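/- **Setting.** Let $H$ be a finite $k$-uniform hypergraph with vertex set $V$, with edge set $E$ (a set of $k$-element subsets of $V$) and with $m=|E|\ge 1$ edges. For $f\in E$ let $N(f)$ be the set of edges $g\ne f$ with $g\cap f\ne\emptyset$, and let $\Delta=\max_{f}|N(f)|$ be the maximum edge degree. Suppose that for some real $\alpha\le 1/3$ $$\text{(i)}\quad 2\mathrm e(\Delta+1)<2^{\alpha k},\qquad\qquad \text{(ii)}\quad \Delta\le \tfrac1{192}\,2^{k/3}.$$ Consider the following randomized algorithm, which answers a sequence of queries about vertices and keeps its memory between queries. (Choices that are left open below — "some", "any", the order of a loop — may be made by an arbitrary rule, which may depend on everything the algorithm has seen so far.) **Statuses.** Each vertex is *uncolored* (initially), *accepted* or *troubled*; accepted and troubled vertices carry a color. *Processing* an uncolored vertex $w$ means: give $w$ a uniformly random one of two colors (independent of the past); mark $w$ troubled if some edge containing $w$ is currently bad, and accepted otherwise. An edge is *safe* if its accepted vertices do not all have the same color. When a vertex of $f$ has just been processed and accepted, $f$ *becomes bad* if at least $(1-\alpha)k$ of its vertices are accepted and they all have the same color; $f$ is *bad* from then on until it is safe. (Acceptances other than by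 processing do not make edges bad.) *Determining* $f$ means processing its uncolored vertices one by one, as long as $f$ is not safe; afterwards $f$ is *unsafe* if it is neither bad nor safe. For a set $S$ of edges, $V(S)=\bigcup S$, and $V_t(S)$ is the set of troubled vertices in $V(S)$; $f|_a$ and $f|_t$ are the sets of accepted and of troubled vertices of $f$. A set of vertices is *monochromatic* if all its vertices have the same current color. Each query starts with all edges unmarked ("not explored"). * *Expanding $(B,U)$ by a bad edge $e$* (marked explored): put $e$ in a queue; while the queue is non-empty, move an edge $f$ from the queue to $B$, and mark as explored and determine every $g\in N(f)$ not yet explored; if $g$ is bad, put it in the queue; if it is unsafe, put it in $U$. * *Expanding $(B,U)$ via an edge $f$*: for every $g\in N(f)$ not yet explored, determine $g$; if $g$ is bad, mark it explored and expand $(B,U)$ by $g$. * *Query $v$*: if $v$ is uncolored, process it. If $v$ is now troubled, build a final component for $v$ and color it. Answer with the color of $v$. * *Building a final component for $v$*: start with $B=U=U_s=\emptyset$; take any bad edge $e\ni v$, mark it explored, determine it, and expand $(B,U)$ by $e$. While $U\cup U_s\neq\emptyset$, do the following two steps. 1. While $U\ne\emptyset$, remove some $f$ from $U$. If $f$ has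 fewer than $\alpha k$ troubled vertices in $V(B)$, determine all edges of $N(f)$, and: if (r1) $f$ intersects two disjoint bad edges that are not in $B$, or (r2) $f\setminus V_t(B)$ is monochromatic, then expand $(B,U)$ via $f$; otherwise, if $f$ has fewer than $\alpha k$ troubled vertices outside $V(B)$, put $f$ in $U_s$. 2. If $U_s\neq\emptyset$, remove some $f$ from $U_s$. If $f$ has fewer than $\alpha k$ troubled vertices in $V(B)$, run the conditional expansion for $f$, and add the returned sets $A,U_A$ to $B,U$. The resulting set $B$ of bad edges is the *final component*. * *Conditional expansion for $f_0$*: start with $A=U_A=\emptyset$, $Q=\{f_0\}$. While $Q\ne\emptyset$: remove some $f$ from $Q$, start with $C=U_C=\emptyset$, expand $(C,U_C)$ via $f$, and add $C,U_C$ to $A,U_A$. (e1) If some edge of $C$ is monochromatic, stop and return $(A,U_A)$. Otherwise determine all neighbours of the edges of $U_C$; if some $g\in U_C$ (e2) is monochromatic or (e3) intersects two disjoint bad edges that are not in $C$, then expand $(A,U_A)$ via one such $g$, stop, and return $(A,U_A)$. Otherwise add to $Q$ all $g\in U_C$ for which $g|_a\cup(g|_t\cap V(C))$ is monochromatic and $g$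 has fewer than $\alpha k$ troubled vertices outside $V(C)$. If $Q$ becomes empty without such a stop, mark all vertices of $V_t(A)$ as accepted and return $(\emptyset,\emptyset)$. In each case the set $A$ of bad edges at the end is a *search area*. * *Coloring a final component $B$*: let $W=V_t(B)$, and let $F$ be the set of non-empty sets $f\cap W$, where $f$ is in $B$ or is an unsafe edge with $|f\cap W|\ge\alpha k$. For at most $\lfloor 2\log_2 m\rfloor$ trials: give independent uniformly random colors to $W$; then for at most $\lfloor 2|F|/\max(\Delta,1)\rfloor$ steps: if some member of $F$ is monochromatic, give new independent uniformly random colors to its vertices; otherwise mark all of $W$ as accepted and finish. If all trials are used up, the algorithm fails and does nothing any more. Thus final components and search areas are always completed, whatever their size. **Proposition.** Under these assumptions, for every (fixed, finite) sequence of queries and every rule for the open choices, the probability that the algorithm constructs, at any time, a final component or a search area consisting of more than $2(\Delta+1)\log_2 m$ bad edges is smaller than $\dfrac2m$. -/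

import Mathlib

open scoped ENNReal

noncomputable section

namespace HypergraphLCA

open scoped Classical

universe u

/-! ### Finite hypergraphs -/

section Hypergraphs

variable {V : Type u} [Fintype V] (H : Hypergraph V)

/-- The finite set of edges of a hypergraph on a finite vertex type. -/
def edges : Finset (Finset V) :=
  Finset.univ.filter fun e => (e : Set V) ∈ H.edgeSet

/-- `H` is `k`-uniform. -/
def IsUniform (k : ℕ) : Prop := ∀ e ∈ edges H, e.card = k

/-- `N(f)`: the edges other than `f` that intersect `f`
(the neighbours of `f` in the line graph). -/
def nbrs (f : Finset V) : Finset (Finset V) :=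
  (edges H).filter fun g => g ≠ f ∧ (g ∩ f).Nonempty

/-- The maximum edge degree `Δ`. -/
def maxEdgeDegree : ℕ := (edges H).sup fun e => (nbrs H e).card

/-- The bound `2 (Δ + 1) log₂ m` on the number of bad edges of a component. -/
def componentBound : ℝ :=
  2 * ((maxEdgeDegree H : ℝ) + 1) * Real.logb 2 ((edges H).card : ℝ)

end Hypergraphs

/-- `V(S)`: the vertices covered by a set of edges `S`. -/
def verts {V : Type u} (S : Finset (Finset V)) : Finset V := S.biUnion id

/-! ### Computation memory -/

inductive Status
  | uncolored
  | accepted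
  | troubled

/-- The memory of the algorithm.
* `status`, `color`: status of every vertex and its current color
  (`false` as a dummy value while the vertex is uncolored);
* `bad`: the edges that have become bad while vertices were processed;
* `explored`: the temporary flags of the current query;
* `hist`: a record of all edges picked so far, each with the colors at that time;
* `found`: the list of all final components and search areas (as sets of bad edges) constructed
  so far;
* `failed`: whether a final coloring phase has failed. -/
structure Memory (V : Type u) where
  status : V → Status
  color : V → Bool
  bad : Finset (Finset V)
  explored : Finset (Finset V)
  hist : List (Finset V × (V → Bool))
  found : List (Finset (Finset V))
  failed : Bool

/-- The memory before the first query. -/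
def Memory.initial (V : Type u) : Memory V where
  status := fun _ => Status.uncolored
  color := fun _ => false
  bad := ∅
  explored := ∅
  hist := []
  found := []
  failed := false

/-- A rule that resolves all unspecified choices of the algorithm ("next edge from ...",
"any bad edge containing ...", the order of the "for" loops). The choice may depend on
everything that the algorithm has seen so far. -/
structure Schedule (V : Type u) where
  edge : Memory V → Finset (Finset V) → Finset V
  edge_mem : ∀ s S, S.Nonempty → edge s S ∈ S
  vertex : Memory V → Finset V → V
  vertex_mem : ∀ s S, S.Nonempty → vertex s S ∈ S

namespace Memory

variable {V : Type u} (s : Memory V)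

/-- Record that the edge `f` has been picked. -/
def log (f : Finset V) : Memory V := { s with hist := (f, s.color) :: s.hist }

/-- Mark the edge `f` as explored. -/
def explore (f : Finset V) : Memory V := { s with explored := insert f s.explored }

/-- Record a constructed final component or search area. -/
def record (C : Finset (Finset V)) : Memory V := { s with found := C :: s.found }

/-- Mark the vertices of `W` as accepted, with their current colors. -/
def accept (W : Finset V) : Memory V :=
  { s with status := fun v => if v ∈ W then Status.accepted else s.status v }

/-- The uncolored vertices of an edge. -/
def uncoloredPart (f : Finset V) : Finset V := f.filter fun v => s.status v = Status.uncolored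

/-- `f|ₐ`: the accepted vertices of `f`. -/
def acceptedPart (f : Finset V) : Finset V := f.filter fun v => s.status v = Status.accepted

/-- `f|ₜ`: the troubled vertices of `f`. -/
def troubledPart (f : Finset V) : Finset V := f.filter fun v => s.status v = Status.troubled

/-- `Vₜ(S)`: the troubled vertices covered by a set of edges `S`. -/
def troubledVerts (S : Finset (Finset V)) : Finset V := s.troubledPart (verts S)

/-- All vertices of `W` have the same current color. -/
def Mono (W : Finset V) : Prop := ∀ v ∈ W, ∀ w ∈ W, s.color v = s.color w

/-- Safe edges are properly colored by their accepted vertices. -/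
def Safe (f : Finset V) : Prop := ¬ s.Mono (s.acceptedPart f)

/-- Edges that have become bad and are not (yet) properly colored by accepted vertices. -/
def Bad (f : Finset V) : Prop := f ∈ s.bad ∧ ¬ s.Safe f

/-- Edges whose status has been determined and that are neither bad nor safe. -/
def Unsafe (f : Finset V) : Prop :=
  s.uncoloredPart f = ∅ ∧ f ∉ s.bad ∧ ¬ s.Safe f

end Memory

/-! ### Loops -/

section Loops

variable {X : Type u}

/-- At most `n` rounds of `while cond do body`. -/
def whileUpTo (cond : X → Prop) (body : X → PMF X) : ℕ → X → PMF X
  | 0, x => PMF.pure x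
  | n + 1, x => if cond x then (body x).bind (whileUpTo cond body n) else PMF.pure x

/-- `while cond do body`, for loops that are certain to stop after a bounded number of rounds
(as all loops below are); `whileUpTo` does nothing any more once `cond` is false. -/
def whileLoop (cond : X → Prop) (body : X → PMF X) (x : X) : PMF X :=
  if h : ∃ n, ∀ y ∈ (whileUpTo cond body n x).support, ¬ cond y then
    whileUpTo cond body (Nat.find h) x
  else PMF.pure x

end Loops

/-- The uniform distribution on the two colors. -/
def coin : PMF Bool := PMF.uniformOfFintype Bool

/-- The local data of a procedure that grows a set `B` of bad edges: the memory, the set `B`, the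
set `U` of collected unsafe edges, and the queue `Q` of bad edges that wait for being expanded
(which is empty outside of `expandBadComp`). -/
structure Area (V : Type u) where
  mem : Memory V
  B : Finset (Finset V)
  U : Finset (Finset V)
  Q : Finset (Finset V)

/-- The local data of `expandOrAccept`: memory, search area `A`, collected unsafe edges `U`, queue
`Q` of unsafe edges to be processed, and whether an amortizing configuration was found. -/
structure Search (V : Type u) where
  mem : Memory V
  A : Finset (Finset V)
  U : Finset (Finset V)
  Q : Finset (Finset V)
  stopped : Bool

/-! ### The algorithm -/

section Algorithm

variable {V : Type u} [Fintype V] (H : Hypergraph V) (k : ℕ) (α : ℝ) (σ : Schedule V)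

/-- Add to the bad edges those edges containing `w` that have at least `(1 - α) k` accepted
vertices, all of the same color. -/
def updateBad (w : V) (s : Memory V) : Memory V :=
  { s with bad := s.bad ∪ (edges H).filter fun e =>
      w ∈ e ∧ (1 - α) * k ≤ ((s.acceptedPart e).card : ℝ) ∧ s.Mono (s.acceptedPart e) }

/-- Process an uncolored vertex: choose a random color, and mark the vertex as troubled if it
belongs to a bad edge and as accepted otherwise. -/
def processVertex (w : V) (s : Memory V) : PMF (Memory V) :=
  coin.bind fun c =>
    if ∃ e ∈ edges H, w ∈ e ∧ s.Bad e then
      PMF.pure { s with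
        status := Function.update s.status w Status.troubled
        color := Function.update s.color w c }
    else
      PMF.pure (updateBad H k α w { s with
        status := Function.update s.status w Status.accepted
        color := Function.update s.color w c })

/-- Process the uncolored vertices of `g` one by one, unless `g` becomes safe. -/
def determine (g : Finset V) : Memory V → PMF (Memory V) :=
  whileLoop (fun s => (s.uncoloredPart g).Nonempty ∧ ¬ s.Safe g)
    (fun s => processVertex H k α (σ.vertex s (s.uncoloredPart g)) s)

/-- `for g ∈ S do body g`. -/
def forEach (S : Finset (Finset V)) (body : Finset V → Area V → PMF (Area V)) (a : Area V) :
    PMF (Area V) :=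
  (whileLoop (fun r : Finset (Finset V) × Area V => r.1.Nonempty)
    (fun r =>
      let g := σ.edge r.2.mem r.1
      (body g { r.2 with mem := r.2.mem.log g }).map fun a' => (r.1.erase g, a'))
    (S, a)).map Prod.snd

/-- Determine the statuses of all edges intersecting `f`. -/
def determineNbrs (f : Finset V) : Area V → PMF (Area V) :=
  forEach σ (nbrs H f) fun g a => (determine H k α σ g a.mem).map fun s => { a with mem := s }

/-- One round of `expandBadComp`: move an edge from the queue to `B`, and explore its
neighbours. -/
def expandBadCompStep (a : Area V) : PMF (Area V) :=
  let f := σ.edge a.mem a.Q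
  forEach σ (nbrs H f)
    (fun g b =>
      if g ∈ b.mem.explored then PMF.pure b
      else (determine H k α σ g (b.mem.explore g)).map fun s =>
        if s.Bad g then { b with mem := s, Q := insert g b.Q }
        else if s.Unsafe g then { b with mem := s, U := insert g b.U }
        else { b with mem := s })
    { mem := a.mem.log f, B := insert f a.B, U := a.U, Q := a.Q.erase f }

/-- Expand `B` by the bad-component of the bad edge `e`, collecting in `U` the non-explored unsafe
edges adjacent to it. -/
def expandBadComp (e : Finset V) (a : Area V) : PMF (Area V) :=
  whileLoop (fun b : Area V => b.Q.Nonempty) (expandBadCompStep H k α σ) { a with Q := {e} }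

/-- Expand `B` by the non-explored bad-components intersected by the unsafe edge `f`. -/
def expandViaUnsafe (f : Finset V) : Area V → PMF (Area V) :=
  forEach σ (nbrs H f) fun g a =>
    if g ∈ a.mem.explored then PMF.pure a
    else (determine H k α σ g a.mem).bind fun s =>
      if s.Bad g then expandBadComp H k α σ g { a with mem := s.explore g }
      else PMF.pure { a with mem := s }

/-- `f` intersects at least two disjoint bad edges outside `B`. -/
def MeetsTwoDisjointBad (s : Memory V) (B : Finset (Finset V)) (f : Finset V) : Prop :=
  ∃ g₁ ∈ edges H, ∃ g₂ ∈ edges H, s.Bad g₁ ∧ s.Bad g₂ ∧ g₁ ∉ B ∧ g₂ ∉ B ∧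
    (g₁ ∩ f).Nonempty ∧ (g₂ ∩ f).Nonempty ∧ Disjoint g₁ g₂

/-- `f` has fewer than `α k` troubled vertices in `V(B)`. -/
def FewInside (s : Memory V) (B : Finset (Finset V)) (f : Finset V) : Prop :=
  ((s.troubledPart f ∩ verts B).card : ℝ) < α * k

/-- `f` has fewer than `α k` troubled vertices outside `V(B)`. -/
def FewOutside (s : Memory V) (B : Finset (Finset V)) (f : Finset V) : Prop :=
  ((s.troubledPart f \ verts B).card : ℝ) < α * k

/-- `g` may cause an activation of `C`: its accepted vertices and its troubled vertices in `V(C)`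
all have the same color. -/
def MayActivate (s : Memory V) (C : Finset (Finset V)) (g : Finset V) : Prop :=
  s.Mono (s.acceptedPart g ∪ (s.troubledPart g ∩ verts C))

/-- One round of the main loop of `expandOrAccept`. Here `c.B` is the newly expanded set `C` of bad
edges, and `c.U` the set of unsafe edges explored around it. -/
def searchStep (t : Search V) : PMF (Search V) :=
  let f := σ.edge t.mem t.Q
  (expandViaUnsafe H k α σ f { mem := t.mem.log f, B := ∅, U := ∅, Q := ∅ }).bind fun c =>
    if ∃ g ∈ c.B, c.mem.Mono g then
      PMF.pure { mem := c.mem, A := t.A ∪ c.B, U := t.U ∪ c.U, Q := t.Q.erase f, stopped := true }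
    else
      (forEach σ c.U (determineNbrs H k α σ)
          { mem := c.mem, B := t.A ∪ c.B, U := t.U ∪ c.U, Q := ∅ }).bind fun d =>
        let amortizing := c.U.filter fun g =>
          d.mem.Mono g ∨ MeetsTwoDisjointBad H d.mem c.B g
        if amortizing.Nonempty then
          let g := σ.edge d.mem amortizing
          (expandViaUnsafe H k α σ g { d with mem := d.mem.log g }).map fun a =>
            { mem := a.mem, A := a.B, U := a.U, Q := t.Q.erase f, stopped := true }
        else
          PMF.pure
            { mem := d.mem, A := d.B, U := d.U, stopped := false
              Q := t.Q.erase f ∪ c.U.filter fun g =>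
                MayActivate d.mem c.B g ∧ FewOutside k α d.mem c.B g }

/-- The conditional expansion via the unsafe edge `e`. The search area is recorded in any case. If
an amortizing configuration was found, it is returned in the fields `B` and `U`; otherwise its
troubled vertices are accepted, and empty sets are returned. -/
def expandOrAccept (e : Finset V) (s : Memory V) : PMF (Area V) :=
  (whileLoop (fun t : Search V => t.Q.Nonempty ∧ t.stopped = false) (searchStep H k α σ)
    { mem := s, A := ∅, U := ∅, Q := {e}, stopped := false }).map fun t =>
      if t.stopped = true then { mem := t.mem.record t.A, B := t.A, U := t.U, Q := ∅ }
      else { mem := (t.mem.record t.A).accept (t.mem.troubledVerts t.A), B := ∅, U := ∅, Q := ∅ }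

/-- Process one edge from `U` by the extension rules (r1) and (r2); the second component collects
the edges that can satisfy rule (r3). -/
def extendStep (r : Area V × Finset (Finset V)) : PMF (Area V × Finset (Finset V)) :=
  let f := σ.edge r.1.mem r.1.U
  let a : Area V := { r.1 with mem := r.1.mem.log f, U := r.1.U.erase f }
  if FewInside k α a.mem a.B f then
    (determineNbrs H k α σ f a).bind fun b =>
      if MeetsTwoDisjointBad H b.mem b.B f ∨ b.mem.Mono (f \ b.mem.troubledVerts b.B) then
        (expandViaUnsafe H k α σ f b).map fun c => (c, r.2)
      else if FewOutside k α b.mem b.B f then PMF.pure (b, insert f r.2)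
      else PMF.pure (b, r.2)
  else PMF.pure (a, r.2)

/-- One round of the main loop of `buildFinalComponent`: apply (r1) and (r2) as long as possible,
then apply (r3) once. -/
def buildStep (r : Area V × Finset (Finset V)) : PMF (Area V × Finset (Finset V)) :=
  (whileLoop (fun q : Area V × Finset (Finset V) => q.1.U.Nonempty) (extendStep H k α σ) r).bind
    fun q =>
      if q.2.Nonempty then
        let f := σ.edge q.1.mem q.2
        let a : Area V := { q.1 with mem := q.1.mem.log f }
        if FewInside k α a.mem a.B f then
          (expandOrAccept H k α σ f a.mem).map fun b =>
            ({ mem := b.mem, B := a.B ∪ b.B, U := a.U ∪ b.U, Q := ∅ }, q.2.erase f)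
        else PMF.pure (a, q.2.erase f)
      else PMF.pure q

/-- Build (and record) the final component of a troubled vertex `v`. It is never interrupted
because of its size. -/
def buildFinalComponent (v : V) (s : Memory V) : PMF (Area V) :=
  let e := σ.edge s ((edges H).filter fun e => v ∈ e ∧ s.Bad e)
  let s₀ : Memory V := { s.log e with explored := {e} }
  (determine H k α σ e s₀).bind fun s₁ =>
    (expandBadComp H k α σ e { mem := s₁, B := ∅, U := ∅, Q := ∅ }).bind fun a =>
      (whileLoop
        (fun r : Area V × Finset (Finset V) => r.1.U.Nonempty ∨ r.2.Nonempty)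
        (buildStep H k α σ) (a, ∅)).map fun r =>
          { r.1 with mem := r.1.mem.record r.1.B }

/-- Assign new independent random colors to all vertices of `W`. -/
def recolor (W : Finset V) (s : Memory V) : PMF (Memory V) :=
  (PMF.uniformOfFintype (V → Bool)).map fun c =>
    { s with color := fun v => if v ∈ W then c v else s.color v }

/-- RESAMPLE with at most the given number of steps, for the hypergraph with vertex set `W` and
edge set `F`. The result is `Sum.inl` if a proper coloring was found (whose colors are then
accepted), and `Sum.inr` otherwise. -/
def resample (W : Finset V) (F : Finset (Finset V)) : ℕ → Memory V → PMF (Memory V ⊕ Memory V)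
  | 0, s => PMF.pure (Sum.inr s)
  | n + 1, s =>
    if (F.filter fun f => s.Mono f).Nonempty then
      let f := σ.edge s (F.filter fun f => s.Mono f)
      (recolor f (s.log f)).bind (resample W F n)
    else PMF.pure (Sum.inl (s.accept W))

/-- At most the given number of trials of RESAMPLE with at most `steps` steps each. -/
def resampleTrials (W : Finset V) (F : Finset (Finset V)) (steps : ℕ) :
    ℕ → Memory V → PMF (Memory V)
  | 0, s => PMF.pure { s with failed := true }
  | n + 1, s =>
    (recolor W s).bind fun s₁ => (resample σ W F steps s₁).bind fun
      | Sum.inl s₂ => PMF.pure s₂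
      | Sum.inr s₂ => resampleTrials W F steps n s₂

/-- The final coloring phase for the final component with the set `B` of bad edges. -/
def colorFinalComponent (B : Finset (Finset V)) (s : Memory V) : PMF (Memory V) :=
  let W := s.troubledVerts B
  let extra := (edges H).filter fun f => s.Unsafe f ∧ α * k ≤ ((f ∩ W).card : ℝ)
  let F := ((B ∪ extra).image fun f => f ∩ W).filter fun f => f.Nonempty
  let steps := ⌊2 * ((F.card : ℝ) / (max (maxEdgeDegree H) 1 : ℕ))⌋₊
  let trials := ⌊2 * Real.logb 2 ((edges H).card : ℝ)⌋₊
  resampleTrials σ W F steps trials s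

/-- Answer a query about the vertex `v` (the answer is the color of `v` in the final memory). -/
def query (v : V) (s : Memory V) : PMF (Memory V) :=
  if s.failed = true then PMF.pure s
  else
    (if s.status v = Status.uncolored then processVertex H k α v s else PMF.pure s).bind fun s₁ =>
      if s₁.status v = Status.troubled then
        (buildFinalComponent H k α σ v s₁).bind fun a =>
          colorFinalComponent H k α σ a.B a.mem
      else PMF.pure s₁

/-- The distribution of the memory after answering a sequence of queries. -/
def run : List V → Memory V → PMF (Memory V)
  | [], s => PMF.pure s
  | v :: vs, s => (query H k α σ v s).bind (run vs)

end Algorithm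

end HypergraphLCA

end

/-!
The proof is a union bound over trees of unlikely events. Whenever the algorithm records a large
set of bad edges, the events that forced it to do so can be arranged as a *witness tree* (`WTree`):
its nodes are edges of the hypergraph, adjacent nodes are intersecting edges, and most nodes stand
for an event that says that many vertices of the edge have the same color (`Kind`). Since a vertex
may be recolored and since the algorithm decides adaptively which vertices it treats, the
probabilities of these events are not estimated in advance. Instead, the union bound is carried
along as a supermartingale.

**The potential.** The `potential` of the memory is `1` once a large set has been recorded, `0` if
the coloring has failed before, and otherwise the sum, over all admissible trees, of the products
of upper bounds on the conditional probabilities of the events of the tree (`treePhi`). The events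
of a tree concern disjoint edges, so a coin toss influences at most one factor, and on average this
factor does not increase (`spec_processVertex`). Accepting troubled vertices, with or without new
colors, does not increase the potential either (`AcceptLike.potential_le`): an event whose edge
contains such a vertex has become impossible, because the edge meets an ever-bad edge that is safe
now. So the expected potential never exceeds the initial one (`spec_run`), provided that it has
already reached `1` when a large set is recorded (`potential_record_le`).

**Witnesses.** This is the case because the invariants of the algorithm (`Growing`, `Running`,
`Stopped`) contain a witness tree whose events have all occurred, and which covers the recorded set
(`Witness`). A covering event meets at most `Δ + 1` edges, so a set of more than
`2 (Δ + 1) log₂ m` bad edges needs more than `2 log₂ m` covering nodes (`Witness.card_le`).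
Each event has a credit, the number of tree edges that it can pay for (`Kind.credit`), and the
`surplus` of the credits over the edges must remain positive. An extension of the component comes
with an event, or with two disjoint bad edges, that pays for its connection to the tree
(`Witness.extend`). A conditional expansion needs more care: the condition for its extension steps
refers to the troubled vertices of the components explored so far, but the witness tree has to be
rooted where an amortizing configuration is found, and this is where the search ends. Therefore a
link between two components can be used in both directions (`Linked.grow`): the event of the
connecting edge exempts the troubled vertices on one side of the link or those on the other side,
and the *levels* of the nodes tell these sides apart. Rooted at an amortizing configuration, the
tree of a search area has one unit more of surplus (`FinalArea.exists_witness`). Together with the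
weaker event that the accepted vertices of the first edge `f₀` of the search have the same color,
it pays for joining the tree of the search area to that of the component
(`Witness.join_finalArea`).

**The initial potential.** At the beginning, an event of credit `c` has probability at most
`2 · 2 ^ (- c k / 3)`, where `2 ^ (k / 3) ≥ 192 Δ`. So the credits pay for the choice among `Δ`
neighbours at every edge of the tree, and a positive constant factor per node remains. It pays for
the shape of the tree, the kinds and the levels (the generating function `WTree.tsum_weight_le`),
and for a further factor `2` per covering node, which amounts to `m²` for a large component. There
are `m` roots, so the initial potential is less than `1 / m` (`sq_mul_potential_initial_le`).
-/

open scoped ENNReal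

noncomputable section

namespace HypergraphLCA

open scoped Classical

universe u

set_option linter.unusedSectionVars false

/-! ### Postconditions together with expectation bounds -/

section Specifications

variable {X Y : Type u}

/-- The distribution `μ` is supported on `Q`, and the expectation of `F` under `μ` is at
most `c`. Taking for `F` the potential of the memory and for `c` its present value, this is one step
of a supermartingale together with a postcondition. -/
def Spec (F : X → ℝ≥0∞) (μ : PMF X) (c : ℝ≥0∞) (Q : X → Prop) : Prop :=
  (∀ y ∈ μ.support, Q y) ∧ ∑' y, μ y * F y ≤ c

theorem Spec.mono {F : X → ℝ≥0∞} {μ : PMF X} {c c' : ℝ≥0∞} {P Q : X → Prop}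
    (h : Spec F μ c P) (hc : c ≤ c') (hPQ : ∀ x, P x → Q x) : Spec F μ c' Q :=
  ⟨fun y hy => hPQ y (h.1 y hy), h.2.trans hc⟩

theorem Spec.post {F : X → ℝ≥0∞} {μ : PMF X} {c : ℝ≥0∞} {P Q : X → Prop}
    (h : Spec F μ c P) (hPQ : ∀ x, P x → Q x) : Spec F μ c Q := h.mono le_rfl hPQ

theorem expect_pure (F : X → ℝ≥0∞) (x : X) : ∑' y, (PMF.pure x) y * F y = F x := by
  rw [tsum_eq_single x]
  · simp
  · intro y hy
    simp [PMF.pure_apply, hy]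

theorem expect_bind (μ : PMF X) (κ : X → PMF Y) (G : Y → ℝ≥0∞) :
    ∑' y, (μ.bind κ) y * G y = ∑' x, μ x * ∑' y, κ x y * G y := by
  simp_rw [PMF.bind_apply, ← ENNReal.tsum_mul_right, ← ENNReal.tsum_mul_left]
  rw [ENNReal.tsum_comm]
  simp_rw [mul_assoc]

theorem Spec.pure {F : X → ℝ≥0∞} {x : X} {c : ℝ≥0∞} {Q : X → Prop} (hQ : Q x) (hc : F x ≤ c) :
    Spec F (PMF.pure x) c Q := by
  refine ⟨fun y hy => ?_, by rwa [expect_pure]⟩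
  rw [PMF.mem_support_pure_iff] at hy
  exact hy ▸ hQ

theorem Spec.bind {F : X → ℝ≥0∞} {G : Y → ℝ≥0∞} {μ : PMF X} {κ : X → PMF Y} {c : ℝ≥0∞}
    {P : X → Prop} {Q : Y → Prop} (h : Spec F μ c P) (hκ : ∀ x, P x → Spec G (κ x) (F x) Q) :
    Spec G (μ.bind κ) c Q := by
  refine ⟨fun y hy => ?_, ?_⟩
  · obtain ⟨x, hx, hy⟩ := (PMF.mem_support_bind_iff _ _ _).1 hy
    exact (hκ x (h.1 x hx)).1 y hy
  · rw [expect_bind]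
    refine le_trans (ENNReal.tsum_le_tsum fun x => ?_) h.2
    by_cases hx : μ x = 0
    · simp [hx]
    · exact mul_le_mul_right (hκ x (h.1 x ((PMF.mem_support_iff _ _).2 hx))).2 _

theorem Spec.map {F : X → ℝ≥0∞} {G : Y → ℝ≥0∞} {μ : PMF X} {f : X → Y} {c : ℝ≥0∞}
    {P : X → Prop} {Q : Y → Prop} (h : Spec F μ c P) (hf : ∀ x, P x → Q (f x) ∧ G (f x) ≤ F x) :
    Spec G (μ.map f) c Q :=
  h.bind fun x hx => Spec.pure (hf x hx).1 (hf x hx).2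

theorem Spec.of_support {F : X → ℝ≥0∞} {μ : PMF X} {c : ℝ≥0∞} {Q : X → Prop}
    (h : ∀ x ∈ μ.support, Q x ∧ F x ≤ c) : Spec F μ c Q := by
  refine ⟨fun x hx => (h x hx).1, ?_⟩
  calc ∑' x, μ x * F x ≤ ∑' x, μ x * c := ENNReal.tsum_le_tsum fun x => by
        by_cases hx : μ x = 0
        · simp [hx]
        · exact mul_le_mul_right (h x ((PMF.mem_support_iff _ _).2 hx)).2 _
    _ = c := by rw [ENNReal.tsum_mul_right, PMF.tsum_coe, one_mul]

theorem spec_whileUpTo {F : X → ℝ≥0∞} {cond : X → Prop} {body : X → PMF X} {I : X → Prop}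
    (hbody : ∀ x, I x → cond x → Spec F (body x) (F x) I) (n : ℕ) :
    ∀ x, I x → Spec F (whileUpTo cond body n x) (F x) I := by
  induction n with
  | zero => intro x hx; exact Spec.pure hx le_rfl
  | succ n ih =>
    intro x hx
    rw [whileUpTo]
    split_ifs with hc
    · exact (hbody x hx hc).bind ih
    · exact Spec.pure hx le_rfl

/-- Partial correctness of `whileLoop`: an invariant of the body holds at the end. -/
theorem spec_whileLoop {F : X → ℝ≥0∞} {cond : X → Prop} {body : X → PMF X} {I : X → Prop}
    (hbody : ∀ x, I x → cond x → Spec F (body x) (F x) I) {x : X} (hx : I x) :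
    Spec F (whileLoop cond body x) (F x) I := by
  rw [whileLoop]
  split_ifs with h
  · exact spec_whileUpTo hbody _ x hx
  · exact Spec.pure hx le_rfl

theorem whileUpTo_terminates {cond : X → Prop} {body : X → PMF X} {I : X → Prop} {m : X → ℕ}
    (hbody : ∀ x, I x → cond x → ∀ y ∈ (body x).support, I y ∧ m y < m x) (n : ℕ) :
    ∀ x, I x → m x ≤ n → ∀ y ∈ (whileUpTo cond body n x).support, ¬ cond y := by
  induction n with
  | zero =>
    intro x hx hm y hy hc
    rw [whileUpTo, PMF.mem_support_pure_iff] at hy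
    subst hy
    obtain ⟨z, hz⟩ := (body y).support_nonempty
    have := (hbody y hx hc z hz).2
    omega
  | succ n ih =>
    intro x hx hm y hy
    rw [whileUpTo] at hy
    split_ifs at hy with hc
    · obtain ⟨z, hz, hy⟩ := (PMF.mem_support_bind_iff _ _ _).1 hy
      have hz' := hbody x hx hc z hz
      exact ih z hz'.1 (by omega) y hy
    · rw [PMF.mem_support_pure_iff] at hy
      exact hy ▸ hc

/-- Total correctness of `whileLoop`: if moreover a natural number decreases in every round,
then the condition is false at the end. -/
theorem spec_whileLoop_of_measure {F : X → ℝ≥0∞} {cond : X → Prop} {body : X → PMF X}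
    {I : X → Prop} (m : X → ℕ)
    (hbody : ∀ x, I x → cond x → Spec F (body x) (F x) fun y => I y ∧ m y < m x) {x : X}
    (hx : I x) : Spec F (whileLoop cond body x) (F x) fun y => I y ∧ ¬ cond y := by
  have hterm := whileUpTo_terminates (fun x hx hc => (hbody x hx hc).1) (m x) x hx le_rfl
  have hex : ∃ n, ∀ y ∈ (whileUpTo cond body n x).support, ¬ cond y := ⟨_, hterm⟩
  have h1 := spec_whileUpTo (F := F) (I := I)
    (fun x hx hc => (hbody x hx hc).post fun _ hy => hy.1) (Nat.find hex) x hx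
  rw [whileLoop, dif_pos hex]
  exact ⟨fun y hy => ⟨h1.1 y hy, Nat.find_spec hex y hy⟩, h1.2⟩

end Specifications

/-- The rule for `forEach`; `J S a` is the invariant when the edges of `S` still have to be
treated. -/
theorem spec_forEach {V : Type u} {σ : Schedule V} {F : Area V → ℝ≥0∞}
    {body : Finset V → Area V → PMF (Area V)} (J : Finset (Finset V) → Area V → Prop)
    (hbody : ∀ S a g, g ∈ S → J S a →
      Spec F (body g { a with mem := a.mem.log g }) (F a) (J (S.erase g)))
    {S : Finset (Finset V)} {a : Area V} (ha : J S a) :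
    Spec F (forEach σ S body a) (F a) (J ∅) := by
  have h := spec_whileLoop_of_measure (F := fun r : Finset (Finset V) × Area V => F r.2)
    (cond := fun r : Finset (Finset V) × Area V => r.1.Nonempty)
    (body := fun r => (body (σ.edge r.2.mem r.1)
      { r.2 with mem := r.2.mem.log (σ.edge r.2.mem r.1) }).map
        fun a' => (r.1.erase (σ.edge r.2.mem r.1), a'))
    (I := fun r => J r.1 r.2) (fun r => r.1.card)
    (fun r hr hc => by
      have hmem := σ.edge_mem r.2.mem r.1 hc
      exact (hbody r.1 r.2 _ hmem hr).map fun a' ha' =>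
        ⟨⟨ha', Finset.card_erase_lt_of_mem hmem⟩, le_rfl⟩)
    (x := (S, a)) ha
  refine Spec.map h fun r hr => ⟨?_, le_rfl⟩
  have : r.1 = ∅ := Finset.not_nonempty_iff_eq_empty.1 hr.2
  exact this ▸ hr.1

/-! ### Invariants of the memory -/

section MemoryFacts

variable {V : Type u} [Fintype V] {H : Hypergraph V} {k : ℕ} {α : ℝ}

/-- The standing numerical assumptions. The condition `1 ≤ α k` is all that is needed of the
condition of the local lemma. -/
structure Params (H : Hypergraph V) (k : ℕ) (α : ℝ) : Prop where
  unif : IsUniform H k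
  one_le : 1 ≤ α * k
  le_third : α ≤ 1 / 3

theorem mem_nbrs {f g : Finset V} : g ∈ nbrs H f ↔ g ∈ edges H ∧ g ≠ f ∧ (g ∩ f).Nonempty := by
  simp [nbrs]

theorem nbrs_symm {f g : Finset V} (hf : f ∈ edges H) (h : g ∈ nbrs H f) : f ∈ nbrs H g := by
  rw [mem_nbrs] at h ⊢
  exact ⟨hf, h.2.1.symm, by rw [Finset.inter_comm]; exact h.2.2⟩

theorem mem_nbrs_of_mem {f g : Finset V} {w : V} (hg : g ∈ edges H) (hne : g ≠ f) (hwg : w ∈ g)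
    (hwf : w ∈ f) : g ∈ nbrs H f :=
  mem_nbrs.2 ⟨hg, hne, w, Finset.mem_inter.2 ⟨hwg, hwf⟩⟩

theorem mem_edges_of_mem_nbrs {f g : Finset V} (h : g ∈ nbrs H f) : g ∈ edges H := (mem_nbrs.1 h).1

theorem mem_verts {S : Finset (Finset V)} {w : V} : w ∈ verts S ↔ ∃ g ∈ S, w ∈ g := by
  simp [verts]

namespace Memory

/-- The status of `f` has been determined. -/
def Det (s : Memory V) (f : Finset V) : Prop := s.uncoloredPart f = ∅ ∨ s.Safe f

theorem mem_uncoloredPart {s : Memory V} {f : Finset V} {w : V} :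
    w ∈ s.uncoloredPart f ↔ w ∈ f ∧ s.status w = Status.uncolored := by simp [uncoloredPart]

theorem mem_acceptedPart {s : Memory V} {f : Finset V} {w : V} :
    w ∈ s.acceptedPart f ↔ w ∈ f ∧ s.status w = Status.accepted := by simp [acceptedPart]

theorem mem_troubledPart {s : Memory V} {f : Finset V} {w : V} :
    w ∈ s.troubledPart f ↔ w ∈ f ∧ s.status w = Status.troubled := by simp [troubledPart]

theorem uncoloredPart_eq_empty {s : Memory V} {f : Finset V} :
    s.uncoloredPart f = ∅ ↔ ∀ w ∈ f, s.status w ≠ Status.uncolored := by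
  simp [uncoloredPart, Finset.filter_eq_empty_iff]

theorem safe_iff {s : Memory V} {f : Finset V} :
    s.Safe f ↔ ∃ v ∈ f, ∃ w ∈ f, s.status v = Status.accepted ∧ s.status w = Status.accepted ∧
      s.color v ≠ s.color w := by
  unfold Safe Mono
  push Not
  simp only [mem_acceptedPart]
  constructor
  · rintro ⟨v, hv, w, hw, h⟩; exact ⟨v, hv.1, w, hw.1, hv.2, hw.2, h⟩
  · rintro ⟨v, hv, w, hw, h1, h2, h⟩; exact ⟨v, ⟨hv, h1⟩, w, ⟨hw, h2⟩, h⟩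

theorem Mono.subset {s : Memory V} {W W' : Finset V} (h : s.Mono W) (hs : W' ⊆ W) : s.Mono W' :=
  fun v hv w hw => h v (hs hv) w (hs hw)

theorem Bad.not_safe {s : Memory V} {f : Finset V} (h : s.Bad f) : ¬ s.Safe f := h.2

theorem Bad.det_iff {s : Memory V} {f : Finset V} (h : s.Bad f) :
    s.Det f ↔ s.uncoloredPart f = ∅ := by
  simp [Det, h.not_safe]

end Memory

/-- The properties of the memory that hold whenever no coloring phase is under way. In `settled`, an
ever-bad edge that is safe now has been given its colors in a coloring phase or by a search area; all
edges around it had been determined before, and the bad ones among them have become safe, too. -/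
structure Inv (H : Hypergraph V) (k : ℕ) (α : ℝ) (s : Memory V) : Prop where
  bad_sub : ∀ g ∈ s.bad, g ∈ edges H
  troubled : ∀ w, s.status w = Status.troubled → ∃ g ∈ edges H, w ∈ g ∧ s.Bad g
  settled : ∀ g ∈ s.bad, s.Safe g → ∀ h ∈ nbrs H g, s.Det h ∧ (h ∈ s.bad → s.Safe h)
  few : ∀ g ∈ edges H, g ∉ s.bad → ¬ s.Det g → ((s.acceptedPart g).card : ℝ) < (1 - α) * k
  not_accepted : ∀ g, s.Bad g → ∃ w ∈ g, s.status w ≠ Status.accepted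

/-- The possible changes from `s` to `s'` while vertices are processed and edges are explored. Colors
and statuses are permanent in this relation, and the badness of an edge is decided when it is
determined (`bad_det`). -/
structure Ext (H : Hypergraph V) (s s' : Memory V) : Prop where
  keep : ∀ v, s.status v ≠ Status.uncolored → s'.status v = s.status v ∧ s'.color v = s.color v
  bad_mono : s.bad ⊆ s'.bad
  explored : s.explored ⊆ s'.explored
  bad_det : ∀ g ∈ edges H, s.Det g → g ∈ s'.bad → g ∈ s.bad
  bad_stays : ∀ g, s.Bad g → s'.Bad g
  new_bad : ∀ g ∈ s'.bad, s'.Safe g → g ∈ s.bad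
  failed : s'.failed = s.failed

theorem Ext.refl (s : Memory V) : Ext H s s :=
  ⟨fun _ _ => ⟨rfl, rfl⟩, subset_rfl, subset_rfl, fun _ _ _ h => h, fun _ h => h, fun _ h _ => h, rfl⟩

theorem safe_of_keep {s s' : Memory V} (h : ∀ v, s.status v ≠ Status.uncolored →
    s'.status v = s.status v ∧ s'.color v = s.color v) {g : Finset V} (hg : s.Safe g) :
    s'.Safe g := by
  rw [Memory.safe_iff] at hg ⊢
  obtain ⟨v, hv, w, hw, h1, h2, hne⟩ := hg
  have hv' := h v (by rw [h1]; exact Status.noConfusion)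
  have hw' := h w (by rw [h2]; exact Status.noConfusion)
  exact ⟨v, hv, w, hw, hv'.1.trans h1, hw'.1.trans h2, by rw [hv'.2, hw'.2]; exact hne⟩

namespace Ext

variable {s s' s'' : Memory V}

theorem safe (h : Ext H s s') {g : Finset V} (hg : s.Safe g) : s'.Safe g := safe_of_keep h.keep hg

theorem colored (h : Ext H s s') {g : Finset V} (hg : s.uncoloredPart g = ∅) :
    s'.uncoloredPart g = ∅ := by
  rw [Memory.uncoloredPart_eq_empty] at hg ⊢
  intro w hw
  rw [(h.keep w (hg w hw)).1]
  exact hg w hw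

theorem det (h : Ext H s s') {g : Finset V} (hg : s.Det g) : s'.Det g :=
  hg.imp h.colored h.safe

theorem trans (h : Ext H s s') (h' : Ext H s' s'') : Ext H s s'' where
  keep v hv := by
    have h1 := h.keep v hv
    have h2 := h'.keep v (by rw [h1.1]; exact hv)
    exact ⟨h2.1.trans h1.1, h2.2.trans h1.2⟩
  bad_mono := h.bad_mono.trans h'.bad_mono
  explored := h.explored.trans h'.explored
  bad_det g hg hd hb := h.bad_det g hg hd (h'.bad_det g hg (h.det hd) hb)
  bad_stays g hg := h'.bad_stays g (h.bad_stays g hg)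
  new_bad g hg hs := by
    have hg' := h'.new_bad g hg hs
    refine h.new_bad g hg' ?_
    by_contra hn
    exact (h'.bad_stays g ⟨hg', hn⟩).2 hs
  failed := h'.failed.trans h.failed

theorem Bad_of (h : Ext H s s') {g : Finset V} (hg : g ∈ edges H) (hd : s.Det g)
    (hb : s'.Bad g) : s.Bad g :=
  ⟨h.bad_det g hg hd hb.1, fun hs => hb.2 (h.safe hs)⟩

theorem safe_of_colored (h : Ext H s s') {g : Finset V} (hg : s.uncoloredPart g = ∅)
    (hs : s'.Safe g) : s.Safe g := by
  rw [Memory.uncoloredPart_eq_empty] at hg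
  rw [Memory.safe_iff] at hs ⊢
  obtain ⟨v, hv, w, hw, h1, h2, hne⟩ := hs
  have hv' := h.keep v (hg v hv)
  have hw' := h.keep w (hg w hw)
  exact ⟨v, hv, w, hw, hv'.1 ▸ h1, hw'.1 ▸ h2, by rw [← hv'.2, ← hw'.2]; exact hne⟩

/-- Ever-bad edges become safe only in coloring phases or when a search area is accepted. -/
theorem safe_of_mem_bad (h : Ext H s s') {g : Finset V} (hg : g ∈ s.bad) (hs : s'.Safe g) :
    s.Safe g := by
  by_contra hn
  exact (h.bad_stays g ⟨hg, hn⟩).2 hs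

theorem acceptedPart_eq (h : Ext H s s') {g : Finset V} (hg : s.uncoloredPart g = ∅) :
    s'.acceptedPart g = s.acceptedPart g := by
  rw [Memory.uncoloredPart_eq_empty] at hg
  ext w
  simp only [Memory.mem_acceptedPart]
  exact and_congr_right fun hw => by rw [(h.keep w (hg w hw)).1]

theorem troubledPart_eq (h : Ext H s s') {g : Finset V} (hg : s.uncoloredPart g = ∅) :
    s'.troubledPart g = s.troubledPart g := by
  rw [Memory.uncoloredPart_eq_empty] at hg
  ext w
  simp only [Memory.mem_troubledPart]
  exact and_congr_right fun hw => by rw [(h.keep w (hg w hw)).1]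

theorem mono_iff (h : Ext H s s') {g : Finset V} (hg : s.uncoloredPart g = ∅) {W : Finset V}
    (hW : W ⊆ g) : s'.Mono W ↔ s.Mono W := by
  rw [Memory.uncoloredPart_eq_empty] at hg
  unfold Memory.Mono
  refine forall₂_congr fun v hv => forall₂_congr fun w hw => ?_
  rw [(h.keep v (hg v (hW hv))).2, (h.keep w (hg w (hW hw))).2]

end Ext

/-! ### Processing a vertex -/

/-- The vertex `w` belongs to a bad edge, and will be marked as troubled when processed. -/
def Hot (H : Hypergraph V) (w : V) (s : Memory V) : Prop := ∃ e ∈ edges H, w ∈ e ∧ s.Bad e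

/-- The memory after processing `w` with the random color `c`. -/
def processOut (H : Hypergraph V) (k : ℕ) (α : ℝ) (w : V) (s : Memory V) (c : Bool) : Memory V :=
  if Hot H w s then
    { s with
      status := Function.update s.status w Status.troubled
      color := Function.update s.color w c }
  else
    updateBad H k α w { s with
      status := Function.update s.status w Status.accepted
      color := Function.update s.color w c }

theorem processVertex_eq (w : V) (s : Memory V) :
    processVertex H k α w s = coin.bind fun c => PMF.pure (processOut H k α w s c) := by
  unfold processVertex processOut Hot
  congr 1
  funext c
  split_ifs <;> rfl

theorem coin_apply (c : Bool) : coin c = 2⁻¹ := by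
  simp [coin, PMF.uniformOfFintype_apply]

theorem spec_processVertex_of_le {w : V} {s : Memory V} {F : Memory V → ℝ≥0∞} {b : ℝ≥0∞}
    {Q : Memory V → Prop} (hQ : ∀ c, Q (processOut H k α w s c))
    (hF : F (processOut H k α w s true) + F (processOut H k α w s false) ≤ 2 * b) :
    Spec F (processVertex H k α w s) b Q := by
  rw [processVertex_eq]
  refine ⟨fun y hy => ?_, ?_⟩
  · obtain ⟨c, -, hy⟩ := (PMF.mem_support_bind_iff _ _ _).1 hy
    rw [PMF.mem_support_pure_iff] at hy
    exact hy ▸ hQ c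
  · have h1 : ∑' y, (coin.bind fun c => PMF.pure (processOut H k α w s c)) y * F y
        = ∑' c, coin c * F (processOut H k α w s c) := by
      simp_rw [PMF.bind_apply, ← ENNReal.tsum_mul_right]
      rw [ENNReal.tsum_comm]
      refine tsum_congr fun c => ?_
      simp_rw [mul_assoc]
      rw [ENNReal.tsum_mul_left, expect_pure]
    rw [h1, tsum_fintype, Fintype.sum_bool, coin_apply, coin_apply, ← mul_add]
    calc (2 : ℝ≥0∞)⁻¹ * _ ≤ 2⁻¹ * (2 * b) := mul_le_mul_right hF _
      _ = b := by rw [← mul_assoc, ENNReal.inv_mul_cancel (by simp) (by simp), one_mul]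

section ProcessOut

variable {w : V} {s : Memory V} {c : Bool}

theorem processOut_status (v : V) : (processOut H k α w s c).status v =
    if v = w then (if Hot H w s then Status.troubled else Status.accepted) else s.status v := by
  unfold processOut
  split_ifs <;> simp_all [updateBad]

theorem processOut_color (v : V) : (processOut H k α w s c).color v =
    if v = w then c else s.color v := by
  unfold processOut
  split_ifs <;> simp_all [updateBad]

theorem processOut_explored : (processOut H k α w s c).explored = s.explored := by
  unfold processOut; split_ifs <;> rfl

theorem processOut_found : (processOut H k α w s c).found = s.found := by
  unfold processOut; split_ifs <;> rfl

theorem processOut_failed : (processOut H k α w s c).failed = s.failed := by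
  unfold processOut; split_ifs <;> rfl

theorem processOut_bad_of_hot (h : Hot H w s) : (processOut H k α w s c).bad = s.bad := by
  unfold processOut; rw [if_pos h]

theorem mem_processOut_bad_iff (h : ¬ Hot H w s) {g : Finset V} :
    g ∈ (processOut H k α w s c).bad ↔ g ∈ s.bad ∨ (g ∈ edges H ∧ w ∈ g ∧
      (1 - α) * k ≤ (((processOut H k α w s c).acceptedPart g).card : ℝ) ∧
      (processOut H k α w s c).Mono ((processOut H k α w s c).acceptedPart g)) := by
  have : processOut H k α w s c = updateBad H k α w { s with
      status := Function.update s.status w Status.accepted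
      color := Function.update s.color w c } := by
    unfold processOut; rw [if_neg h]
  rw [this]
  simp only [updateBad, Finset.mem_union, Finset.mem_filter]
  rfl

theorem processOut_keep (hw : s.status w = Status.uncolored) (v : V)
    (hv : s.status v ≠ Status.uncolored) :
    (processOut H k α w s c).status v = s.status v ∧
      (processOut H k α w s c).color v = s.color v := by
  have : v ≠ w := fun h => hv (h ▸ hw)
  simp [processOut_status, processOut_color, this]

theorem processOut_acceptedPart_of_hot (h : Hot H w s) (hw : s.status w = Status.uncolored)
    (g : Finset V) : (processOut H k α w s c).acceptedPart g = s.acceptedPart g := by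
  ext v
  simp only [Memory.mem_acceptedPart, processOut_status, if_pos h]
  refine and_congr_right fun _ => ?_
  split_ifs with hv
  · simp [hv, hw]
  · rfl

theorem processOut_acceptedPart_of_notMem {g : Finset V} (hw : w ∉ g) :
    (processOut H k α w s c).acceptedPart g = s.acceptedPart g := by
  ext v
  simp only [Memory.mem_acceptedPart, processOut_status]
  refine and_congr_right fun hv => ?_
  rw [if_neg fun h : v = w => hw (h ▸ hv)]

theorem processOut_acceptedPart_of_mem (h : ¬ Hot H w s) {g : Finset V} (hg : w ∈ g) :
    (processOut H k α w s c).acceptedPart g = insert w (s.acceptedPart g) := by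
  ext v
  simp only [Memory.mem_acceptedPart, processOut_status, if_neg h, Finset.mem_insert]
  split_ifs with hv
  · simp [hv, hg]
  · simp [hv]

theorem processOut_uncoloredPart (g : Finset V) :
    (processOut H k α w s c).uncoloredPart g = (s.uncoloredPart g).erase w := by
  ext v
  simp only [Memory.mem_uncoloredPart, processOut_status, Finset.mem_erase]
  by_cases hv : v = w
  · simp only [hv, if_true, not_true, ne_eq, false_and, iff_false, not_and]
    intro _
    split_ifs <;> simp
  · simp [hv]

/-- Processing keeps bad edges bad: their vertices become troubled, and so their accepted vertices
do not change any more. -/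
theorem ext_processOut (hI : Inv H k α s) (hw : s.status w = Status.uncolored) :
    Ext H s (processOut H k α w s c) where
  keep := processOut_keep hw
  bad_mono g hg := by
    by_cases h : Hot H w s
    · rwa [processOut_bad_of_hot h]
    · exact (mem_processOut_bad_iff h).2 (Or.inl hg)
  explored := by rw [processOut_explored]
  bad_det g hg hd hb := by
    by_cases h : Hot H w s
    · rwa [processOut_bad_of_hot h] at hb
    · rcases (mem_processOut_bad_iff h).1 hb with hb | ⟨-, hwg, -, hm⟩
      · exact hb
      · rcases hd with hd | hd
        · exact absurd hw (Memory.uncoloredPart_eq_empty.1 hd w hwg)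
        · exact absurd hm (safe_of_keep (processOut_keep hw) hd)
  bad_stays g hg := by
    have hacc : (processOut H k α w s c).acceptedPart g = s.acceptedPart g := by
      by_cases h : Hot H w s
      · exact processOut_acceptedPart_of_hot h hw g
      · by_cases hwg' : w ∈ g
        · exact absurd ⟨g, hI.bad_sub g hg.1, hwg', hg⟩ h
        · exact processOut_acceptedPart_of_notMem hwg'
    refine ⟨?_, ?_⟩
    · by_cases h : Hot H w s
      · rw [processOut_bad_of_hot h]; exact hg.1
      · exact (mem_processOut_bad_iff h).2 (Or.inl hg.1)
    · intro hs
      refine hs ?_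
      rw [hacc]
      have := hg.2
      simp only [Memory.Safe, not_not] at this
      intro v hv u hu
      rw [(processOut_keep hw v _).2, (processOut_keep hw u _).2]
      · exact this v hv u hu
      · rw [(Memory.mem_acceptedPart.1 hu).2]; exact Status.noConfusion
      · rw [(Memory.mem_acceptedPart.1 hv).2]; exact Status.noConfusion
  new_bad g hg hs := by
    by_cases h : Hot H w s
    · rwa [processOut_bad_of_hot h] at hg
    · rcases (mem_processOut_bad_iff h).1 hg with hb | ⟨-, -, -, hm⟩
      · exact hb
      · exact absurd hm hs
  failed := processOut_failed

/-- The invariant `not_accepted` holds for an edge that becomes bad since the previous number of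
accepted vertices was below `(1 - α) k`, and `α k ≥ 1`. -/
theorem inv_processOut (hp : Params H k α) (hI : Inv H k α s)
    (hw : s.status w = Status.uncolored) : Inv H k α (processOut H k α w s c) := by
  have hE : Ext H s (processOut H k α w s c) := ext_processOut hI hw
  have hnew : ∀ g, g ∈ (processOut H k α w s c).bad → g ∉ s.bad →
      ¬ Hot H w s ∧ g ∈ edges H ∧ w ∈ g ∧
        (processOut H k α w s c).Mono ((processOut H k α w s c).acceptedPart g) := by
    intro g hg hn
    by_cases h : Hot H w s
    · rw [processOut_bad_of_hot h] at hg
      exact absurd hg hn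
    · rcases (mem_processOut_bad_iff h).1 hg with hb | ⟨h1, h2, -, h3⟩
      · exact absurd hb hn
      · exact ⟨h, h1, h2, h3⟩
  refine ⟨?_, ?_, ?_, ?_, ?_⟩
  · intro g hg
    by_cases hb : g ∈ s.bad
    · exact hI.bad_sub g hb
    · exact (hnew g hg hb).2.1
  · intro v hv
    by_cases hvw : v = w
    · subst hvw
      rw [processOut_status, if_pos rfl] at hv
      by_cases h : Hot H v s
      · obtain ⟨e, he, hve, hb⟩ := h
        exact ⟨e, he, hve, hE.bad_stays e hb⟩
      · simp [h] at hv
    · rw [processOut_status, if_neg hvw] at hv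
      obtain ⟨e, he, hve, hb⟩ := hI.troubled v hv
      exact ⟨e, he, hve, hE.bad_stays e hb⟩
  · intro g hg hs h hh
    by_cases hb : g ∈ s.bad
    · have := hI.settled g hb (hE.safe_of_mem_bad hb hs) h hh
      refine ⟨hE.det this.1, fun hb' => hE.safe (this.2 ?_)⟩
      exact hE.bad_det h (mem_edges_of_mem_nbrs hh) this.1 hb'
    · exact absurd (hnew g hg hb).2.2.2 hs
  · intro g hg hb hd
    have hb0 : g ∉ s.bad := fun h => hb (hE.bad_mono h)
    have hd0 : ¬ s.Det g := fun h => hd (hE.det h)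
    have h0 := hI.few g hg hb0 hd0
    by_cases h : Hot H w s
    · rwa [processOut_acceptedPart_of_hot h hw]
    · by_cases hwg : w ∈ g
      · by_contra hlt
        refine hb ((mem_processOut_bad_iff h).2 (Or.inr ⟨hg, hwg, not_lt.1 hlt, ?_⟩))
        by_contra hm
        exact hd (Or.inr hm)
      · rwa [processOut_acceptedPart_of_notMem hwg]
  · intro g hg
    by_cases hb : g ∈ s.bad
    · have hB : s.Bad g := ⟨hb, fun h => hg.2 (hE.safe h)⟩
      obtain ⟨v, hv, hva⟩ := hI.not_accepted g hB
      by_cases hvw : v = w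
      · subst hvw
        refine ⟨v, hv, ?_⟩
        rw [processOut_status, if_pos rfl, if_pos ⟨g, hI.bad_sub g hb, hv, hB⟩]
        exact Status.noConfusion
      · exact ⟨v, hv, by rwa [processOut_status, if_neg hvw]⟩
    · obtain ⟨hh, hge, hwg, hm⟩ := hnew g hg.1 hb
      have hd0 : ¬ s.Det g := by
        rintro (h | h)
        · exact Memory.uncoloredPart_eq_empty.1 h w hwg hw
        · exact hg.2 (hE.safe h)
      have h0 := hI.few g hge hb hd0
      by_contra hall
      push Not at hall
      have h1 : (processOut H k α w s c).acceptedPart g = g := by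
        ext v; simp only [Memory.mem_acceptedPart]
        exact ⟨fun h => h.1, fun h => ⟨h, hall v h⟩⟩
      have h2 : g.card ≤ (s.acceptedPart g).card + 1 := by
        conv_lhs => rw [← h1, processOut_acceptedPart_of_mem hh hwg]
        exact Finset.card_insert_le _ _
      rw [hp.unif g hge] at h2
      have h3 : (k : ℝ) ≤ ((s.acceptedPart g).card : ℝ) + 1 := by exact_mod_cast h2
      have := hp.one_le
      nlinarith

end ProcessOut

end MemoryFacts

/-! ### Witness trees and their total weight -/

section Trees

/-- The kinds of nodes of a witness tree. A `blank` node only connects other nodes. All other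
nodes stand for an event about their edge `f`:
* `bad`: the edge has become bad;
* `inn`, `out`: the vertices of `f` have the same color, where the troubled vertices in
  previously covered bad edges (for `inn`), or in other bad edges (for `out`), are exempted;
* `full`: all vertices of `f` have the same color;
* `acc`: the accepted vertices of `f` have the same color, and there are enough of them. -/
inductive Kind
  | blank
  | bad
  | inn
  | out
  | full
  | acc

/-- A node of a witness tree: an edge of the hypergraph, the kind of the node and its level. The
levels are only compared with each other; a node of kind `inn` or `out` regards as previously covered
the bad edges that meet a node of a lower level. -/
structure Node (V : Type u) where
  edge : Finset V
  kind : Kind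
  lev : ℤ

/-- Rooted plane trees with labelled nodes, built by attaching the root of `t₂` below the root
of `t₁` by `join t₁ δ t₂`; here `δ` is the difference between the levels of the two roots. Adjacent
nodes have levels that differ by at most one, which makes three possibilities to be counted. -/
inductive WTree (V : Type u) : Type u
  | single (e : Finset V) (κ : Kind)
  | join (t₁ : WTree V) (δ : SignType) (t₂ : WTree V)

namespace WTree

variable {V : Type u}

/-- The edge at the root. -/
def rootEdge : WTree V → Finset V
  | single e _ => e
  | join t₁ _ _ => t₁.rootEdge

/-- The kind of the root. -/
def rootKind : WTree V → Kind
  | single _ κ => κ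
  | join t₁ _ _ => t₁.rootKind

/-- The nodes of the tree, if the root has level `l`. -/
def content : ℤ → WTree V → Multiset (Node V)
  | l, single e κ => {⟨e, κ, l⟩}
  | l, join t₁ δ t₂ => content l t₁ + content (l + (δ : ℤ)) t₂

/-- The number of nested `join`s. -/
def depth : WTree V → ℕ
  | single _ _ => 0
  | join t₁ _ t₂ => max t₁.depth t₂.depth + 1

/-- The product of the weights `w` of the nodes, times a factor `d` for each edge of the tree. -/
def weight (w : Kind → ℝ≥0∞) (d : ℝ≥0∞) : WTree V → ℝ≥0∞
  | single _ κ => w κ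
  | join t₁ _ t₂ => t₁.weight w d * t₂.weight w d * d

variable [Fintype V] {H : Hypergraph V}

/-- Adjacent nodes of the tree are neighbouring edges of the hypergraph. -/
def Valid (H : Hypergraph V) : WTree V → Prop
  | single e _ => e ∈ edges H
  | join t₁ _ t₂ => t₁.Valid H ∧ t₂.Valid H ∧ t₂.rootEdge ∈ nbrs H t₁.rootEdge

theorem root_mem_content (t : WTree V) (l : ℤ) :
    (⟨t.rootEdge, t.rootKind, l⟩ : Node V) ∈ t.content l := by
  induction t generalizing l with
  | single e κ => simp [content, rootEdge, rootKind]
  | join t₁ δ t₂ ih₁ ih₂ => exact Multiset.mem_add.2 (Or.inl (ih₁ l))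

theorem content_shift (t : WTree V) (l c : ℤ) :
    t.content (l + c) = (t.content l).map fun n => ⟨n.edge, n.kind, n.lev + c⟩ := by
  induction t generalizing l with
  | single e κ => simp [content]
  | join t₁ δ t₂ ih₁ ih₂ =>
    simp only [content, Multiset.map_add, ih₁]
    rw [show l + c + (δ : ℤ) = l + (δ : ℤ) + c by ring, ih₂]

theorem Valid.edge_mem {t : WTree V} (h : t.Valid H) {l : ℤ} {n : Node V}
    (hn : n ∈ t.content l) : n.edge ∈ edges H := by
  induction t generalizing l with
  | single e κ =>
    simp only [content, Multiset.mem_singleton] at hn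
    subst hn; exact h
  | join t₁ δ t₂ ih₁ ih₂ =>
    rcases Multiset.mem_add.1 hn with hn | hn
    · exact ih₁ h.1 hn
    · exact ih₂ h.2.1 hn

/-- A tree can be attached below any node of another tree. -/
theorem Valid.graft {t t' : WTree V} (h : t.Valid H) (h' : t'.Valid H) {l : ℤ} {n : Node V}
    (hn : n ∈ t.content l) (δ : SignType) (hadj : t'.rootEdge ∈ nbrs H n.edge) :
    ∃ t'' : WTree V, t''.Valid H ∧ t''.rootEdge = t.rootEdge ∧ t''.rootKind = t.rootKind ∧
      t''.content l = t.content l + t'.content (n.lev + (δ : ℤ)) := by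
  induction t generalizing l with
  | single e κ =>
    simp only [content, Multiset.mem_singleton] at hn
    subst hn
    exact ⟨join (single e κ) δ t', ⟨h, h', hadj⟩, rfl, rfl, rfl⟩
  | join t₁ δ' t₂ ih₁ ih₂ =>
    rcases Multiset.mem_add.1 hn with hn | hn
    · obtain ⟨t'', hv, he, hk, hc⟩ := ih₁ h.1 hn
      refine ⟨join t'' δ' t₂, ⟨hv, h.2.1, he ▸ h.2.2⟩, he, hk, ?_⟩
      simp only [content, hc, add_right_comm]
    · obtain ⟨t'', hv, he, hk, hc⟩ := ih₂ h.2.1 hn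
      refine ⟨join t₁ δ' t'', ⟨h.1, hv, he ▸ h.2.2⟩, rfl, rfl, ?_⟩
      simp only [content, hc, add_assoc]

/-- `WTree` as a sum type. -/
def equivSum : WTree V ≃ (Finset V × Kind) ⊕ (WTree V × SignType × WTree V) where
  toFun
    | single e κ => Sum.inl (e, κ)
    | join t₁ δ t₂ => Sum.inr (t₁, δ, t₂)
  invFun
    | Sum.inl p => single p.1 p.2
    | Sum.inr p => join p.1 p.2.1 p.2.2
  left_inv t := by cases t <;> rfl
  right_inv p := by rcases p with p | p <;> rfl

theorem tsum_eq (f : WTree V → ℝ≥0∞) : ∑' t, f t =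
    (∑' p : Finset V × Kind, f (single p.1 p.2)) +
      ∑' p : WTree V × SignType × WTree V, f (join p.1 p.2.1 p.2.2) := by
  rw [← equivSum.symm.tsum_eq]
  exact Summable.tsum_sum ENNReal.summable ENNReal.summable

/-- The six kinds, as a sum. -/
def kindSum (w : Kind → ℝ≥0∞) : ℝ≥0∞ :=
  w .blank + w .bad + w .inn + w .out + w .full + w .acc

theorem tsum_kind (w : Kind → ℝ≥0∞) : ∑' κ, w κ = kindSum w := by
  rw [tsum_eq_sum (s := {Kind.blank, .bad, .inn, .out, .full, .acc})]
  · simp [kindSum, add_assoc]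
  · intro κ hκ
    cases κ <;> simp at hκ

theorem ite_and_le {A B C : Prop} [Decidable (A ∧ B ∧ C)] [Decidable C] (a : ℝ≥0∞) :
    (if A ∧ B ∧ C then a else 0) ≤ if C then a else 0 := by
  by_cases h : C
  · rw [if_pos h]
    split_ifs
    · exact le_rfl
    · exact zero_le
  · rw [if_neg h, if_neg fun h' => h h'.2.2]

/-- The bound of `tsum_weight_le` for trees of bounded depth, by induction: the trees of depth zero
contribute `∑ w`, and a tree `join t₁ δ t₂` is given by two smaller trees, the difference `δ` and a
neighbour of the root. -/
theorem tsum_weight_le_of_depth {w : Kind → ℝ≥0∞} {d G : ℝ≥0∞}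
    (hd : ∀ x ∈ edges H, ((nbrs H x).card : ℝ≥0∞) * d ≤ 1) (hG : kindSum w + 3 * (G * G) ≤ G) (n : ℕ) :
    ∀ x ∈ edges H, ∑' t : WTree V, (if t.depth ≤ n ∧ t.Valid H ∧ t.rootEdge = x then t.weight w d else 0)
      ≤ G := by
  have hbase : ∀ x : Finset V, ∑' p : Finset V × Kind,
      (if p.1 = x then w p.2 else 0) = kindSum w := by
    intro x
    rw [ENNReal.tsum_prod', tsum_eq_single x]
    · simp [tsum_kind]
    · intro y hy; simp [hy]
  induction n with
  | zero =>
    intro x hx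
    rw [tsum_eq]
    have h2 : ∑' p : WTree V × SignType × WTree V,
        (if (join p.1 p.2.1 p.2.2).depth ≤ 0 ∧ (join p.1 p.2.1 p.2.2).Valid H ∧
          (join p.1 p.2.1 p.2.2).rootEdge = x then (join p.1 p.2.1 p.2.2).weight w d else 0) = 0 := by
      simp [depth]
    rw [h2, add_zero]
    refine le_trans ?_ (le_trans le_self_add hG)
    rw [← hbase x]
    exact ENNReal.tsum_le_tsum fun p => ite_and_le _
  | succ n ih =>
    intro x hx
    rw [tsum_eq]
    refine le_trans (add_le_add ?_ ?_) hG
    · rw [← hbase x]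
      exact ENNReal.tsum_le_tsum fun p => ite_and_le _
    · set a : Finset V → WTree V → ℝ≥0∞ := fun y t =>
        if t.depth ≤ n ∧ t.Valid H ∧ t.rootEdge = y then t.weight w d else 0 with ha
      have hb : ∑' t, ∑ y ∈ nbrs H x, a y t ≤ (nbrs H x).card * G := by
        rw [Summable.tsum_finsetSum fun _ _ => ENNReal.summable]
        calc ∑ y ∈ nbrs H x, ∑' t, a y t ≤ ∑ y ∈ nbrs H x, G := Finset.sum_le_sum fun y hy =>
              ih y (mem_edges_of_mem_nbrs hy)
          _ = _ := by rw [Finset.sum_const, nsmul_eq_mul]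
      calc ∑' p : WTree V × SignType × WTree V,
          (if (join p.1 p.2.1 p.2.2).depth ≤ n + 1 ∧ (join p.1 p.2.1 p.2.2).Valid H ∧
            (join p.1 p.2.1 p.2.2).rootEdge = x then (join p.1 p.2.1 p.2.2).weight w d else 0)
          ≤ ∑' p : WTree V × SignType × WTree V, a x p.1 * ((∑ y ∈ nbrs H x, a y p.2.2) * d) := by
            refine ENNReal.tsum_le_tsum fun p => ?_
            split_ifs with h
            · obtain ⟨h1, h2, h3⟩ := h
              simp only [depth, Nat.add_le_add_iff_right, max_le_iff] at h1
              simp only [rootEdge] at h3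
              have e1 : a x p.1 = p.1.weight w d := by
                exact if_pos ⟨h1.1, h2.1, h3⟩
              have e2 : p.2.2.weight w d ≤ ∑ y ∈ nbrs H x, a y p.2.2 := by
                have hm : p.2.2.rootEdge ∈ nbrs H x := h3 ▸ h2.2.2
                refine le_trans (le_of_eq ?_) (Finset.single_le_sum (f := fun y => a y p.2.2)
                  (fun _ _ => zero_le) hm)
                exact (if_pos ⟨h1.2, h2.2.1, rfl⟩).symm
              simp only [weight]
              rw [e1, mul_assoc]
              gcongr
            · exact zero_le
        _ = (∑' t, a x t) * (3 * ((∑' t, ∑ y ∈ nbrs H x, a y t) * d)) := by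
            rw [ENNReal.tsum_prod']
            simp_rw [ENNReal.tsum_mul_left]
            rw [ENNReal.tsum_mul_right, ENNReal.tsum_prod']
            simp_rw [ENNReal.tsum_mul_right]
            congr 1
            rw [tsum_fintype, Finset.sum_const, nsmul_eq_mul, mul_assoc]
            rfl
        _ ≤ G * (3 * ((nbrs H x).card * G * d)) := by gcongr; exact ih x hx
        _ = 3 * (G * G) * ((nbrs H x).card * d) := by ring
        _ ≤ 3 * (G * G) * 1 := by gcongr; exact hd x hx
        _ = 3 * (G * G) := mul_one _

/-- The generating function of witness trees: if the weights of the nodes satisfy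
`∑ w + 3 G² ≤ G`, then the trees with a given root have total weight at most `G`. The factor `3`
counts the level differences, and `d` compensates for the choice of a neighbour. -/
theorem tsum_weight_le {w : Kind → ℝ≥0∞} {d G : ℝ≥0∞}
    (hd : ∀ x ∈ edges H, ((nbrs H x).card : ℝ≥0∞) * d ≤ 1) (hG : kindSum w + 3 * (G * G) ≤ G)
    {x : Finset V} (hx : x ∈ edges H) :
    ∑' t : WTree V, (if t.Valid H ∧ t.rootEdge = x then t.weight w d else 0) ≤ G := by
  rw [ENNReal.tsum_eq_iSup_sum]
  refine iSup_le fun T => ?_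
  refine le_trans ?_ (tsum_weight_le_of_depth hd hG (T.sup depth) x hx)
  refine le_trans (Finset.sum_le_sum fun t ht => ?_) (ENNReal.sum_le_tsum T)
  have := Finset.le_sup (f := depth) ht
  by_cases h : t.Valid H ∧ t.rootEdge = x
  · rw [if_pos h, if_pos ⟨this, h⟩]
  · rw [if_neg h]; exact zero_le

end WTree

/-! ### Trees as multisets of nodes -/

section Multisets

variable {V : Type u} [Fintype V] {H : Hypergraph V}

/-- The nodes of `M` can be arranged as a valid tree, with any of them as the root. Witnesses are
handled in this form: the shape of the tree only matters for counting. -/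
def IsT (H : Hypergraph V) (M : Multiset (Node V)) : Prop :=
  M ≠ 0 ∧ ∀ n ∈ M, ∃ t : WTree V, t.Valid H ∧ t.rootEdge = n.edge ∧ t.content n.lev = M

theorem IsT.singleton {n : Node V} (h : n.edge ∈ edges H) : IsT H {n} := by
  refine ⟨by simp, fun m hm => ?_⟩
  rw [Multiset.mem_singleton] at hm
  subst hm
  exact ⟨.single m.edge m.kind, h, rfl, rfl⟩

/-- Two trees can be joined by an edge between any two nodes; whichever node is to be the root, the
tree that does not contain it is grafted onto the other one. -/
theorem IsT.join {M₁ M₂ : Multiset (Node V)} (h₁ : IsT H M₁) (h₂ : IsT H M₂) {x y : Node V}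
    (hx : x ∈ M₁) (hy : y ∈ M₂) (hxy : y.edge ∈ nbrs H x.edge) (hyx : x.edge ∈ nbrs H y.edge)
    (δ : SignType) (hδ : y.lev = x.lev + (δ : ℤ)) : IsT H (M₁ + M₂) := by
  refine ⟨fun h0 => h₁.1 (add_eq_zero.1 h0).1, fun n hn => ?_⟩
  rcases Multiset.mem_add.1 hn with hn | hn
  · obtain ⟨t₁, hv₁, hr₁, hc₁⟩ := h₁.2 n hn
    obtain ⟨t₂, hv₂, hr₂, hc₂⟩ := h₂.2 y hy
    obtain ⟨t, hv, hr, -, hc⟩ := hv₁.graft hv₂ (hc₁ ▸ hx) δ (hr₂ ▸ hxy)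
    exact ⟨t, hv, hr.trans hr₁, by rw [hc, hc₁, ← hδ, hc₂]⟩
  · obtain ⟨t₁, hv₁, hr₁, hc₁⟩ := h₁.2 x hx
    obtain ⟨t₂, hv₂, hr₂, hc₂⟩ := h₂.2 n hn
    obtain ⟨t, hv, hr, -, hc⟩ := hv₂.graft hv₁ (hc₂ ▸ hy) (-δ) (hr₁ ▸ hyx)
    refine ⟨t, hv, hr.trans hr₂, ?_⟩
    have : y.lev + ((-δ : SignType) : ℤ) = x.lev := by
      rw [hδ]; cases δ <;> simp
    rw [hc, hc₂, this, hc₁, add_comm]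

theorem IsT.cons {M : Multiset (Node V)} (h : IsT H M) {x y : Node V} (hx : x ∈ M)
    (hxe : x.edge ∈ edges H) (hxy : y.edge ∈ nbrs H x.edge) (δ : SignType)
    (hδ : y.lev = x.lev + (δ : ℤ)) : IsT H (y ::ₘ M) := by
  have := h.join (IsT.singleton (mem_edges_of_mem_nbrs hxy)) hx (Multiset.mem_singleton_self y)
    hxy (nbrs_symm hxe hxy) δ hδ
  rwa [add_comm, Multiset.singleton_add] at this

/-- Raise all levels by `c`. -/
def Node.shift (c : ℤ) (n : Node V) : Node V := ⟨n.edge, n.kind, n.lev + c⟩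

theorem IsT.shift {M : Multiset (Node V)} (h : IsT H M) (c : ℤ) : IsT H (M.map (Node.shift c)) := by
  refine ⟨by simpa using h.1, fun n hn => ?_⟩
  obtain ⟨m, hm, rfl⟩ := Multiset.mem_map.1 hn
  obtain ⟨t, hv, hr, hc⟩ := h.2 m hm
  refine ⟨t, hv, hr, ?_⟩
  show t.content (m.lev + c) = _
  rw [WTree.content_shift, hc]
  rfl

end Multisets

end Trees

/-! ### Potentials of single events -/

/-- The conditional probability that `n` given vertices and `t - n` further ones get the same
color, if the first `n` already have. The color of the first vertex is free, hence the value at `0`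
is that at `1`. -/
def phiNum (t n : ℕ) : ℝ≥0∞ := 2⁻¹ ^ (t - max n 1)

theorem phiNum_eq_one {t n : ℕ} (h : t ≤ n) : phiNum t n = 1 := by
  have : t - max n 1 = 0 := by omega
  rw [phiNum, this, pow_zero]

theorem phiNum_one (t : ℕ) : phiNum t 1 = phiNum t 0 := rfl

theorem phiNum_succ_le (t n : ℕ) : phiNum t (n + 1) ≤ 2 * phiNum t n := by
  have h : t - max n 1 ≤ (t - max (n + 1) 1) + 1 := by omega
  have h1 : (2⁻¹ : ℝ≥0∞) ^ ((t - max (n + 1) 1) + 1) ≤ 2⁻¹ ^ (t - max n 1) :=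
    pow_le_pow_right_of_le_one' (ENNReal.inv_le_one.2 one_le_two) h
  calc phiNum t (n + 1) = 2 * (2⁻¹ ^ ((t - max (n + 1) 1) + 1)) := by
        rw [pow_succ', ← mul_assoc, ENNReal.mul_inv_cancel (by simp) (by simp), one_mul, phiNum]
    _ ≤ 2 * phiNum t n := mul_le_mul_right h1 _

/-- One coin toss: a potential that survives only if the new color agrees with the colors of the
vertices of `R` does not increase on average. -/
theorem add_le_two_mul_phiNum {V : Type u} {R : Finset V} {col : V → Bool} {t : ℕ}
    {f : Bool → ℝ≥0∞}
    (hf : ∀ c, f c ≤ if ∀ u ∈ R, col u = c then phiNum t (R.card + 1) else 0) :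
    f true + f false ≤ 2 * phiNum t R.card := by
  rcases R.eq_empty_or_nonempty with rfl | ⟨u, hu⟩
  · simp only [Finset.notMem_empty, false_imp_iff, implies_true, if_true, Finset.card_empty,
      zero_add, phiNum_one] at hf
    rw [two_mul]
    exact add_le_add (hf true) (hf false)
  · have hz : f (!col u) = 0 := by
      have := hf (!col u)
      rw [if_neg fun h => by simpa using h u hu] at this
      exact le_antisymm this zero_le
    have hle : f (col u) ≤ phiNum t (R.card + 1) := (hf _).trans (by split_ifs; exacts [le_rfl, zero_le])
    have hle' := hle.trans (phiNum_succ_le t R.card)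
    cases h : col u
    · rw [h] at hz hle'
      simp only [Bool.not_false] at hz
      rwa [hz, zero_add]
    · rw [h] at hz hle'
      simp only [Bool.not_true] at hz
      rwa [hz, add_zero]

section Potentials

variable {V : Type u} [Fintype V] {H : Hypergraph V} {k : ℕ} {α : ℝ}

/-- The number of accepted vertices that makes an edge bad. -/
def badThr (k : ℕ) (α : ℝ) : ℕ := ⌈(1 - α) * k⌉₊

/-- An upper bound on the conditional probability that the edge `e` ever becomes bad. -/
def phiBad (k : ℕ) (α : ℝ) (e : Finset V) (s : Memory V) : ℝ≥0∞ :=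
  if e ∈ s.bad then 1 else if s.Det e then 0 else phiNum (badThr k α) (s.acceptedPart e).card

/-- The vertices of `e` that are accepted, or troubled and only contained in such bad edges that
belong to `T`. -/
def required (e : Finset V) (T : Set (Finset V)) (s : Memory V) : Finset V :=
  e.filter fun w => s.status w = Status.accepted ∨
    (s.status w = Status.troubled ∧ ∀ g ∈ s.bad, w ∈ g → g ∈ T)

/-- Situations that never occur on edges used by a witness: some vertex of `e` belongs to bad edges
of both classes, or `e` meets an edge that has been bad and is safe now. These situations are
permanent. -/
def Killed (e : Finset V) (T : Set (Finset V)) (s : Memory V) : Prop :=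
  (∃ w ∈ e, ∃ g₁ ∈ s.bad, ∃ g₂ ∈ s.bad, w ∈ g₁ ∧ w ∈ g₂ ∧ g₁ ∈ T ∧ g₂ ∉ T) ∨
    ∃ g ∈ s.bad, (∃ w ∈ g, w ∈ e) ∧ s.Safe g

/-- An upper bound on the conditional probability that at least `t` vertices of `e` will be
required, all of the same color. -/
def phiReq (e : Finset V) (t : ℕ) (T : Set (Finset V)) (s : Memory V) : ℝ≥0∞ :=
  if Killed e T s ∨ ¬ s.Mono (required e T s) then 0 else phiNum t (required e T s).card

theorem mem_required {e : Finset V} {T : Set (Finset V)} {s : Memory V} {w : V} :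
    w ∈ required e T s ↔ w ∈ e ∧ (s.status w = Status.accepted ∨
      (s.status w = Status.troubled ∧ ∀ g ∈ s.bad, w ∈ g → g ∈ T)) := by
  simp [required]

theorem phiReq_eq_one {e : Finset V} {t : ℕ} {T : Set (Finset V)} {s : Memory V}
    (h1 : ¬ Killed e T s) (h2 : s.Mono (required e T s)) (h3 : t ≤ (required e T s).card) :
    phiReq e t T s = 1 := by
  rw [phiReq, if_neg (by tauto), phiNum_eq_one h3]

section Processing

variable {s : Memory V} {w : V}

theorem mem_processOut_bad_of_notMem {e : Finset V} (hw : w ∉ e) {c : Bool} :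
    e ∈ (processOut H k α w s c).bad ↔ e ∈ s.bad := by
  by_cases h : Hot H w s
  · rw [processOut_bad_of_hot h]
  · rw [mem_processOut_bad_iff h]
    exact ⟨fun h' => h'.elim id fun h'' => absurd h''.2.1 hw, Or.inl⟩

theorem phiBad_processOut_of_notMem (hI : Inv H k α s) (hu : s.status w = Status.uncolored)
    {e : Finset V} (hw : w ∉ e) (c : Bool) :
    phiBad k α e (processOut H k α w s c) ≤ phiBad k α e s := by
  unfold phiBad
  rw [processOut_acceptedPart_of_notMem hw]
  by_cases h1 : e ∈ s.bad
  · rw [if_pos h1, if_pos ((mem_processOut_bad_of_notMem hw).2 h1)]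
  · rw [if_neg h1, if_neg fun h => h1 ((mem_processOut_bad_of_notMem hw).1 h)]
    by_cases h2 : s.Det e
    · rw [if_pos h2, if_pos ((ext_processOut hI hu).det h2)]
    · rw [if_neg h2]
      split_ifs
      · exact zero_le
      · exact le_rfl

/-- If `w` is processed with color `c` and a set of colored vertices together with `w` is
monochromatic, then `c` was their color before. -/
theorem color_eq_of_mono_insert {R : Finset V} {c : Bool}
    (hR : ∀ u ∈ R, s.status u ≠ Status.uncolored) (hu : s.status w = Status.uncolored)
    (h : (processOut H k α w s c).Mono (insert w R)) : ∀ u ∈ R, s.color u = c := by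
  intro u hu'
  have hne : u ≠ w := fun h => hR u hu' (h ▸ hu)
  have := h u (Finset.mem_insert_of_mem hu') w (Finset.mem_insert_self _ _)
  rwa [processOut_color, processOut_color, if_neg hne, if_pos rfl] at this

/-- Processing a vertex of `e` does not increase the average of `phiBad`: a troubled vertex does not
count, and an accepted one needs the right color. -/
theorem phiBad_processOut_of_mem (hI : Inv H k α s) (hu : s.status w = Status.uncolored)
    {e : Finset V} (hw : w ∈ e) :
    phiBad k α e (processOut H k α w s true) + phiBad k α e (processOut H k α w s false)
      ≤ 2 * phiBad k α e s := by
  have hE := fun c => ext_processOut (c := c) hI hu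
  by_cases h1 : e ∈ s.bad
  · simp only [phiBad, if_pos ((hE _).bad_mono h1), if_pos h1]
    norm_num
  by_cases hd : s.Det e
  · have hz : ∀ c, phiBad k α e (processOut H k α w s c) = 0 := by
      intro c
      have hs : s.Safe e := hd.resolve_left fun h =>
        Memory.uncoloredPart_eq_empty.1 h w hw hu
      have hs' := (hE c).safe hs
      have hb : e ∉ (processOut H k α w s c).bad := by
        by_cases h : Hot H w s
        · rwa [processOut_bad_of_hot h]
        · rw [mem_processOut_bad_iff h]
          rintro (h | h)
          · exact h1 h
          · exact hs' h.2.2.2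
      rw [phiBad, if_neg hb, if_pos (show (HypergraphLCA.processOut H k α w s c).Det e from Or.inr hs')]
    simp [hz]
  · by_cases h : Hot H w s
    · have hle : ∀ c, phiBad k α e (processOut H k α w s c) ≤ phiBad k α e s := by
        intro c
        simp only [phiBad, processOut_bad_of_hot h, if_neg h1, if_neg hd,
          processOut_acceptedPart_of_hot h hu]
        split_ifs
        · exact zero_le
        · exact le_rfl
      rw [two_mul]
      exact add_le_add (hle _) (hle _)
    · have hs : phiBad k α e s = phiNum (badThr k α) (s.acceptedPart e).card := by
        rw [phiBad, if_neg h1, if_neg hd]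
      rw [hs]
      have hwa : w ∉ s.acceptedPart e := by
        simp [Memory.mem_acceptedPart, hu]
      refine add_le_two_mul_phiNum (f := fun c => phiBad k α e (processOut H k α w s c))
        (col := s.color) fun c => ?_
      have hcard : ((processOut H k α w s c).acceptedPart e).card
          = (s.acceptedPart e).card + 1 := by
        rw [processOut_acceptedPart_of_mem h hw, Finset.card_insert_of_notMem hwa]
      have hcol : ¬ (processOut H k α w s c).Safe e → ∀ u ∈ s.acceptedPart e, s.color u = c := by
        intro hns
        have hm : (processOut H k α w s c).Mono (insert w (s.acceptedPart e)) := by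
          rw [← processOut_acceptedPart_of_mem h hw]
          exact not_not.1 hns
        refine color_eq_of_mono_insert (fun u hu' => ?_) hu hm
        rw [(Memory.mem_acceptedPart.1 hu').2]
        exact Status.noConfusion
      show phiBad k α e (processOut H k α w s c) ≤ _
      by_cases hb : e ∈ (processOut H k α w s c).bad
      · rcases (mem_processOut_bad_iff h).1 hb with hb' | ⟨-, -, hcd, hm⟩
        · exact absurd hb' h1
        · rw [if_pos (hcol (not_not.2 hm)), phiBad, if_pos hb, ← hcard,
            phiNum_eq_one (show badThr k α ≤ _ from Nat.ceil_le.2 hcd)]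
      · rw [phiBad, if_neg hb]
        by_cases hd' : (processOut H k α w s c).Det e
        · rw [if_pos hd']; exact zero_le
        · rw [if_neg hd', if_pos (hcol fun hs' => hd' (Or.inr hs')), hcard]

theorem Killed.processOut (hI : Inv H k α s) (hu : s.status w = Status.uncolored) {c : Bool}
    {e : Finset V} {T : Set (Finset V)} (h : Killed e T s) :
    Killed e T (processOut H k α w s c) := by
  have hE := ext_processOut (c := c) hI hu
  rcases h with ⟨v, hv, g₁, h1, g₂, h2, h3⟩ | ⟨g, hg, h1, h2⟩
  · exact Or.inl ⟨v, hv, g₁, hE.bad_mono h1, g₂, hE.bad_mono h2, h3⟩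
  · exact Or.inr ⟨g, hE.bad_mono hg, h1, hE.safe h2⟩

/-- For the vertices that have been processed before, it is decided whether they are required,
unless the event is killed: a vertex that is troubled by a bad edge of one class stays in this class,
since a new bad edge of the other class would contain a vertex of both. -/
theorem mem_required_processOut (hI : Inv H k α s) (hu : s.status w = Status.uncolored) {c : Bool}
    {e : Finset V} {T : Set (Finset V)} (h : ¬ Killed e T (processOut H k α w s c)) {v : V}
    (hv : v ≠ w) : v ∈ required e T (processOut H k α w s c) ↔ v ∈ required e T s := by
  have hE := ext_processOut (c := c) hI hu
  rw [mem_required, mem_required, processOut_status, if_neg hv]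
  refine and_congr_right fun hve => or_congr_right (and_congr_right fun ht => ?_)
  refine ⟨fun hh g hg => hh g (hE.bad_mono hg), fun hh g hg hvg => ?_⟩
  obtain ⟨e₀, -, hve₀, hb⟩ := hI.troubled v ht
  by_contra hgT
  exact h (Or.inl ⟨v, hve, e₀, hE.bad_mono hb.1, g, hg, hve₀, hvg, hh e₀ hb.1 hve₀, hgT⟩)

theorem mono_processOut_iff {c : Bool} {W : Finset V}
    (hW : w ∉ W) : (processOut H k α w s c).Mono W ↔ s.Mono W := by
  unfold Memory.Mono
  refine forall₂_congr fun v hv => forall₂_congr fun u hu' => ?_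
  rw [processOut_color, processOut_color, if_neg fun h : v = w => hW (h ▸ hv),
    if_neg fun h : u = w => hW (h ▸ hu')]

theorem notMem_required_of_uncolored {e : Finset V} {T : Set (Finset V)}
    (hu : s.status w = Status.uncolored) : w ∉ required e T s := by
  simp [mem_required, hu]

theorem phiReq_processOut_le (hI : Inv H k α s) (hu : s.status w = Status.uncolored)
    {e : Finset V} {t : ℕ} {T : Set (Finset V)} {c : Bool}
    (hw : w ∉ required e T (processOut H k α w s c)) :
    phiReq e t T (processOut H k α w s c) ≤ phiReq e t T s := by
  by_cases hk : Killed e T (processOut H k α w s c)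
  · rw [phiReq, if_pos (Or.inl hk)]; exact zero_le
  have hR : required e T (processOut H k α w s c) = required e T s := by
    ext v
    by_cases hv : v = w
    · subst hv
      exact iff_of_false hw (notMem_required_of_uncolored hu)
    · exact mem_required_processOut hI hu hk hv
  have hk' : ¬ Killed e T s := fun h => hk (h.processOut hI hu)
  unfold phiReq
  rw [hR, mono_processOut_iff (notMem_required_of_uncolored hu)]
  simp [hk, hk']

theorem phiReq_processOut_of_notMem (hI : Inv H k α s) (hu : s.status w = Status.uncolored)
    {e : Finset V} {t : ℕ} {T : Set (Finset V)} (hw : w ∉ e) (c : Bool) :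
    phiReq e t T (processOut H k α w s c) ≤ phiReq e t T s :=
  phiReq_processOut_le hI hu fun h => hw (mem_required.1 h).1

/-- Processing a vertex of `e` does not increase the average of `phiReq`: the vertex is either
exempted, or required to have the right color. Which of these is the case depends on the previous
bad edges only, not on the coin. -/
theorem phiReq_processOut_of_mem (hI : Inv H k α s) (hu : s.status w = Status.uncolored)
    {e : Finset V} {t : ℕ} {T : Set (Finset V)} (hw : w ∈ e) :
    phiReq e t T (processOut H k α w s true) + phiReq e t T (processOut H k α w s false)
      ≤ 2 * phiReq e t T s := by
  -- The exempted case.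
  by_cases hq : Hot H w s ∧ ¬ ∀ g ∈ s.bad, w ∈ g → g ∈ T
  · rw [two_mul]
    have : ∀ c, w ∉ required e T (processOut H k α w s c) := by
      intro c
      rw [mem_required, processOut_status, if_pos rfl, if_pos hq.1, processOut_bad_of_hot hq.1]
      rintro ⟨-, h | h⟩
      · exact Status.noConfusion h
      · exact hq.2 h.2
    exact add_le_add (phiReq_processOut_le hI hu (this _)) (phiReq_processOut_le hI hu (this _))
  by_cases hk' : Killed e T s ∨ ¬ s.Mono (required e T s)
  · have hz : ∀ c, phiReq e t T (processOut H k α w s c) = 0 := by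
      intro c
      by_cases hk : Killed e T (processOut H k α w s c)
      · rw [phiReq, if_pos (Or.inl hk)]
      · have hnm : ¬ s.Mono (required e T s) :=
          hk'.resolve_left fun h => hk (h.processOut hI hu)
        rw [phiReq, if_pos (Or.inr fun hm => hnm ?_)]
        rw [← mono_processOut_iff (c := c) (H := H) (k := k) (α := α)
          (notMem_required_of_uncolored hu)]
        refine hm.subset fun v hv => (mem_required_processOut hI hu hk ?_).2 hv
        rintro rfl
        exact notMem_required_of_uncolored hu hv
    simp [hz]
  · have hs : phiReq e t T s = phiNum t (required e T s).card := by rw [phiReq, if_neg hk']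
    rw [hs]
    refine add_le_two_mul_phiNum (f := fun c => phiReq e t T (processOut H k α w s c))
      (col := s.color) fun c => ?_
    show phiReq e t T (processOut H k α w s c) ≤ _
    by_cases hk : Killed e T (processOut H k α w s c)
    · rw [phiReq, if_pos (Or.inl hk)]; exact zero_le
    have hR : required e T (processOut H k α w s c) = insert w (required e T s) := by
      ext v
      by_cases hv : v = w
      · subst hv
        refine iff_of_true ?_ (Finset.mem_insert_self _ _)
        rw [mem_required, processOut_status, if_pos rfl]
        by_cases hh : Hot H v s
        · rw [if_pos hh, processOut_bad_of_hot hh]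
          refine ⟨hw, Or.inr ⟨rfl, ?_⟩⟩
          by_contra hn
          exact hq ⟨hh, hn⟩
        · rw [if_neg hh]
          exact ⟨hw, Or.inl rfl⟩
      · rw [mem_required_processOut hI hu hk hv, Finset.mem_insert]
        simp [hv]
    by_cases hm : (processOut H k α w s c).Mono (required e T (processOut H k α w s c))
    · have hcard : (required e T (processOut H k α w s c)).card = (required e T s).card + 1 := by
        rw [hR, Finset.card_insert_of_notMem (notMem_required_of_uncolored hu)]
      rw [phiReq, if_neg (by tauto), hcard, if_pos]
      rw [hR] at hm
      refine color_eq_of_mono_insert (fun u hu' => ?_) hu hm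
      rintro h
      exact notMem_required_of_uncolored h hu'
    · rw [phiReq, if_pos (Or.inr hm)]; exact zero_le

end Processing

/-- `s'` arises from `s` by accepting the troubled vertices in `W`, maybe with new colors. All
edges that meet `W` are determined, and the bad edges that have made the vertices of `W` troubled
are safe in `s'`. This covers both the coloring of a final component and the acceptance of an
unsuccessful search area. -/
structure AcceptLike (H : Hypergraph V) (W : Finset V) (s s' : Memory V) : Prop where
  troubled : ∀ w ∈ W, s.status w = Status.troubled
  status : ∀ v, s'.status v = if v ∈ W then Status.accepted else s.status v
  color : ∀ v, v ∉ W → s'.color v = s.color v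
  bad : s'.bad = s.bad
  det : ∀ f ∈ edges H, (∃ w ∈ f, w ∈ W) → s.Det f
  safe_bad : ∀ w ∈ W, ∃ g ∈ s.bad, w ∈ g ∧ s'.Safe g

namespace AcceptLike

variable {W : Finset V} {s s' : Memory V}

theorem notMem (h : AcceptLike H W s s') {v : V} (hv : s.status v ≠ Status.troubled) : v ∉ W :=
  fun hw => hv (h.troubled v hw)

theorem safe (h : AcceptLike H W s s') {g : Finset V} (hg : s.Safe g) : s'.Safe g := by
  rw [Memory.safe_iff] at hg ⊢
  obtain ⟨v, hv, w, hw, h1, h2, hne⟩ := hg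
  have hvW := h.notMem (v := v) (by rw [h1]; exact Status.noConfusion)
  have hwW := h.notMem (v := w) (by rw [h2]; exact Status.noConfusion)
  refine ⟨v, hv, w, hw, ?_, ?_, ?_⟩
  · rw [h.status, if_neg hvW, h1]
  · rw [h.status, if_neg hwW, h2]
  · rwa [h.color v hvW, h.color w hwW]

theorem uncoloredPart (h : AcceptLike H W s s') (g : Finset V) :
    s'.uncoloredPart g = s.uncoloredPart g := by
  ext v
  simp only [Memory.mem_uncoloredPart, h.status]
  refine and_congr_right fun _ => ?_
  split_ifs with hv
  · simp [h.troubled v hv]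
  · rfl

theorem det_of (h : AcceptLike H W s s') {g : Finset V} (hg : s.Det g) : s'.Det g :=
  hg.imp (fun hu => (h.uncoloredPart g).trans hu) h.safe

theorem acceptedPart (h : AcceptLike H W s s') {g : Finset V} (hg : ∀ w ∈ g, w ∉ W) :
    s'.acceptedPart g = s.acceptedPart g := by
  ext v
  simp only [Memory.mem_acceptedPart, h.status]
  exact and_congr_right fun hv => by rw [if_neg (hg v hv)]

theorem mono_iff (h : AcceptLike H W s s') {W' : Finset V} (hW : ∀ w ∈ W', w ∉ W) :
    s'.Mono W' ↔ s.Mono W' := by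
  unfold Memory.Mono
  refine forall₂_congr fun v hv => forall₂_congr fun u hu => ?_
  rw [h.color v (hW v hv), h.color u (hW u hu)]

theorem safe_iff (h : AcceptLike H W s s') {g : Finset V} (hg : ∀ w ∈ g, w ∉ W) :
    s'.Safe g ↔ s.Safe g := by
  unfold Memory.Safe
  rw [h.acceptedPart hg, h.mono_iff fun w hw => hg w (Memory.mem_acceptedPart.1 hw).1]

theorem phiBad_le (h : AcceptLike H W s s') {e : Finset V} (he : e ∈ edges H) :
    phiBad k α e s' ≤ phiBad k α e s := by
  unfold phiBad
  rw [h.bad]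
  by_cases h1 : e ∈ s.bad
  · simp [h1]
  rw [if_neg h1, if_neg h1]
  by_cases h2 : s.Det e
  · rw [if_pos (h.det_of h2)]; exact zero_le
  · have hW : ∀ w ∈ e, w ∉ W := fun w hw hwW => h2 (h.det e he ⟨w, hw, hwW⟩)
    rw [if_neg h2, h.acceptedPart hW]
    split_ifs
    · exact zero_le
    · exact le_rfl

theorem phiReq_le (h : AcceptLike H W s s') {e : Finset V} {t : ℕ} {T : Set (Finset V)} :
    phiReq e t T s' ≤ phiReq e t T s := by
  by_cases hk : Killed e T s'
  · rw [phiReq, if_pos (Or.inl hk)]; exact zero_le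
  have hW : ∀ w ∈ e, w ∉ W := by
    intro w hw hwW
    obtain ⟨g, hg, hwg, hs⟩ := h.safe_bad w hwW
    exact hk (Or.inr ⟨g, h.bad ▸ hg, ⟨w, hwg, hw⟩, hs⟩)
  have hk' : ¬ Killed e T s := by
    rintro (h1 | ⟨g, hg, h1, h2⟩)
    · exact hk (Or.inl (h.bad.symm ▸ h1))
    · exact hk (Or.inr ⟨g, h.bad.symm ▸ hg, h1, h.safe h2⟩)
  have hR : required e T s' = required e T s := by
    ext v
    rw [mem_required, mem_required, h.bad]
    exact and_congr_right fun hv => by rw [h.status, if_neg (hW v hv)]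
  unfold phiReq
  rw [hR, h.mono_iff fun w hw => hW w (mem_required.1 hw).1]
  simp [hk, hk']

end AcceptLike

/-! ### The potential of the memory -/

namespace Kind

/-- All kinds of nodes except `blank` stand for events. -/
def IsElem (κ : Kind) : Prop := κ ≠ blank

/-- The kinds of nodes that count for the size of a witness tree. An `acc` node only serves to join
two trees, and need not cover anything. -/
def IsCover (κ : Kind) : Prop := κ = bad ∨ κ = inn ∨ κ = out ∨ κ = full

/-- The number of edges of the tree that a node of the given kind can pay for: its probability,
multiplied by this power of the edge degree, is still small. Since `α ≤ 1 / 3`, the exponents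
`(1 - α) k`, `k` and `(1 - 2 α) k` of these probabilities are at least `2`, `3` and `1` times
`k / 3`. -/
def credit : Kind → ℕ
  | blank => 0
  | bad => 2
  | inn => 2
  | out => 2
  | full => 3
  | acc => 1

/-- The number of vertices of the same color in the event of a node. -/
def thr (k : ℕ) (α : ℝ) : Kind → ℕ
  | blank => 0
  | bad => badThr k α
  | inn => badThr k α
  | out => badThr k α
  | full => k
  | acc => ⌈(1 - 2 * α) * k⌉₊

theorem IsCover.isElem {κ : Kind} (h : κ.IsCover) : κ.IsElem := by
  rcases h with rfl | rfl | rfl | rfl <;> simp [IsElem]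

end Kind

/-- `g` meets the edge of a covering node of `M` of level below `l`. In a witness, these are the bad
edges of level below `l` (`Witness.meetsBelow_iff`); but this definition refers to the tree only,
and so it is fixed before the algorithm starts. -/
def MeetsBelow (M : Multiset (Node V)) (l : ℤ) (g : Finset V) : Prop :=
  ∃ m ∈ M, m.kind.IsCover ∧ m.lev < l ∧ (g ∩ m.edge).Nonempty

/-- The bad edges whose troubled vertices are not exempted in the event of a node `n` of `M`. -/
def testSet (M : Multiset (Node V)) (n : Node V) : Set (Finset V) :=
  match n.kind with
  | .inn => {g | ¬ MeetsBelow M n.lev g}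
  | .out => {g | MeetsBelow M n.lev g}
  | .acc => ∅
  | _ => Set.univ

/-- The potential of a node `n` of the tree with nodes `M`. -/
def nodePhi (k : ℕ) (α : ℝ) (M : Multiset (Node V)) (s : Memory V) (n : Node V) : ℝ≥0∞ :=
  match n.kind with
  | .blank => 1
  | .bad => phiBad k α n.edge s
  | κ => phiReq n.edge (κ.thr k α) (testSet M n) s

/-- The potential of the tree with nodes `M`. -/
def treePhi (k : ℕ) (α : ℝ) (M : Multiset (Node V)) (s : Memory V) : ℝ≥0∞ :=
  (M.map (nodePhi k α M s)).prod

/-- The edges of different events are disjoint: no vertex belongs to two of them. The count is over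
a multiset, so no event occurs twice either. -/
def Disj (M : Multiset (Node V)) : Prop :=
  ∀ v : V, (M.filter fun n => n.kind.IsElem ∧ v ∈ n.edge).card ≤ 1

/-- The number of covering nodes. -/
def numCover (M : Multiset (Node V)) : ℕ := (M.filter fun n => n.kind.IsCover).card

/-- The total credit, minus the number of edges of the tree. A new node changes it by its credit
minus one, so that a `blank` node costs one unit, and most events gain one. -/
def surplus (M : Multiset (Node V)) : ℤ := (M.map fun n => (n.kind.credit : ℤ)).sum - M.card + 1

/-- The trees that occur in the union bound. The levels are normalized such that the root has
level zero. -/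
structure Admissible (H : Hypergraph V) (t : WTree V) : Prop where
  valid : t.Valid H
  disj : Disj (t.content 0)
  surplus : 2 ≤ surplus (t.content 0)
  size : 2 * Real.logb 2 ((edges H).card : ℝ) < numCover (t.content 0)

/-- A component that is too large has been constructed. -/
def LargeFound (H : Hypergraph V) (s : Memory V) : Prop :=
  ∃ C ∈ s.found, componentBound H < (C.card : ℝ)

/-- An upper bound on the conditional probability that a large component will be constructed. -/
def potential (H : Hypergraph V) (k : ℕ) (α : ℝ) (s : Memory V) : ℝ≥0∞ :=
  if LargeFound H s then 1
  else if s.failed = true then 0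
  else ∑' t : WTree V, if Admissible H t then treePhi k α (t.content 0) s else 0

theorem nodePhi_processOut_le (hI : Inv H k α s) (hu : s.status w = Status.uncolored)
    (M : Multiset (Node V)) {n : Node V} (hw : ¬ (n.kind.IsElem ∧ w ∈ n.edge)) (c : Bool) :
    nodePhi k α M (processOut H k α w s c) n ≤ nodePhi k α M s n := by
  obtain ⟨e, κ, l⟩ := n
  by_cases hκ : κ = Kind.blank
  · subst hκ; exact le_rfl
  have hwe : w ∉ e := fun h => hw ⟨hκ, h⟩
  cases κ
  · exact absurd rfl hκ
  · exact phiBad_processOut_of_notMem hI hu hwe c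
  all_goals exact phiReq_processOut_of_notMem hI hu hwe c

theorem nodePhi_processOut_add_le (hI : Inv H k α s) (hu : s.status w = Status.uncolored)
    (M : Multiset (Node V)) {n : Node V} (hκ : n.kind.IsElem) (hw : w ∈ n.edge) :
    nodePhi k α M (processOut H k α w s true) n + nodePhi k α M (processOut H k α w s false) n
      ≤ 2 * nodePhi k α M s n := by
  obtain ⟨e, κ, l⟩ := n
  cases κ
  · exact absurd rfl hκ
  · exact phiBad_processOut_of_mem hI hu hw
  all_goals exact phiReq_processOut_of_mem hI hu hw

theorem prod_map_le_prod_map {X : Type*} (M : Multiset X) (f g : X → ℝ≥0∞)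
    (h : ∀ x ∈ M, f x ≤ g x) : (M.map f).prod ≤ (M.map g).prod := by
  induction M using Multiset.induction_on with
  | empty => simp
  | cons a M ih =>
    simp only [Multiset.map_cons, Multiset.prod_cons]
    exact mul_le_mul' (h a (Multiset.mem_cons_self a M))
      (ih fun x hx => h x (Multiset.mem_cons_of_mem hx))

/-- At most one factor of `treePhi` is affected by the coin, since the edges of the events are
disjoint; the other factors do not increase for either outcome. -/
theorem treePhi_processOut_add_le (hI : Inv H k α s) (hu : s.status w = Status.uncolored)
    {M : Multiset (Node V)} (hM : Disj M) :
    treePhi k α M (processOut H k α w s true) + treePhi k α M (processOut H k α w s false)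
      ≤ 2 * treePhi k α M s := by
  by_cases hex : ∃ n ∈ M, n.kind.IsElem ∧ w ∈ n.edge
  · obtain ⟨n, hn, hκ, hw⟩ := hex
    obtain ⟨M', hM'⟩ := Multiset.exists_cons_of_mem hn
    have hle : ∀ c, ((M'.map (nodePhi k α M (processOut H k α w s c))).prod)
        ≤ (M'.map (nodePhi k α M s)).prod := by
      intro c
      refine prod_map_le_prod_map _ _ _ fun m hm => nodePhi_processOut_le hI hu M ?_ c
      intro hmw
      have h1 := hM w
      rw [hM', Multiset.filter_cons_of_pos M' (show n.kind.IsElem ∧ w ∈ n.edge from ⟨hκ, hw⟩),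
        Multiset.card_cons] at h1
      have h2 : 0 < (M'.filter fun n => n.kind.IsElem ∧ w ∈ n.edge).card :=
        Multiset.card_pos_iff_exists_mem.2 ⟨m, Multiset.mem_filter.2 ⟨hm, hmw⟩⟩
      omega
    have he : ∀ s', treePhi k α M s' = nodePhi k α M s' n * (M'.map (nodePhi k α M s')).prod := by
      intro s'
      unfold treePhi
      conv_lhs => rw [show M.map (nodePhi k α M s') = (n ::ₘ M').map (nodePhi k α M s') by
        rw [← hM']]
      rw [Multiset.map_cons, Multiset.prod_cons]
    rw [he, he, he]
    calc _ ≤ nodePhi k α M (processOut H k α w s true) n * (M'.map (nodePhi k α M s)).prod +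
          nodePhi k α M (processOut H k α w s false) n * (M'.map (nodePhi k α M s)).prod :=
          add_le_add (mul_le_mul_right (hle _) _) (mul_le_mul_right (hle _) _)
      _ = (nodePhi k α M (processOut H k α w s true) n +
          nodePhi k α M (processOut H k α w s false) n) * (M'.map (nodePhi k α M s)).prod := by
          rw [add_mul]
      _ ≤ 2 * nodePhi k α M s n * (M'.map (nodePhi k α M s)).prod :=
          mul_le_mul_left (nodePhi_processOut_add_le hI hu M hκ hw) _
      _ = _ := mul_assoc _ _ _
  · have hle : ∀ c, treePhi k α M (processOut H k α w s c) ≤ treePhi k α M s := fun c =>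
      prod_map_le_prod_map _ _ _ fun n hn =>
        nodePhi_processOut_le hI hu M (fun h => hex ⟨n, hn, h⟩) c
    rw [two_mul]
    exact add_le_add (hle _) (hle _)

/-- The potential is a supermartingale under processing a vertex. -/
theorem spec_processVertex (hp : Params H k α) {s : Memory V} {w : V} (hI : Inv H k α s)
    (hu : s.status w = Status.uncolored) :
    Spec (potential H k α) (processVertex H k α w s) (potential H k α s) fun s' =>
      Inv H k α s' ∧ Ext H s s' ∧ s'.explored = s.explored ∧
        (∀ g, s'.uncoloredPart g = (s.uncoloredPart g).erase w) := by
  refine spec_processVertex_of_le (fun c => ⟨inv_processOut hp hI hu, ext_processOut hI hu,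
    processOut_explored, processOut_uncoloredPart⟩) ?_
  unfold potential
  have hf : ∀ c, LargeFound H (processOut H k α w s c) ↔ LargeFound H s := fun c => by
    rw [LargeFound, LargeFound, processOut_found]
  simp only [hf, processOut_failed]
  split_ifs
  · norm_num
  · simp
  · rw [← ENNReal.tsum_add, ← ENNReal.tsum_mul_left]
    refine ENNReal.tsum_le_tsum fun t => ?_
    split_ifs with ht
    · exact treePhi_processOut_add_le hI hu ht.disj
    · simp

/-- Accepting vertices does not increase the potential: the events whose edges contain such a vertex
become impossible or have been decided before, and the others are not affected. -/
theorem AcceptLike.potential_le {W : Finset V} {s s' : Memory V} (h : AcceptLike H W s s')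
    (hfound : s'.found = s.found) (hfailed : s'.failed = s.failed) :
    potential H k α s' ≤ potential H k α s := by
  unfold potential
  have hf : LargeFound H s' ↔ LargeFound H s := by rw [LargeFound, LargeFound, hfound]
  simp only [hf, hfailed]
  split_ifs
  · exact le_rfl
  · exact le_rfl
  · refine ENNReal.tsum_le_tsum fun t => ?_
    split_ifs with ht
    · refine prod_map_le_prod_map _ _ _ fun n hn => ?_
      have he := ht.valid.edge_mem hn
      obtain ⟨e, κ, l⟩ := n
      cases κ
      · exact le_rfl
      · exact h.phiBad_le he
      all_goals exact h.phiReq_le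
    · exact le_rfl

end Potentials

/-! ### Witnesses of sets of bad edges -/

section Witnesses

variable {V : Type u} [Fintype V] {H : Hypergraph V} {k : ℕ} {α : ℝ} {s : Memory V}

theorem surplus_cons (n : Node V) (M : Multiset (Node V)) :
    surplus (n ::ₘ M) = surplus M + (n.kind.credit : ℤ) - 1 := by
  simp only [surplus, Multiset.map_cons, Multiset.sum_cons, Multiset.card_cons]
  push_cast
  ring

theorem surplus_add (M₁ M₂ : Multiset (Node V)) :
    surplus (M₁ + M₂) = surplus M₁ + surplus M₂ - 1 := by
  simp only [surplus, Multiset.map_add, Multiset.sum_add, Multiset.card_add]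
  push_cast
  ring

theorem Disj.add {M₁ M₂ : Multiset (Node V)} (h₁ : Disj M₁) (h₂ : Disj M₂)
    (h : ∀ n ∈ M₁, n.kind.IsElem → ∀ m ∈ M₂, m.kind.IsElem → ¬ (m.edge ∩ n.edge).Nonempty) :
    Disj (M₁ + M₂) := by
  intro v
  rw [Multiset.filter_add, Multiset.card_add]
  have e₁ := h₁ v
  have e₂ := h₂ v
  by_contra hc
  have p₁ : 0 < (M₁.filter fun n => n.kind.IsElem ∧ v ∈ n.edge).card := by omega
  have p₂ : 0 < (M₂.filter fun n => n.kind.IsElem ∧ v ∈ n.edge).card := by omega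
  obtain ⟨n, hn⟩ := Multiset.card_pos_iff_exists_mem.1 p₁
  obtain ⟨m, hm⟩ := Multiset.card_pos_iff_exists_mem.1 p₂
  rw [Multiset.mem_filter] at hn hm
  exact h n hn.1 hn.2.1 m hm.1 hm.2.1 ⟨v, Finset.mem_inter.2 ⟨hm.2.2, hn.2.2⟩⟩

theorem Disj.singleton (n : Node V) : Disj ({n} : Multiset (Node V)) := fun _ =>
  (Multiset.card_le_card (Multiset.filter_le _ _)).trans (Multiset.card_singleton n).le

theorem Disj.cons {M : Multiset (Node V)} (h : Disj M) {n : Node V}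
    (hn : n.kind.IsElem → ∀ m ∈ M, m.kind.IsElem → ¬ (n.edge ∩ m.edge).Nonempty) :
    Disj (n ::ₘ M) := by
  rw [← Multiset.singleton_add]
  refine (Disj.singleton n).add h fun n' hn' he m hm hme hne => ?_
  rw [Multiset.mem_singleton] at hn'
  subst hn'
  rw [Finset.inter_comm] at hne
  exact hn he m hm hme hne

theorem IsT.edge_mem {M : Multiset (Node V)} (h : IsT H M) {n : Node V} (hn : n ∈ M) :
    n.edge ∈ edges H := by
  obtain ⟨t, hv, -, hc⟩ := h.2 n hn
  exact hv.edge_mem (l := n.lev) (by rw [hc]; exact hn)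

theorem mem_nbrs_of_meets {f g : Finset V} (hg : g ∈ edges H) (hne : g ≠ f)
    (h : (g ∩ f).Nonempty) : g ∈ nbrs H f := mem_nbrs.2 ⟨hg, hne, h⟩

theorem meets_of_mem_nbrs {f g : Finset V} (h : g ∈ nbrs H f) : (g ∩ f).Nonempty :=
  (mem_nbrs.1 h).2.2

theorem meets_comm {f g : Finset V} : (g ∩ f).Nonempty ↔ (f ∩ g).Nonempty := by
  rw [Finset.inter_comm]

theorem meets_of_mem {f g : Finset V} {w : V} (hg : w ∈ g) (hf : w ∈ f) : (g ∩ f).Nonempty :=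
  ⟨w, Finset.mem_inter.2 ⟨hg, hf⟩⟩

theorem not_meets_of_disjoint {f g : Finset V} (h : Disjoint g f) : ¬ (g ∩ f).Nonempty := by
  rw [Finset.disjoint_iff_inter_eq_empty.1 h]
  exact Finset.not_nonempty_empty

/-- A set of completely colored bad edges, with determined neighbours, that contains all bad
neighbours of its edges. So it is a union of connected components of the bad edges, and will remain
one. -/
structure Region (H : Hypergraph V) (s : Memory V) (X : Finset (Finset V)) : Prop where
  edge : ∀ g ∈ X, g ∈ edges H
  bad : ∀ g ∈ X, s.Bad g
  colored : ∀ g ∈ X, s.uncoloredPart g = ∅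
  det : ∀ g ∈ X, ∀ h ∈ nbrs H g, s.Det h
  closed : ∀ g ∈ X, ∀ h ∈ nbrs H g, h ∈ s.bad → h ∈ X

theorem Region.union {X Y : Finset (Finset V)} (hX : Region H s X) (hY : Region H s Y) :
    Region H s (X ∪ Y) where
  edge g hg := (Finset.mem_union.1 hg).elim (hX.edge g) (hY.edge g)
  bad g hg := (Finset.mem_union.1 hg).elim (hX.bad g) (hY.bad g)
  colored g hg := (Finset.mem_union.1 hg).elim (hX.colored g) (hY.colored g)
  det g hg := (Finset.mem_union.1 hg).elim (hX.det g) (hY.det g)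
  closed g hg h hh hb := Finset.mem_union.2 ((Finset.mem_union.1 hg).imp
    (fun hg => hX.closed g hg h hh hb) fun hg => hY.closed g hg h hh hb)

theorem Region.mem_of_meets {X : Finset (Finset V)} (hX : Region H s X) {g h : Finset V}
    (hg : g ∈ X) (hh : h ∈ s.bad) (he : h ∈ edges H) (hm : (h ∩ g).Nonempty) : h ∈ X := by
  by_cases hne : h = g
  · exact hne ▸ hg
  · exact hX.closed g hg h (mem_nbrs_of_meets he hne hm) hh

/-- Every edge of `N` can be reached, inside of `N`, from an edge in `S`. This is expressed by the
induction principle that it provides. -/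
def GenFrom (H : Hypergraph V) (N : Finset (Finset V)) (S : Set (Finset V)) : Prop :=
  ∀ Z : Set (Finset V), (∀ g ∈ N, g ∈ S → g ∈ Z) →
    (∀ a ∈ N, a ∈ Z → ∀ c ∈ N, c ∈ nbrs H a → c ∈ Z) → ∀ g ∈ N, g ∈ Z

theorem GenFrom.mono {N : Finset (Finset V)} {S S' : Set (Finset V)} (h : GenFrom H N S)
    (hS : ∀ g ∈ N, g ∈ S → g ∈ S') : GenFrom H N S' :=
  fun Z h1 h2 => h Z (fun g hg hgS => h1 g hg (hS g hg hgS)) h2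

theorem GenFrom.exists_mem {N : Finset (Finset V)} {S : Set (Finset V)} (h : GenFrom H N S)
    (hN : N.Nonempty) : ∃ g ∈ N, g ∈ S := by
  by_contra hc
  push Not at hc
  obtain ⟨g, hg⟩ := hN
  exact h ∅ (fun g hg hgS => hc g hg hgS) (fun _ _ h => h.elim) g hg

/-- The vertices that are exempted from having the same color in the event of the node `n`. -/
def exempt (s : Memory V) (ℓ : Finset V → ℤ) (n : Node V) : Finset V :=
  match n.kind with
  | .inn => n.edge.filter fun w =>
      s.status w = Status.troubled ∧ ∃ g ∈ s.bad, w ∈ g ∧ ℓ g < n.lev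
  | .out => n.edge.filter fun w =>
      s.status w = Status.troubled ∧ ∃ g ∈ s.bad, w ∈ g ∧ ¬ ℓ g < n.lev
  | .acc => s.troubledPart n.edge
  | _ => ∅

/-- The event of the node `n` has occurred; here `ℓ` assigns levels to the bad edges. -/
def NodeSat (k : ℕ) (α : ℝ) (s : Memory V) (ℓ : Finset V → ℤ) (n : Node V) : Prop :=
  match n.kind with
  | .blank => True
  | .bad => n.edge ∈ s.bad
  | κ => s.Mono (n.edge \ exempt s ℓ n) ∧ κ.thr k α ≤ (n.edge \ exempt s ℓ n).card

theorem exempt_congr {ℓ ℓ' : Finset V → ℤ} {n : Node V}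
    (h : ∀ g ∈ s.bad, (g ∩ n.edge).Nonempty → ℓ' g = ℓ g) : exempt s ℓ' n = exempt s ℓ n := by
  obtain ⟨e, κ, l⟩ := n
  cases κ <;> simp only [exempt]
  all_goals
    ext w
    simp only [Finset.mem_filter]
    refine and_congr_right fun hw => and_congr_right fun _ => exists_congr fun g =>
      and_congr_right fun hg => and_congr_right fun hwg => ?_
    rw [h g hg (meets_of_mem hwg hw)]

theorem NodeSat.congr {ℓ ℓ' : Finset V → ℤ} {n : Node V} (hn : NodeSat k α s ℓ n)
    (h : n.kind.IsElem → ∀ g ∈ s.bad, (g ∩ n.edge).Nonempty → ℓ' g = ℓ g) :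
    NodeSat k α s ℓ' n := by
  obtain ⟨e, κ, l⟩ := n
  cases κ
  · trivial
  all_goals
    have := exempt_congr (h (by simp [Kind.IsElem]))
    simp only [NodeSat, this] at hn ⊢
    exact hn

/-- Everything that is required of a witness, except that it covers all of `X`. The nodes of `M`
form a tree, their events have occurred, and concern disjoint edges; all bad edges that meet the
edges of the events belong to `X`, and the level of a bad edge is at most the level of a covering
node that meets it. The levels `ℓ` are constant on the connected components of `X` (`const`). They
are part of the data, because the order in which a witness covers the components may differ from the
order of their exploration. -/
structure PreWitness (H : Hypergraph V) (k : ℕ) (α : ℝ) (s : Memory V) (M : Multiset (Node V))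
    (X : Finset (Finset V)) (ℓ : Finset V → ℤ) : Prop where
  tree : IsT H M
  disj : Disj M
  colored : ∀ n ∈ M, n.kind.IsElem → s.uncoloredPart n.edge = ∅
  det : ∀ n ∈ M, n.kind.IsElem → ∀ g ∈ nbrs H n.edge, s.Det g
  hit : ∀ n ∈ M, n.kind.IsElem → ∀ g ∈ s.bad, (g ∩ n.edge).Nonempty → g ∈ X
  lev : ∀ n ∈ M, n.kind.IsCover → ∀ g ∈ X, (g ∩ n.edge).Nonempty → ℓ g ≤ n.lev
  region : Region H s X
  const : ∀ g ∈ X, ∀ h ∈ X, h ∈ nbrs H g → ℓ g = ℓ h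
  sat : ∀ n ∈ M, NodeSat k α s ℓ n

/-- Some covering node of the level of `g` meets `g`. By `PreWitness.lev`, this is the lowest covering
node that meets `g`, so the tree determines the level of `g`. -/
def Covered (M : Multiset (Node V)) (ℓ : Finset V → ℤ) (g : Finset V) : Prop :=
  ∃ n ∈ M, n.kind.IsCover ∧ (g ∩ n.edge).Nonempty ∧ n.lev = ℓ g

/-- A tree of events that have occurred and that cover the set `X` of bad edges. Several such trees
may exist; they are only used to see that the potential is at least one. -/
structure Witness (H : Hypergraph V) (k : ℕ) (α : ℝ) (s : Memory V) (M : Multiset (Node V))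
    (X : Finset (Finset V)) (ℓ : Finset V → ℤ) : Prop extends PreWitness H k α s M X ℓ where
  cov : ∀ g ∈ X, Covered M ℓ g

/-- Some node that stands for an event meets `g`. -/
def Met (M : Multiset (Node V)) (g : Finset V) : Prop :=
  ∃ n ∈ M, n.kind.IsElem ∧ (g ∩ n.edge).Nonempty

theorem Met.mono {M M' : Multiset (Node V)} {g : Finset V}
    (h : Met M g) (hM : M ≤ M') : Met M' g :=
  let ⟨n, hn, h⟩ := h
  ⟨n, Multiset.mem_of_le hM hn, h⟩

namespace PreWitness

variable {M : Multiset (Node V)} {X : Finset (Finset V)} {ℓ : Finset V → ℤ}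

/-- A node without an event is attached to the tree. -/
theorem cons_blank (hW : PreWitness H k α s M X ℓ) {n : Node V} (hn : n ∈ M) {f : Finset V}
    (hf : f ∈ nbrs H n.edge) : PreWitness H k α s (⟨f, .blank, n.lev⟩ ::ₘ M) X ℓ where
  tree := hW.tree.cons hn (hW.tree.edge_mem hn) hf 0 (by simp)
  disj := hW.disj.cons fun h => absurd rfl h
  colored m hm hk := by
    rcases Multiset.mem_cons.1 hm with rfl | hm
    · exact absurd rfl hk
    · exact hW.colored m hm hk
  det m hm hk := by
    rcases Multiset.mem_cons.1 hm with rfl | hm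
    · exact absurd rfl hk
    · exact hW.det m hm hk
  hit m hm hk := by
    rcases Multiset.mem_cons.1 hm with rfl | hm
    · exact absurd rfl hk
    · exact hW.hit m hm hk
  lev m hm hk := by
    rcases Multiset.mem_cons.1 hm with rfl | hm
    · exact absurd rfl hk.isElem
    · exact hW.lev m hm hk
  region := hW.region
  const := hW.const
  sat m hm := by
    rcases Multiset.mem_cons.1 hm with rfl | hm
    · trivial
    · exact hW.sat m hm

/-- A new event is attached to the tree. -/
theorem cons_elem (hW : PreWitness H k α s M X ℓ) {n : Node V} (hn : n ∈ M) {m : Node V}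
    (hm : m.edge ∈ nbrs H n.edge) (δ : SignType) (hδ : m.lev = n.lev + (δ : ℤ))
    (hmet : ¬ Met M m.edge)
    (hcol : s.uncoloredPart m.edge = ∅) (hdet : ∀ g ∈ nbrs H m.edge, s.Det g)
    (hhit : ∀ g ∈ s.bad, (g ∩ m.edge).Nonempty → g ∈ X)
    (hlev : m.kind.IsCover → ∀ g ∈ X, (g ∩ m.edge).Nonempty → ℓ g ≤ m.lev)
    (hsat : NodeSat k α s ℓ m) : PreWitness H k α s (m ::ₘ M) X ℓ where
  tree := hW.tree.cons hn (hW.tree.edge_mem hn) hm δ hδ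
  disj := hW.disj.cons fun _ n' hn' hk hne => hmet ⟨n', hn', hk, hne⟩
  colored m' hm' hk := by
    rcases Multiset.mem_cons.1 hm' with rfl | hm'
    · exact hcol
    · exact hW.colored m' hm' hk
  det m' hm' hk := by
    rcases Multiset.mem_cons.1 hm' with rfl | hm'
    · exact hdet
    · exact hW.det m' hm' hk
  hit m' hm' hk := by
    rcases Multiset.mem_cons.1 hm' with rfl | hm'
    · exact hhit
    · exact hW.hit m' hm' hk
  lev m' hm' hk := by
    rcases Multiset.mem_cons.1 hm' with rfl | hm'
    · exact hlev hk
    · exact hW.lev m' hm' hk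
  region := hW.region
  const := hW.const
  sat m' hm' := by
    rcases Multiset.mem_cons.1 hm' with rfl | hm'
    · exact hsat
    · exact hW.sat m' hm'

theorem level_eq_of_meets (hW : PreWitness H k α s M X ℓ) {g h : Finset V} (hg : g ∈ X)
    (hh : h ∈ X) (hm : (h ∩ g).Nonempty) : ℓ h = ℓ g := by
  by_cases hne : h = g
  · rw [hne]
  · exact (hW.const g hg h hh (mem_nbrs_of_meets (hW.region.edge h hh) hne hm)).symm

/-- A bad edge that does not meet any event yet becomes an event. -/
theorem cons_bad (hW : PreWitness H k α s M X ℓ) (hI : Inv H k α s) {n : Node V} (hn : n ∈ M)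
    {c : Finset V} (hcX : c ∈ X) (hc : c ∈ nbrs H n.edge) (hl : ℓ c = n.lev) (hmet : ¬ Met M c) :
    PreWitness H k α s (⟨c, .bad, ℓ c⟩ ::ₘ M) X ℓ :=
  hW.cons_elem hn (m := ⟨c, .bad, ℓ c⟩) hc 0 (by simp [hl]) hmet (hW.region.colored c hcX)
    (hW.region.det c hcX)
    (fun g hg hm => hW.region.mem_of_meets hcX hg (hI.bad_sub g hg) hm)
    (fun _ g hg hm => (hW.level_eq_of_meets hcX hg hm).le) (hW.region.bad c hcX).1

/-- If the edges of `N` can be reached from the edges that meet some event or the edge of the node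
`n₀`, then `N` can be covered by attaching further events, each of which pays for its connection
to the tree. -/
theorem absorb (hI : Inv H k α s) {N : Finset (Finset V)} {S : Set (Finset V)} {l : ℤ}
    {n₀ : Node V} (hNX : N ⊆ X) (hl : ∀ g ∈ N, ℓ g = l) (hn₀l : n₀.lev = l)
    (hgen : GenFrom H N S) (j : ℕ) :
    ∀ M : Multiset (Node V), PreWitness H k α s M X ℓ → n₀ ∈ M →
      (∀ n ∈ M, n.kind.IsElem → ∀ g ∈ N, (g ∩ n.edge).Nonempty → n.kind.IsCover ∧ n.lev = l) →
      (∀ c ∈ N, c ∈ S → Met M c ∨ c ∈ nbrs H n₀.edge) →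
      (N.filter fun g => ¬ Met M g).card ≤ j →
      ∃ M', M ≤ M' ∧ PreWitness H k α s M' X ℓ ∧ (∀ g ∈ N, Covered M' ℓ g) ∧
        surplus M ≤ surplus M' ∧ ∀ n ∈ M', n.kind.IsElem → n ∈ M ∨ n.edge ∈ N := by
  induction j with
  | zero =>
    intro M hW _ hP _ hcard
    refine ⟨M, le_rfl, hW, fun g hg => ?_, le_rfl, fun n hn _ => Or.inl hn⟩
    have hmet : Met M g := by
      by_contra hmet
      have := Finset.card_pos.2
        (⟨g, Finset.mem_filter.2 ⟨hg, hmet⟩⟩ : (N.filter fun g => ¬ Met M g).Nonempty)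
      omega
    obtain ⟨n, hn, hk, hm⟩ := hmet
    have := hP n hn hk g hg hm
    exact ⟨n, hn, this.1, hm, this.2.trans (hl g hg).symm⟩
  | succ j ih =>
    intro M hW hn₀ hP hS hcard
    by_cases hall : ∀ g ∈ N, Met M g
    · refine ⟨M, le_rfl, hW, fun g hg => ?_, le_rfl, fun n hn _ => Or.inl hn⟩
      obtain ⟨n, hn, hk, hm⟩ := hall g hg
      have := hP n hn hk g hg hm
      exact ⟨n, hn, this.1, hm, this.2.trans (hl g hg).symm⟩
    -- One more event: an edge next to `n₀`, or next to an edge that has been met already.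
    have hstep : ∃ M₁ c, M ≤ M₁ ∧ PreWitness H k α s M₁ X ℓ ∧ c ∈ N ∧ ¬ Met M c ∧
        surplus M ≤ surplus M₁ ∧ (⟨c, .bad, l⟩ : Node V) ∈ M₁ ∧
        ∀ n ∈ M₁, n.kind.IsElem → n ∈ M ∨ n = ⟨c, .bad, l⟩ := by
      by_cases hseed : ∃ c ∈ N, c ∈ S ∧ ¬ Met M c
      · obtain ⟨c, hc, hcS, hmet⟩ := hseed
        have hadj := (hS c hc hcS).resolve_left hmet
        refine ⟨⟨c, .bad, ℓ c⟩ ::ₘ M, c, Multiset.le_cons_self _ _,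
          hW.cons_bad hI hn₀ (hNX hc) hadj ((hl c hc).trans hn₀l.symm) hmet, hc, hmet, ?_,
          by rw [hl c hc]; exact Multiset.mem_cons_self _ _, fun n hn _ => ?_⟩
        · rw [surplus_cons]; simp [Kind.credit]
        · rcases Multiset.mem_cons.1 hn with rfl | hn
          · exact Or.inr (by rw [hl c hc])
          · exact Or.inl hn
      · push Not at hseed hall
        obtain ⟨g₀, hg₀, hmet₀⟩ := hall
        have hex : ∃ a ∈ N, Met M a ∧ ∃ c ∈ N, c ∈ nbrs H a ∧ ¬ Met M c := by
          by_contra hno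
          push Not at hno
          exact hmet₀ (hgen {g | Met M g} hseed (fun a ha haZ c hc hca => hno a ha haZ c hc hca)
            g₀ hg₀)
        obtain ⟨a, ha, ⟨n, hn, hk, hm⟩, c, hc, hca, hmet⟩ := hex
        have hlev := (hP n hn hk a ha hm).2
        have hne : a ≠ n.edge := by
          rintro rfl
          exact hmet ⟨n, hn, hk, meets_of_mem_nbrs hca⟩
        have hW₁ := hW.cons_blank hn (mem_nbrs_of_meets (hW.region.edge a (hNX ha)) hne hm)
        have hmet₁ : ¬ Met (⟨a, .blank, n.lev⟩ ::ₘ M) c := by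
          rintro ⟨n', hn', hk', hm'⟩
          rcases Multiset.mem_cons.1 hn' with rfl | hn'
          · exact hk' rfl
          · exact hmet ⟨n', hn', hk', hm'⟩
        refine ⟨⟨c, .bad, ℓ c⟩ ::ₘ ⟨a, .blank, n.lev⟩ ::ₘ M, c,
          (Multiset.le_cons_self _ _).trans (Multiset.le_cons_self _ _),
          hW₁.cons_bad hI (Multiset.mem_cons_self _ _) (hNX hc) hca
            ((hl c hc).trans hlev.symm) hmet₁, hc, hmet, ?_,
          by rw [hl c hc]; exact Multiset.mem_cons_self _ _, fun n' hn' hk' => ?_⟩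
        · rw [surplus_cons, surplus_cons]; simp only [Kind.credit]; omega
        · rcases Multiset.mem_cons.1 hn' with rfl | hn'
          · exact Or.inr (by rw [hl c hc])
          · rcases Multiset.mem_cons.1 hn' with rfl | hn'
            · exact absurd rfl hk'
            · exact Or.inl hn'
    obtain ⟨M₁, c, hle, hW₁, hc, hmet, hsur, hcM, hsub⟩ := hstep
    have hcmet : Met M₁ c := by
      have hcc : (c ∩ c).Nonempty := by
        obtain ⟨w, hw, -⟩ := hI.not_accepted c (hW.region.bad c (hNX hc))
        exact meets_of_mem hw hw
      exact ⟨_, hcM, by simp [Kind.IsElem], hcc⟩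
    have hlt : (N.filter fun g => ¬ Met M₁ g).card < (N.filter fun g => ¬ Met M g).card := by
      refine Finset.card_lt_card ⟨fun g hg => ?_, fun hsub => ?_⟩
      · rw [Finset.mem_filter] at hg ⊢
        exact ⟨hg.1, fun h => hg.2 (h.mono hle)⟩
      · exact (Finset.mem_filter.1 (hsub (Finset.mem_filter.2 ⟨hc, hmet⟩))).2 hcmet
    obtain ⟨M', hle', hW', hcov, hsur', hsub'⟩ := ih M₁ hW₁ (Multiset.mem_of_le hle hn₀)
      (fun n hn hk g hg hm => by
        rcases hsub n hn hk with hn | rfl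
        · exact hP n hn hk g hg hm
        · exact ⟨Or.inl rfl, rfl⟩)
      (fun c hc hcS => (hS c hc hcS).imp_left fun h => h.mono hle) (by omega)
    refine ⟨M', hle.trans hle', hW', hcov, hsur.trans hsur', fun n hn hk => ?_⟩
    rcases hsub' n hn hk with hn | hn
    · rcases hsub n hn hk with hn | rfl
      · exact Or.inl hn
      · exact Or.inr hc
    · exact Or.inr hn

end PreWitness

namespace Witness

variable {M : Multiset (Node V)} {X : Finset (Finset V)} {ℓ : Finset V → ℤ}

/-- The classes of bad edges in `testSet`, which are defined by the tree, are those given by the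
levels. -/
theorem meetsBelow_iff (hW : Witness H k α s M X ℓ) {g : Finset V} (hg : g ∈ X) (l : ℤ) :
    MeetsBelow M l g ↔ ℓ g < l := by
  constructor
  · rintro ⟨m, hm, hc, hl, hne⟩
    exact (hW.lev m hm hc g hg hne).trans_lt hl
  · intro hl
    obtain ⟨m, hm, hc, hne, he⟩ := hW.cov g hg
    exact ⟨m, hm, hc, by omega, hne⟩

/-- The bound on the conditional probability of an event that has occurred has reached one. The point
is that the vertices required by `testSet` are exactly those that are not exempted with respect to
the levels. -/
theorem nodePhi_eq_one (hW : Witness H k α s M X ℓ) (hI : Inv H k α s) {n : Node V}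
    (hn : n ∈ M) : nodePhi k α M s n = 1 := by
  have key : n.kind.IsElem → n.kind ≠ .bad → ∀ t : ℕ,
      s.Mono (n.edge \ exempt s ℓ n) ∧ t ≤ (n.edge \ exempt s ℓ n).card →
      phiReq n.edge t (testSet M n) s = 1 := by
    intro hk hkb t ht
    have hX : ∀ w ∈ n.edge, ∀ g ∈ s.bad, w ∈ g → g ∈ X := fun w hw g hg hwg =>
      hW.hit n hn hk g hg (meets_of_mem hwg hw)
    have hT : ∀ w ∈ n.edge, ∀ g₁ ∈ s.bad, ∀ g₂ ∈ s.bad, w ∈ g₁ → w ∈ g₂ →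
        g₁ ∈ testSet M n → g₂ ∈ testSet M n := by
      intro w hw g₁ h₁ g₂ h₂ hw₁ hw₂ hT
      have e : ℓ g₁ = ℓ g₂ := hW.level_eq_of_meets (hX w hw g₂ h₂ hw₂) (hX w hw g₁ h₁ hw₁)
        (meets_of_mem hw₁ hw₂)
      have b₁ := hW.meetsBelow_iff (hX w hw g₁ h₁ hw₁) n.lev
      have b₂ := hW.meetsBelow_iff (hX w hw g₂ h₂ hw₂) n.lev
      rw [e, ← b₂] at b₁
      unfold testSet at hT ⊢
      split at hT <;> simp_all
    -- A vertex in two bad edges lies in a single component, and all its edges have the same level.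
    have hkill : ¬ Killed n.edge (testSet M n) s := by
      rintro (⟨w, hw, g₁, h₁, g₂, h₂, hw₁, hw₂, hT₁, hT₂⟩ | ⟨g, hg, ⟨w, hwg, hw⟩, hs⟩)
      · exact hT₂ (hT w hw g₁ h₁ g₂ h₂ hw₁ hw₂ hT₁)
      · exact (hW.region.bad g (hX w hw g hg hwg)).2 hs
    have hR : required n.edge (testSet M n) s = n.edge \ exempt s ℓ n := by
      ext w
      rw [mem_required, Finset.mem_sdiff]
      refine and_congr_right fun hw => ?_
      have hu : s.status w ≠ Status.uncolored :=
        Memory.uncoloredPart_eq_empty.1 (hW.colored n hn hk) w hw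
      cases hst : s.status w
      · exact absurd hst hu
      · refine iff_of_true (Or.inl rfl) ?_
        unfold exempt
        split <;> simp [hst, Memory.mem_troubledPart]
      · obtain ⟨g₀, -, hwg₀, hb₀⟩ := hI.troubled w hst
        have h₀ : (∀ g ∈ s.bad, w ∈ g → g ∈ testSet M n) ↔ g₀ ∈ testSet M n :=
          ⟨fun h => h g₀ hb₀.1 hwg₀, fun h g hg hwg => hT w hw g₀ hb₀.1 g hg hwg₀ hwg h⟩
        have hlev : ∀ P : ℤ → Prop, (∃ g ∈ s.bad, w ∈ g ∧ P (ℓ g)) ↔ P (ℓ g₀) := by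
          refine fun P => ⟨?_, fun h => ⟨g₀, hb₀.1, hwg₀, h⟩⟩
          rintro ⟨g, hg, hwg, h⟩
          rwa [← hW.level_eq_of_meets (hX w hw g₀ hb₀.1 hwg₀) (hX w hw g hg hwg)
            (meets_of_mem hwg hwg₀)]
        have b₀ := hW.meetsBelow_iff (hX w hw g₀ hb₀.1 hwg₀) n.lev
        rw [h₀]
        have hl₁ := hlev fun x => x < n.lev
        have hl₂ := hlev fun x => ¬ x < n.lev
        unfold testSet exempt
        cases hκ : n.kind
        · exact absurd hκ hk
        · exact absurd hκ hkb
        · simp only [Set.mem_ofPred_eq, Finset.mem_filter, hl₁, b₀, hst, hw]; simp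
        · simp only [Set.mem_ofPred_eq, Finset.mem_filter, hl₂, b₀, hst, hw]; simp
        · simp
        · simp [Memory.mem_troubledPart, hst, hw]
    exact phiReq_eq_one hkill (hR ▸ ht.1) (hR ▸ ht.2)
  have hs := hW.sat n hn
  obtain ⟨e, κ, l⟩ := n
  cases κ
  · rfl
  · simp only [NodeSat] at hs
    simp only [nodePhi, phiBad]
    rw [if_pos hs]
  all_goals exact key (by simp [Kind.IsElem]) (by simp) _ hs

theorem treePhi_eq_one (hW : Witness H k α s M X ℓ) (hI : Inv H k α s) :
    treePhi k α M s = 1 := by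
  unfold treePhi
  rw [Multiset.map_congr rfl fun n hn => hW.nodePhi_eq_one hI hn]
  simp

end Witness

end Witnesses

/-! ### Extending and joining witnesses -/

section Extensions

variable {V : Type u} [Fintype V] {H : Hypergraph V} {k : ℕ} {α : ℝ} {s : Memory V}

theorem NodeSat.shift {ℓ : Finset V → ℤ} {n : Node V} (hn : NodeSat k α s ℓ n) (c : ℤ) :
    NodeSat k α s (fun g => ℓ g + c) (n.shift c) := by
  obtain ⟨e, κ, l⟩ := n
  have he : exempt s (fun g => ℓ g + c) (Node.shift c ⟨e, κ, l⟩) = exempt s ℓ ⟨e, κ, l⟩ := by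
    cases κ <;> simp [exempt, Node.shift]
  cases κ
  · trivial
  · exact hn
  all_goals
    simp only [NodeSat, Node.shift] at hn ⊢
    simp only [Node.shift] at he
    rw [he]
    exact hn

theorem surplus_shift (M : Multiset (Node V)) (c : ℤ) :
    surplus (M.map (Node.shift c)) = surplus M := by
  simp only [surplus, Multiset.map_map, Multiset.card_map]
  rfl

/-- All levels may be raised. -/
theorem Witness.shift {M : Multiset (Node V)} {X : Finset (Finset V)} {ℓ : Finset V → ℤ}
    (hW : Witness H k α s M X ℓ) (c : ℤ) :
    Witness H k α s (M.map (Node.shift c)) X (fun g => ℓ g + c) where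
  tree := hW.tree.shift c
  disj v := by
    rw [Multiset.filter_map, Multiset.card_map]
    exact hW.disj v
  colored m hm := by
    obtain ⟨n, hn, rfl⟩ := Multiset.mem_map.1 hm
    exact hW.colored n hn
  det m hm := by
    obtain ⟨n, hn, rfl⟩ := Multiset.mem_map.1 hm
    exact hW.det n hn
  hit m hm := by
    obtain ⟨n, hn, rfl⟩ := Multiset.mem_map.1 hm
    exact hW.hit n hn
  lev m hm hk g hg hne := by
    obtain ⟨n, hn, rfl⟩ := Multiset.mem_map.1 hm
    have := hW.lev n hn hk g hg hne
    simp only [Node.shift]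
    omega
  region := hW.region
  const g hg h hh hadj := by rw [hW.const g hg h hh hadj]
  sat m hm := by
    obtain ⟨n, hn, rfl⟩ := Multiset.mem_map.1 hm
    exact (hW.sat n hn).shift c
  cov g hg := by
    obtain ⟨n, hn, hk, hm, hl⟩ := hW.cov g hg
    exact ⟨_, Multiset.mem_map_of_mem _ hn, hk, hm, by simp only [Node.shift]; omega⟩

theorem card_nbrs_le {f : Finset V} (hf : f ∈ edges H) : (nbrs H f).card ≤ maxEdgeDegree H :=
  Finset.le_sup (f := fun e => (nbrs H e).card) hf

/-- Every covering node meets at most `Δ + 1` edges. -/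
theorem Witness.card_le {M : Multiset (Node V)} {X : Finset (Finset V)} {ℓ : Finset V → ℤ}
    (hW : Witness H k α s M X ℓ) : X.card ≤ (maxEdgeDegree H + 1) * numCover M := by
  have h1 : X ⊆ (M.filter fun n => n.kind.IsCover).toFinset.biUnion
      fun n => insert n.edge (nbrs H n.edge) := by
    intro g hg
    obtain ⟨n, hn, hk, hm, -⟩ := hW.cov g hg
    rw [Finset.mem_biUnion]
    refine ⟨n, by rw [Multiset.mem_toFinset, Multiset.mem_filter]; exact ⟨hn, hk⟩, ?_⟩
    rw [Finset.mem_insert]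
    by_cases hne : g = n.edge
    · exact Or.inl hne
    · exact Or.inr (mem_nbrs_of_meets (hW.region.edge g hg) hne hm)
  calc X.card ≤ _ := Finset.card_le_card h1
    _ ≤ (M.filter fun n => n.kind.IsCover).toFinset.card * (maxEdgeDegree H + 1) := by
        refine Finset.card_biUnion_le_card_mul _ _ _ fun n hn => ?_
        rw [Multiset.mem_toFinset, Multiset.mem_filter] at hn
        exact (Finset.card_insert_le _ _).trans
          (Nat.add_le_add_right (card_nbrs_le (hW.tree.edge_mem hn.1)) 1)
    _ ≤ _ := by
        rw [mul_comm]
        exact Nat.mul_le_mul_left _ (Multiset.toFinset_card_le _)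

/-- A witness with surplus at least two of a large set of bad edges certifies that the potential
is at least one. -/
theorem Witness.one_le_potential {M : Multiset (Node V)} {X : Finset (Finset V)}
    {ℓ : Finset V → ℤ} (hW : Witness H k α s M X ℓ) (hI : Inv H k α s) (hs : 2 ≤ surplus M)
    (hX : componentBound H < (X.card : ℝ)) (hf : s.failed = false) :
    1 ≤ potential H k α s := by
  unfold potential
  split_ifs with h1 h2
  · exact le_rfl
  · simp [hf] at h2
  · obtain ⟨n, hn⟩ := Multiset.exists_mem_of_ne_zero hW.tree.1
    have hW' := hW.shift (-n.lev)
    obtain ⟨t, hv, -, hc⟩ := hW'.tree.2 _ (Multiset.mem_map_of_mem _ hn)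
    have hc0 : t.content 0 = M.map (Node.shift (-n.lev)) := by
      rw [← hc]
      congr 1
      simp [Node.shift]
    have hadm : Admissible H t := by
      refine ⟨hv, hc0 ▸ hW'.disj, by rw [hc0, surplus_shift]; exact hs, ?_⟩
      rw [hc0]
      have hle : (X.card : ℝ) ≤ ((maxEdgeDegree H : ℝ) + 1) *
          numCover (M.map (Node.shift (-n.lev))) := by exact_mod_cast hW'.card_le
      have hlt := hX.trans_le hle
      unfold componentBound at hlt
      have hpos : (0 : ℝ) < (maxEdgeDegree H : ℝ) + 1 := by positivity
      nlinarith
    calc (1 : ℝ≥0∞) = if Admissible H t then treePhi k α (t.content 0) s else 0 := by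
          rw [if_pos hadm, hc0, hW'.treePhi_eq_one hI]
      _ ≤ _ := ENNReal.le_tsum t

/-- The set `X` may be enlarged, with levels of the new edges chosen at will: no event of the tree
meets them. -/
theorem PreWitness.of_subset {M : Multiset (Node V)} {X Y : Finset (Finset V)}
    {ℓ ℓ' : Finset V → ℤ} (hW : PreWitness H k α s M X ℓ) (hXY : X ⊆ Y)
    (hY : Region H s Y) (hℓ : ∀ g ∈ X, ℓ' g = ℓ g)
    (hc : ∀ g ∈ Y, ∀ h ∈ Y, h ∈ nbrs H g → ℓ' g = ℓ' h) : PreWitness H k α s M Y ℓ' where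
  tree := hW.tree
  disj := hW.disj
  colored := hW.colored
  det := hW.det
  hit n hn hk g hg hm := hXY (hW.hit n hn hk g hg hm)
  lev n hn hk g hg hm := by
    have hgX := hW.hit n hn hk.isElem g (hY.bad g hg).1 hm
    rw [hℓ g hgX]
    exact hW.lev n hn hk g hgX hm
  region := hY
  const := hc
  sat n hn := (hW.sat n hn).congr fun hk g hg hm => hℓ g (hW.hit n hn hk g hg hm)

/-- Levels on two regions without common edges. -/
def levelUnion (Y : Finset (Finset V)) (ℓ ℓ' : Finset V → ℤ) : Finset V → ℤ :=
  fun g => if g ∈ Y then ℓ' g else ℓ g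

theorem levelUnion_of_mem {X Y : Finset (Finset V)} {ℓ ℓ' : Finset V → ℤ} (hd : Disjoint X Y)
    {g : Finset V} (hg : g ∈ X) : levelUnion Y ℓ ℓ' g = ℓ g :=
  if_neg (Finset.disjoint_left.1 hd hg)

theorem levelUnion_const {X Y : Finset (Finset V)} {ℓ ℓ' : Finset V → ℤ} (hd : Disjoint X Y)
    (hX : Region H s X) (hY : Region H s Y)
    (hc : ∀ g ∈ X, ∀ h ∈ X, h ∈ nbrs H g → ℓ g = ℓ h)
    (hc' : ∀ g ∈ Y, ∀ h ∈ Y, h ∈ nbrs H g → ℓ' g = ℓ' h) :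
    ∀ g ∈ X ∪ Y, ∀ h ∈ X ∪ Y, h ∈ nbrs H g → levelUnion Y ℓ ℓ' g = levelUnion Y ℓ ℓ' h := by
  intro g hg h hh hadj
  have hhb : h ∈ s.bad := ((hX.union hY).bad h hh).1
  by_cases hgY : g ∈ Y
  · have hhY := hY.closed g hgY h hadj hhb
    simp only [levelUnion, if_pos hgY, if_pos hhY]
    exact hc' g hgY h hhY hadj
  · have hgX : g ∈ X := (Finset.mem_union.1 hg).resolve_right hgY
    have hhX := hX.closed g hgX h hadj hhb
    rw [levelUnion_of_mem hd hgX, levelUnion_of_mem hd hhX]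
    exact hc g hgX h hhX hadj

/-- Two trees with disjoint events, for the same levels, are joined by an edge. -/
theorem PreWitness.join {M₁ M₂ : Multiset (Node V)} {X : Finset (Finset V)} {ℓ : Finset V → ℤ}
    (h₁ : PreWitness H k α s M₁ X ℓ) (h₂ : PreWitness H k α s M₂ X ℓ) {x y : Node V}
    (hx : x ∈ M₁) (hy : y ∈ M₂) (hxy : y.edge ∈ nbrs H x.edge) (hl : y.lev = x.lev)
    (hd : ∀ n ∈ M₁, n.kind.IsElem → ∀ m ∈ M₂, m.kind.IsElem → ¬ (m.edge ∩ n.edge).Nonempty) :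
    PreWitness H k α s (M₁ + M₂) X ℓ where
  tree := h₁.tree.join h₂.tree hx hy hxy (nbrs_symm (h₁.tree.edge_mem hx) hxy) 0 (by simp [hl])
  disj := h₁.disj.add h₂.disj hd
  colored n hn := (Multiset.mem_add.1 hn).elim (h₁.colored n) (h₂.colored n)
  det n hn := (Multiset.mem_add.1 hn).elim (h₁.det n) (h₂.det n)
  hit n hn := (Multiset.mem_add.1 hn).elim (h₁.hit n) (h₂.hit n)
  lev n hn := (Multiset.mem_add.1 hn).elim (h₁.lev n) (h₂.lev n)
  region := h₁.region
  const := h₁.const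
  sat n hn := (Multiset.mem_add.1 hn).elim (h₁.sat n) (h₂.sat n)

theorem PreWitness.single {X : Finset (Finset V)} (hX : Region H s X) {n : Node V}
    (hn : n.edge ∈ edges H) (hl : n.lev = 0) (hcol : s.uncoloredPart n.edge = ∅)
    (hdet : ∀ g ∈ nbrs H n.edge, s.Det g) (hhit : ∀ g ∈ s.bad, (g ∩ n.edge).Nonempty → g ∈ X)
    (hsat : NodeSat k α s (fun _ => 0) n) : PreWitness H k α s {n} X (fun _ => 0) where
  tree := IsT.singleton hn
  disj := Disj.singleton n
  colored m hm _ := by rw [Multiset.mem_singleton.1 hm]; exact hcol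
  det m hm _ := by rw [Multiset.mem_singleton.1 hm]; exact hdet
  hit m hm _ := by rw [Multiset.mem_singleton.1 hm]; exact hhit
  lev m hm _ g _ _ := by rw [Multiset.mem_singleton.1 hm, hl]
  region := hX
  const _ _ _ _ _ := rfl
  sat m hm := by rw [Multiset.mem_singleton.1 hm]; exact hsat

/-- The event that justifies to continue from `X` to the bad edges of `N`, which are connected with
`X` by the edge `f`: either `f` meets two disjoint edges of `N`, or sufficiently many vertices of
`f` have the same color, except for a few vertices troubled by `X` or a few vertices troubled
by `N`. -/
def Trigger (H : Hypergraph V) (k : ℕ) (α : ℝ) (s : Memory V) (X N : Finset (Finset V))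
    (f : Finset V) : Prop :=
  (∃ b₁ ∈ N, ∃ b₂ ∈ N, b₁ ∈ nbrs H f ∧ b₂ ∈ nbrs H f ∧ Disjoint b₁ b₂) ∨
  (f ∉ s.bad ∧ s.uncoloredPart f = ∅ ∧ (∀ g ∈ nbrs H f, s.Det g) ∧
    (∀ g ∈ nbrs H f, g ∈ s.bad → g ∈ X ∪ N) ∧
    ((s.Mono (f \ (s.troubledPart f ∩ verts X)) ∧
        ((s.troubledPart f ∩ verts X).card : ℝ) < α * k) ∨
      (s.Mono (s.acceptedPart f ∪ (s.troubledPart f ∩ verts X)) ∧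
        ((s.troubledPart f \ verts X).card : ℝ) < α * k) ∨
      s.Mono f))

theorem badThr_le_card (hp : Params H k α) {f S : Finset V} (hf : f ∈ edges H)
    (h : (S.card : ℝ) < α * k) : badThr k α ≤ (f \ S).card := by
  refine Nat.ceil_le.2 ?_
  have h1 : f.card ≤ (f \ S).card + S.card := by
    have := Finset.le_card_sdiff S f
    omega
  rw [hp.unif f hf] at h1
  have h2 : (k : ℝ) ≤ ((f \ S).card : ℝ) + (S.card : ℝ) := by exact_mod_cast h1
  nlinarith

/-- If `f` meets the edge of some event, then each connected set of bad edges next to `f` can be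
added: a `blank` node for `f` and one bad edge next to it are attached, and the two tree edges are
paid for by the credit of the bad edge. -/
theorem Witness.extend_of_met {M : Multiset (Node V)} {X N : Finset (Finset V)}
    {ℓ : Finset V → ℤ} (hW : Witness H k α s M X ℓ) (hI : Inv H k α s)
    (hN : Region H s N) (hne : N.Nonempty) (hd : Disjoint X N) {f : Finset V} (hf : f ∈ edges H)
    (hgen : GenFrom H N {g | g ∈ nbrs H f}) (hmet : Met M f) :
    ∃ M' ℓ', Witness H k α s M' (X ∪ N) ℓ' ∧ surplus M ≤ surplus M' ∧
      ∀ n ∈ M', n.kind.IsElem → n ∈ M ∨ n.edge ∈ N := by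
  obtain ⟨n, hn, hk, hm⟩ := hmet
  obtain ⟨b, hbN, hbf⟩ := hgen.exists_mem hne
  have hunmet : ∀ g ∈ N, ¬ Met M g := by
    rintro g hg ⟨n', hn', hk', hm'⟩
    exact Finset.disjoint_left.1 hd (hW.hit n' hn' hk' g (hN.bad g hg).1 hm') hg
  have hfn : f ≠ n.edge := by
    rintro rfl
    exact hunmet b hbN ⟨n, hn, hk, meets_of_mem_nbrs hbf⟩
  set ℓ' := levelUnion N ℓ fun _ => n.lev with hℓ'
  have hℓN : ∀ g ∈ N, ℓ' g = n.lev := fun g hg => if_pos hg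
  have hP := hW.toPreWitness.of_subset (ℓ' := ℓ') Finset.subset_union_left
    (hW.region.union hN) (fun g hg => levelUnion_of_mem hd hg)
    (levelUnion_const hd hW.region hN hW.const fun _ _ _ _ _ => rfl)
  have hP₁ := hP.cons_blank hn (mem_nbrs_of_meets hf hfn hm)
  have hP₂ := hP₁.cons_bad hI (Multiset.mem_cons_self _ _) (Finset.mem_union_right _ hbN) hbf
    (hℓN b hbN) (by
      rintro ⟨n', hn', hk', hm'⟩
      rcases Multiset.mem_cons.1 hn' with rfl | hn'
      · exact hk' rfl
      · exact hunmet b hbN ⟨n', hn', hk', hm'⟩)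
  rw [hℓN b hbN] at hP₂
  obtain ⟨M', hle, hW', hcov, hsur, hsub⟩ := PreWitness.absorb hI (n₀ := ⟨f, .blank, n.lev⟩)
    Finset.subset_union_right hℓN rfl hgen _ _ hP₂
    (Multiset.mem_cons_of_mem (Multiset.mem_cons_self _ _))
    (fun n' hn' hk' g hg hm' => by
      rcases Multiset.mem_cons.1 hn' with rfl | hn'
      · exact ⟨Or.inl rfl, rfl⟩
      · rcases Multiset.mem_cons.1 hn' with rfl | hn'
        · exact absurd rfl hk'
        · exact absurd ⟨n', hn', hk', hm'⟩ (hunmet g hg))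
    (fun c _ hc => Or.inr hc) le_rfl
  have hle' : M ≤ M' := ((Multiset.le_cons_self _ _).trans (Multiset.le_cons_self _ _)).trans hle
  refine ⟨M', ℓ', ⟨hW', fun g hg => ?_⟩, ?_, fun n' hn' hk' => ?_⟩
  · rcases Finset.mem_union.1 hg with hg | hg
    · obtain ⟨m, hm, h1, h2, h3⟩ := hW.cov g hg
      exact ⟨m, Multiset.mem_of_le hle' hm, h1, h2, h3.trans (levelUnion_of_mem hd hg).symm⟩
    · exact hcov g hg
  · rw [surplus_cons, surplus_cons] at hsur
    simp only [Kind.credit] at hsur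
    omega
  · rcases hsub n' hn' hk' with h | h
    · rcases Multiset.mem_cons.1 h with rfl | h
      · exact Or.inr hbN
      · rcases Multiset.mem_cons.1 h with rfl | h
        · exact absurd rfl hk'
        · exact Or.inl h
    · exact Or.inr h

/-- If `f` meets two disjoint new bad edges, then these are two new events, which pay for the
`blank` nodes of `x` and `f` that connect them with the tree. -/
theorem Witness.extend_of_disjoint {M : Multiset (Node V)} {X N : Finset (Finset V)}
    {ℓ : Finset V → ℤ} (hW : Witness H k α s M X ℓ) (hI : Inv H k α s)
    (hN : Region H s N) (hd : Disjoint X N) {f : Finset V} (hf : f ∈ edges H)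
    (hgen : GenFrom H N {g | g ∈ nbrs H f}) (hmet : ¬ Met M f) {x : Finset V} (hx : x ∈ X)
    (hxf : x ∈ nbrs H f) {b₁ b₂ : Finset V} (h₁ : b₁ ∈ N) (h₂ : b₂ ∈ N) (hf₁ : b₁ ∈ nbrs H f)
    (hf₂ : b₂ ∈ nbrs H f) (hdis : Disjoint b₁ b₂) :
    ∃ M' ℓ', Witness H k α s M' (X ∪ N) ℓ' ∧ surplus M ≤ surplus M' ∧
      ∀ n ∈ M', n.kind.IsElem → n ∈ M ∨ n.edge ∈ N := by
  obtain ⟨n, hn, hk, hm, -⟩ := hW.cov x hx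
  have hunmet : ∀ g ∈ N, ¬ Met M g := by
    rintro g hg ⟨n', hn', hk', hm'⟩
    exact Finset.disjoint_left.1 hd (hW.hit n' hn' hk' g (hN.bad g hg).1 hm') hg
  have hxn : x ≠ n.edge := by
    rintro rfl
    exact hmet ⟨n, hn, hk.isElem, meets_comm.1 (meets_of_mem_nbrs hxf)⟩
  have hfx := nbrs_symm hf hxf
  set ℓ' := levelUnion N ℓ fun _ => n.lev with hℓ'
  have hℓN : ∀ g ∈ N, ℓ' g = n.lev := fun g hg => if_pos hg
  have hP := hW.toPreWitness.of_subset (ℓ' := ℓ') Finset.subset_union_left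
    (hW.region.union hN) (fun g hg => levelUnion_of_mem hd hg)
    (levelUnion_const hd hW.region hN hW.const fun _ _ _ _ _ => rfl)
  have hP₁ := (hP.cons_blank hn (mem_nbrs_of_meets (hW.region.edge x hx) hxn hm)).cons_blank
    (Multiset.mem_cons_self _ _) hfx
  have hP₂ := hP₁.cons_bad hI (Multiset.mem_cons_self _ _) (Finset.mem_union_right _ h₁) hf₁
    (hℓN b₁ h₁) (by
      rintro ⟨n', hn', hk', hm'⟩
      rcases Multiset.mem_cons.1 hn' with rfl | hn'
      · exact hk' rfl
      · rcases Multiset.mem_cons.1 hn' with rfl | hn'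
        · exact hk' rfl
        · exact hunmet b₁ h₁ ⟨n', hn', hk', hm'⟩)
  have hP₃ := hP₂.cons_bad hI (Multiset.mem_cons_of_mem (Multiset.mem_cons_self _ _))
    (Finset.mem_union_right _ h₂) hf₂ (hℓN b₂ h₂) (by
      rintro ⟨n', hn', hk', hm'⟩
      rcases Multiset.mem_cons.1 hn' with rfl | hn'
      · exact not_meets_of_disjoint hdis.symm hm'
      · rcases Multiset.mem_cons.1 hn' with rfl | hn'
        · exact hk' rfl
        · rcases Multiset.mem_cons.1 hn' with rfl | hn'
          · exact hk' rfl
          · exact hunmet b₂ h₂ ⟨n', hn', hk', hm'⟩)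
  rw [hℓN b₁ h₁, hℓN b₂ h₂] at hP₃
  obtain ⟨M', hle, hW', hcov, hsur, hsub⟩ := PreWitness.absorb hI (n₀ := ⟨f, .blank, n.lev⟩)
    Finset.subset_union_right hℓN rfl hgen _ _ hP₃
    (Multiset.mem_cons_of_mem (Multiset.mem_cons_of_mem (Multiset.mem_cons_self _ _)))
    (fun n' hn' hk' g hg hm' => by
      rcases Multiset.mem_cons.1 hn' with rfl | hn'
      · exact ⟨Or.inl rfl, rfl⟩
      rcases Multiset.mem_cons.1 hn' with rfl | hn'
      · exact ⟨Or.inl rfl, rfl⟩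
      rcases Multiset.mem_cons.1 hn' with rfl | hn'
      · exact absurd rfl hk'
      rcases Multiset.mem_cons.1 hn' with rfl | hn'
      · exact absurd rfl hk'
      exact absurd ⟨n', hn', hk', hm'⟩ (hunmet g hg))
    (fun c _ hc => Or.inr hc) le_rfl
  have hle' : M ≤ M' := ((((Multiset.le_cons_self _ _).trans (Multiset.le_cons_self _ _)).trans
    (Multiset.le_cons_self _ _)).trans (Multiset.le_cons_self _ _)).trans hle
  refine ⟨M', ℓ', ⟨hW', fun g hg => ?_⟩, ?_, fun n' hn' hk' => ?_⟩
  · rcases Finset.mem_union.1 hg with hg | hg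
    · obtain ⟨m, hm, h1, h2, h3⟩ := hW.cov g hg
      exact ⟨m, Multiset.mem_of_le hle' hm, h1, h2, h3.trans (levelUnion_of_mem hd hg).symm⟩
    · exact hcov g hg
  · rw [surplus_cons, surplus_cons, surplus_cons, surplus_cons] at hsur
    simp only [Kind.credit] at hsur
    omega
  · rcases hsub n' hn' hk' with h | h
    · rcases Multiset.mem_cons.1 h with rfl | h
      · exact Or.inr h₂
      rcases Multiset.mem_cons.1 h with rfl | h
      · exact Or.inr h₁
      rcases Multiset.mem_cons.1 h with rfl | h
      · exact absurd rfl hk'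
      rcases Multiset.mem_cons.1 h with rfl | h
      · exact absurd rfl hk'
      exact Or.inl h
    · exact Or.inr h

/-- Here the event of `f` itself is added, on a level above those of the adjacent edges of `X`, so that
these count as previously covered. Its credit pays for the `blank` node that connects it with the
tree, and it covers the edges of `N` next to `f`, which get the same level. -/
theorem Witness.extend_of_event {M : Multiset (Node V)} {X N : Finset (Finset V)}
    {ℓ : Finset V → ℤ} (hW : Witness H k α s M X ℓ) (hI : Inv H k α s)
    (hp : Params H k α)
    (hN : Region H s N) (hd : Disjoint X N) {f : Finset V} (hf : f ∈ edges H)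
    (hgen : GenFrom H N {g | g ∈ nbrs H f}) (hmet : ¬ Met M f) {x : Finset V} (hx : x ∈ X)
    (hxf : x ∈ nbrs H f) (hfb : f ∉ s.bad) (hcol : s.uncoloredPart f = ∅)
    (hdet : ∀ g ∈ nbrs H f, s.Det g) (hbad : ∀ g ∈ nbrs H f, g ∈ s.bad → g ∈ X ∪ N)
    (hev : (s.Mono (f \ (s.troubledPart f ∩ verts X)) ∧
        ((s.troubledPart f ∩ verts X).card : ℝ) < α * k) ∨
      (s.Mono (s.acceptedPart f ∪ (s.troubledPart f ∩ verts X)) ∧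
        ((s.troubledPart f \ verts X).card : ℝ) < α * k) ∨ s.Mono f) :
    ∃ M' ℓ', Witness H k α s M' (X ∪ N) ℓ' ∧ surplus M ≤ surplus M' ∧
      ∀ n ∈ M', n.kind.IsElem → n ∈ M ∨ n.edge ∈ N ∨ n.edge = f := by
  -- Attaching the new node next to an edge `y` of maximal level makes the levels of adjacent nodes
  -- differ by one.
  obtain ⟨y, hy, hmax⟩ := Finset.exists_max_image (X.filter fun g => g ∈ nbrs H f) ℓ
    ⟨x, Finset.mem_filter.2 ⟨hx, hxf⟩⟩
  rw [Finset.mem_filter] at hy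
  obtain ⟨n, hn, hk, hm, hnl⟩ := hW.cov y hy.1
  have hunmet : ∀ g ∈ N, ¬ Met M g := by
    rintro g hg ⟨n', hn', hk', hm'⟩
    exact Finset.disjoint_left.1 hd (hW.hit n' hn' hk' g (hN.bad g hg).1 hm') hg
  have hyn : y ≠ n.edge := by
    rintro rfl
    exact hmet ⟨n, hn, hk.isElem, meets_comm.1 (meets_of_mem_nbrs hy.2)⟩
  have hfy := nbrs_symm hf hy.2
  set l := ℓ y + 1 with hl
  set ℓ' := levelUnion N ℓ fun _ => l with hℓ'
  have hℓN : ∀ g ∈ N, ℓ' g = l := fun g hg => if_pos hg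
  have hℓX : ∀ g ∈ X, ℓ' g = ℓ g := fun g hg => levelUnion_of_mem hd hg
  have hlow : ∀ g ∈ X, (g ∩ f).Nonempty → ℓ' g < l := by
    intro g hg hgm
    rw [hℓX g hg]
    have : g ≠ f := by rintro rfl; exact hfb (hW.region.bad g hg).1
    have := hmax g (Finset.mem_filter.2 ⟨hg, mem_nbrs_of_meets (hW.region.edge g hg) this hgm⟩)
    omega
  have hhit : ∀ g ∈ s.bad, (g ∩ f).Nonempty → g ∈ X ∪ N := by
    intro g hg hgm
    have : g ≠ f := by rintro rfl; exact hfb hg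
    exact hbad g (mem_nbrs_of_meets (hI.bad_sub g hg) this hgm) hg
  have hP := hW.toPreWitness.of_subset (ℓ' := ℓ') Finset.subset_union_left
    (hW.region.union hN) (fun g hg => levelUnion_of_mem hd hg)
    (levelUnion_const hd hW.region hN hW.const fun _ _ _ _ _ => rfl)
  have hP₁ := hP.cons_blank hn (mem_nbrs_of_meets (hW.region.edge y hy.1) hyn hm)
  have hcard : f.card = k := hp.unif f hf
  -- The kind of the new node depends on which troubled vertices are exempted in the trigger.
  have hsat : ∃ κ : Kind, κ.IsCover ∧ 2 ≤ κ.credit ∧ NodeSat k α s ℓ' ⟨f, κ, l⟩ := by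
    rcases hev with ⟨h1, h2⟩ | ⟨h1, h2⟩ | h1
    · refine ⟨.inn, Or.inr (Or.inl rfl), le_rfl, ?_⟩
      have he : exempt s ℓ' ⟨f, .inn, l⟩ = s.troubledPart f ∩ verts X := by
        ext w
        simp only [exempt, Finset.mem_filter, Finset.mem_inter, Memory.mem_troubledPart, mem_verts]
        constructor
        · rintro ⟨hw, ht, g, hg, hwg, hlt⟩
          rcases Finset.mem_union.1 (hhit g hg (meets_of_mem hwg hw)) with hgX | hgN
          · exact ⟨⟨hw, ht⟩, g, hgX, hwg⟩
          · rw [hℓN g hgN] at hlt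
            exact absurd hlt (lt_irrefl _)
        · rintro ⟨⟨hw, ht⟩, g, hgX, hwg⟩
          exact ⟨hw, ht, g, (hW.region.bad g hgX).1, hwg, hlow g hgX (meets_of_mem hwg hw)⟩
      simp only [NodeSat, he]
      exact ⟨h1, badThr_le_card hp hf h2⟩
    · refine ⟨.out, Or.inr (Or.inr (Or.inl rfl)), le_rfl, ?_⟩
      have he : exempt s ℓ' ⟨f, .out, l⟩ ⊆ s.troubledPart f \ verts X := by
        intro w
        simp only [exempt, Finset.mem_filter, Finset.mem_sdiff, Memory.mem_troubledPart, mem_verts]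
        rintro ⟨hw, ht, g, hg, hwg, hlt⟩
        refine ⟨⟨hw, ht⟩, ?_⟩
        rintro ⟨g', hg', hwg'⟩
        have := hW.region.mem_of_meets hg' hg (hI.bad_sub g hg) (meets_of_mem hwg hwg')
        exact hlt (hlow g this (meets_of_mem hwg hw))
      have hsub : f \ exempt s ℓ' ⟨f, .out, l⟩ ⊆
          s.acceptedPart f ∪ (s.troubledPart f ∩ verts X) := by
        intro w
        simp only [exempt, Finset.mem_filter, Finset.mem_sdiff, Memory.mem_troubledPart, mem_verts,
          Finset.mem_union, Finset.mem_inter, Memory.mem_acceptedPart]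
        rintro ⟨hw, hnot⟩
        have hu := Memory.uncoloredPart_eq_empty.1 hcol w hw
        cases hst : s.status w
        · exact absurd hst hu
        · exact Or.inl ⟨hw, rfl⟩
        · obtain ⟨g₀, -, hwg₀, hb₀⟩ := hI.troubled w hst
          refine Or.inr ⟨⟨hw, rfl⟩, g₀, ?_, hwg₀⟩
          refine (Finset.mem_union.1 (hhit g₀ hb₀.1 (meets_of_mem hwg₀ hw))).resolve_right ?_
          intro hgN
          exact hnot ⟨hw, hst, g₀, hb₀.1, hwg₀, by rw [hℓN g₀ hgN]; exact lt_irrefl _⟩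
      simp only [NodeSat]
      refine ⟨h1.subset hsub, badThr_le_card hp hf (lt_of_le_of_lt ?_ h2)⟩
      exact_mod_cast Finset.card_le_card he
    · refine ⟨.full, Or.inr (Or.inr (Or.inr rfl)), by simp [Kind.credit], ?_⟩
      simp only [NodeSat, exempt, Finset.sdiff_empty]
      exact ⟨h1, hcard.ge⟩
  obtain ⟨κ, hκc, hκ, hsat⟩ := hsat
  have hP₂ := hP₁.cons_elem (m := ⟨f, κ, l⟩) (Multiset.mem_cons_self _ _) hfy 1
    (by simp [hl, hnl]) (by
      rintro ⟨n', hn', hk', hm'⟩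
      rcases Multiset.mem_cons.1 hn' with rfl | hn'
      · exact hk' rfl
      · exact hmet ⟨n', hn', hk', hm'⟩) hcol hdet hhit
    (fun _ g hg hgm => by
      rcases Finset.mem_union.1 hg with hg | hg
      · exact (hlow g hg hgm).le
      · exact (hℓN g hg).le) hsat
  obtain ⟨M', hle, hW', hcov, hsur, hsub⟩ := PreWitness.absorb hI (n₀ := ⟨f, κ, l⟩)
    Finset.subset_union_right hℓN rfl hgen _ _ hP₂ (Multiset.mem_cons_self _ _)
    (fun n' hn' hk' g hg hm' => by
      rcases Multiset.mem_cons.1 hn' with rfl | hn'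
      · exact ⟨hκc, rfl⟩
      rcases Multiset.mem_cons.1 hn' with rfl | hn'
      · exact absurd rfl hk'
      exact absurd ⟨n', hn', hk', hm'⟩ (hunmet g hg))
    (fun c _ hc => Or.inr hc) le_rfl
  have hle' : M ≤ M' := ((Multiset.le_cons_self _ _).trans (Multiset.le_cons_self _ _)).trans hle
  refine ⟨M', ℓ', ⟨hW', fun g hg => ?_⟩, ?_, fun n' hn' hk' => ?_⟩
  · rcases Finset.mem_union.1 hg with hg | hg
    · obtain ⟨m, hm, h1, h2, h3⟩ := hW.cov g hg
      exact ⟨m, Multiset.mem_of_le hle' hm, h1, h2, h3.trans (levelUnion_of_mem hd hg).symm⟩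
    · exact hcov g hg
  · rw [surplus_cons, surplus_cons] at hsur
    have : (2 : ℤ) ≤ (κ.credit : ℤ) := by exact_mod_cast hκ
    simp only [Kind.credit] at hsur this
    omega
  · rcases hsub n' hn' hk' with h | h
    · rcases Multiset.mem_cons.1 h with rfl | h
      · exact Or.inr (Or.inr rfl)
      rcases Multiset.mem_cons.1 h with rfl | h
      · exact absurd rfl hk'
      exact Or.inl h
    · exact Or.inr (Or.inl h)

/-- A witness can be extended by the bad edges that are found via an edge `f` with a trigger, without
loss of surplus. -/
theorem Witness.extend {M : Multiset (Node V)} {X N : Finset (Finset V)}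
    {ℓ : Finset V → ℤ} (hW : Witness H k α s M X ℓ) (hI : Inv H k α s)
    (hp : Params H k α) (hN : Region H s N) (hne : N.Nonempty) (hd : Disjoint X N)
    {f : Finset V} (hf : f ∈ edges H) (hgen : GenFrom H N {g | g ∈ nbrs H f}) {x : Finset V}
    (hx : x ∈ X) (hxf : x ∈ nbrs H f) (hT : Trigger H k α s X N f) :
    ∃ M' ℓ', Witness H k α s M' (X ∪ N) ℓ' ∧ surplus M ≤ surplus M' ∧
      ∀ n ∈ M', n.kind.IsElem → n ∈ M ∨ n.edge ∈ N ∨ n.edge = f := by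
  by_cases hmet : Met M f
  · obtain ⟨M', ℓ', h1, h2, h3⟩ := hW.extend_of_met hI hN hne hd hf hgen hmet
    exact ⟨M', ℓ', h1, h2, fun n hn hk => (h3 n hn hk).imp_right Or.inl⟩
  rcases hT with ⟨b₁, h₁, b₂, h₂, hf₁, hf₂, hdis⟩ | ⟨h1, h2, h3, h4, h5⟩
  · obtain ⟨M', ℓ', h1, h2, h3⟩ :=
      hW.extend_of_disjoint hI hN hd hf hgen hmet hx hxf h₁ h₂ hf₁ hf₂ hdis
    exact ⟨M', ℓ', h1, h2, fun n hn hk => (h3 n hn hk).imp_right Or.inl⟩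
  · exact hW.extend_of_event hI hp hN hd hf hgen hmet hx hxf h1 h2 h3 h4 h5

end Extensions

/-! ### Witnesses of search areas -/

section SearchAreas

variable {V : Type u} [Fintype V] {H : Hypergraph V} {k : ℕ} {α : ℝ} {s : Memory V}

/-- A connected component of the bad edges, whose surroundings have been determined. -/
structure Comp (H : Hypergraph V) (s : Memory V) (C : Finset (Finset V)) : Prop
    extends Region H s C where
  nonempty : C.Nonempty
  conn : ∀ c ∈ C, GenFrom H C {c}

theorem Comp.genFrom {C : Finset (Finset V)} (hC : Comp H s C) {S : Set (Finset V)}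
    {c : Finset V} (hc : c ∈ C) (hS : c ∈ S) : GenFrom H C S :=
  (hC.conn c hc).mono fun g _ hg => by rw [Set.mem_singleton_iff] at hg; exact hg ▸ hS

theorem Comp.subset_of_mem {C X : Finset (Finset V)} (hC : Comp H s C) (hX : Region H s X)
    {c : Finset V} (hc : c ∈ C) (hcX : c ∈ X) : C ⊆ X :=
  hC.conn c hc {g | g ∈ X} (fun _ _ hgS => by rw [Set.mem_singleton_iff] at hgS; exact hgS ▸ hcX)
    fun a _ haX h hh hadj => hX.closed a haX h hadj (hC.bad h hh).1

theorem Comp.disjoint_of_notMem {C X : Finset (Finset V)} (hC : Comp H s C) (hX : Region H s X)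
    {c : Finset V} (hc : c ∈ C) (hcX : c ∉ X) : Disjoint X C :=
  Finset.disjoint_left.2 fun _ hgX hgC => hcX (hC.subset_of_mem hX hgC hgX hc)

/-- A set of components of bad edges in which each component, except for the first one, is joined
to an earlier one by an edge `f` that meets just these two components, and whose vertices have the
same color, except for a few vertices outside of the earlier component. This describes the search
area as long as a conditional expansion runs. -/
inductive Linked (H : Hypergraph V) (k : ℕ) (α : ℝ) (s : Memory V) : Finset (Finset V) → Prop
  | comp {C : Finset (Finset V)} (h : Comp H s C) : Linked H k α s C
  | link {A C₁ C₂ : Finset (Finset V)} {f : Finset V} (h : Linked H k α s A) (h₁ : Comp H s C₁)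
      (hsub : C₁ ⊆ A) (h₂ : Comp H s C₂) (hd : Disjoint A C₂) (hf : f ∈ edges H)
      (hfb : f ∉ s.bad) (hcol : s.uncoloredPart f = ∅) (hdet : ∀ g ∈ nbrs H f, s.Det g)
      (hbad : ∀ g ∈ nbrs H f, g ∈ s.bad → g ∈ C₁ ∪ C₂)
      (hm₁ : ∃ g ∈ C₁, g ∈ nbrs H f) (hm₂ : ∃ g ∈ C₂, g ∈ nbrs H f)
      (hmono : s.Mono (s.acceptedPart f ∪ (s.troubledPart f ∩ verts C₁)))
      (hcard : ((s.troubledPart f \ verts C₁).card : ℝ) < α * k) : Linked H k α s (A ∪ C₂)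

theorem Linked.region {A : Finset (Finset V)} (h : Linked H k α s A) : Region H s A := by
  induction h with
  | comp h => exact h.toRegion
  | link _ _ _ h₂ _ _ _ _ _ _ _ _ _ _ ih => exact ih.union h₂.toRegion

theorem Linked.exists_comp {A : Finset (Finset V)} (h : Linked H k α s A) :
    A.Nonempty ∧ ∀ a ∈ A, ∃ C, Comp H s C ∧ C ⊆ A ∧ a ∈ C := by
  induction h with
  | comp h => exact ⟨h.nonempty, fun a ha => ⟨_, h, subset_rfl, ha⟩⟩
  | link _ _ _ h₂ _ _ _ _ _ _ _ _ _ _ ih =>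
    refine ⟨ih.1.mono Finset.subset_union_left, fun a ha => ?_⟩
    rcases Finset.mem_union.1 ha with ha | ha
    · obtain ⟨C, h1, h2, h3⟩ := ih.2 a ha
      exact ⟨C, h1, h2.trans Finset.subset_union_left, h3⟩
    · exact ⟨_, h₂, Finset.subset_union_right, ha⟩

/-- `e` belongs to `A`, or is a neighbour of an edge of `A`. -/
def Near (H : Hypergraph V) (A : Finset (Finset V)) (e : Finset V) : Prop :=
  e ∈ A ∨ ∃ a ∈ A, e ∈ nbrs H a

theorem Near.mono {A A' : Finset (Finset V)} {e : Finset V} (h : Near H A e) (hA : A ⊆ A') :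
    Near H A' e :=
  h.imp (fun h => hA h) fun ⟨a, ha, h⟩ => ⟨a, hA ha, h⟩

/-- The links can be used in both directions: if the component behind a link has been covered
first, then the edge `f` of the link has a color that is common to all vertices except for a few
vertices in that component. So a witness that covers any edge of `A` can be extended to all of
`A`. -/
theorem Linked.grow (hI : Inv H k α s) (hp : Params H k α) {A : Finset (Finset V)}
    (hA : Linked H k α s A) :
    ∀ (M : Multiset (Node V)) (X : Finset (Finset V)) (ℓ : Finset V → ℤ), Witness H k α s M X ℓ →
      (∃ g ∈ X, g ∈ A) → ∃ M' ℓ', Witness H k α s M' (X ∪ A) ℓ' ∧ surplus M ≤ surplus M' ∧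
        ∀ n ∈ M', n.kind.IsElem → n ∈ M ∨ Near H A n.edge := by
  induction hA with
  | @comp C h =>
    rintro M X ℓ hW ⟨g, hgX, hgC⟩
    have hsub := h.subset_of_mem hW.region hgC hgX
    rw [Finset.union_eq_left.2 hsub]
    exact ⟨M, ℓ, hW, le_rfl, fun n hn _ => Or.inl hn⟩
  | @link A C₁ C₂ f hA h₁ hsub h₂ hd hf hfb hcol hdet hbad hm₁ hm₂ hmono hcard ih =>
    rintro M X ℓ hW hex
    obtain ⟨g₁, hg₁, hgf₁⟩ := hm₁
    obtain ⟨g₂, hg₂, hgf₂⟩ := hm₂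
    have hnear : ∀ {e : Finset V}, e ∈ C₁ ∨ e ∈ C₂ ∨ e = f → Near H (A ∪ C₂) e := by
      rintro e (h | h | rfl)
      · exact Or.inl (Finset.mem_union_left _ (hsub h))
      · exact Or.inl (Finset.mem_union_right _ h)
      · exact Or.inr ⟨g₂, Finset.mem_union_right _ hg₂, nbrs_symm hf hgf₂⟩
    have hC₁₂ : Disjoint C₁ C₂ := hd.mono_left hsub
    -- From `A` to `C₂`: the exempted vertices belong to the new component, as in a node `out`.
    have hforward : ∀ (M : Multiset (Node V)) (X : Finset (Finset V)) (ℓ : Finset V → ℤ),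
        Witness H k α s M X ℓ → A ⊆ X → ∃ M' ℓ', Witness H k α s M' (X ∪ C₂) ℓ' ∧
          surplus M ≤ surplus M' ∧ ∀ n ∈ M', n.kind.IsElem → n ∈ M ∨ Near H (A ∪ C₂) n.edge := by
      intro M X ℓ hW hAX
      by_cases hmem : g₂ ∈ X
      · rw [Finset.union_eq_left.2 (h₂.subset_of_mem hW.region hg₂ hmem)]
        exact ⟨M, ℓ, hW, le_rfl, fun n hn _ => Or.inl hn⟩
      have hdX := h₂.disjoint_of_notMem hW.region hg₂ hmem
      have hV : s.troubledPart f ∩ verts X = s.troubledPart f ∩ verts C₁ := by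
        ext w
        simp only [Finset.mem_inter, mem_verts, Memory.mem_troubledPart]
        refine and_congr_right fun hw => ⟨?_, ?_⟩
        · rintro ⟨g, hg, hwg⟩
          have hgb := (hW.region.bad g hg).1
          have hgf : g ≠ f := by rintro rfl; exact hfb hgb
          have := hbad g (mem_nbrs_of_mem (hW.region.edge g hg) hgf hwg hw.1) hgb
          exact ⟨g, (Finset.mem_union.1 this).resolve_right (Finset.disjoint_left.1 hdX hg), hwg⟩
        · rintro ⟨g, hg, hwg⟩
          exact ⟨g, hAX (hsub hg), hwg⟩
      have hV' : s.troubledPart f \ verts X = s.troubledPart f \ verts C₁ := by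
        rw [← Finset.sdiff_inter_self_left, hV, Finset.sdiff_inter_self_left]
      obtain ⟨M', ℓ', hW', hs', hl'⟩ := hW.extend hI hp h₂.toRegion h₂.nonempty hdX hf
        (h₂.genFrom hg₂ hgf₂) (hAX (hsub hg₁)) hgf₁
        (Or.inr ⟨hfb, hcol, hdet,
          fun g hg hgb => Finset.union_subset_union_left (hsub.trans hAX) (hbad g hg hgb),
          Or.inr (Or.inl ⟨by rwa [hV], by rwa [hV']⟩)⟩)
      exact ⟨M', ℓ', hW', hs', fun n hn hk => (hl' n hn hk).imp_right fun h => hnear (Or.inr h)⟩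
    by_cases hXA : ∃ g ∈ X, g ∈ A
    · obtain ⟨M₁, ℓ₁, hW₁, hs₁, hl₁⟩ := ih M X ℓ hW hXA
      obtain ⟨M', ℓ', hW', hs', hl'⟩ := hforward M₁ _ ℓ₁ hW₁ Finset.subset_union_right
      rw [Finset.union_assoc] at hW'
      refine ⟨M', ℓ', hW', hs₁.trans hs', fun n hn hk => ?_⟩
      rcases hl' n hn hk with h | h
      · exact (hl₁ n h hk).imp_right fun h => h.mono Finset.subset_union_left
      · exact Or.inr h
    · -- From `C₂` back to `A`: the exempted vertices belong to the component that has been covered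
      -- already, as in a node `inn`.
      push Not at hXA
      obtain ⟨g, hgX, hgA⟩ := hex
      have hgC₂ := (Finset.mem_union.1 hgA).resolve_left (hXA g hgX)
      have hC₂X := h₂.subset_of_mem hW.region hgC₂ hgX
      have hdX : Disjoint X C₁ := Finset.disjoint_left.2 fun e he he' => hXA e he (hsub he')
      have hout : ∀ w ∈ f, s.status w = Status.troubled → w ∉ verts X → w ∈ verts C₁ := by
        intro w hw ht hwX
        obtain ⟨g₀, hg₀, hwg₀, hb₀⟩ := hI.troubled w ht
        have hgf : g₀ ≠ f := by rintro rfl; exact hfb hb₀.1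
        refine mem_verts.2 ⟨g₀, ?_, hwg₀⟩
        refine (Finset.mem_union.1 (hbad g₀ (mem_nbrs_of_mem hg₀ hgf hwg₀ hw) hb₀.1)).resolve_right
          fun h => hwX (mem_verts.2 ⟨g₀, hC₂X h, hwg₀⟩)
      have hmono' : s.Mono (f \ (s.troubledPart f ∩ verts X)) := by
        refine hmono.subset fun w hw => ?_
        simp only [Finset.mem_sdiff, Finset.mem_inter, Memory.mem_troubledPart] at hw
        rw [Finset.mem_union, Memory.mem_acceptedPart, Finset.mem_inter, Memory.mem_troubledPart]
        have hu := Memory.uncoloredPart_eq_empty.1 hcol w hw.1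
        cases hst : s.status w
        · exact absurd hst hu
        · exact Or.inl ⟨hw.1, rfl⟩
        · exact Or.inr ⟨⟨hw.1, rfl⟩, hout w hw.1 hst fun h => hw.2 ⟨⟨hw.1, hst⟩, h⟩⟩
      have hcard' : ((s.troubledPart f ∩ verts X).card : ℝ) < α * k := by
        refine lt_of_le_of_lt ?_ hcard
        refine Nat.cast_le.2 (Finset.card_le_card fun w hw => ?_)
        rw [Finset.mem_inter] at hw
        rw [Finset.mem_sdiff]
        refine ⟨hw.1, fun hwC => ?_⟩
        obtain ⟨c, hc, hwc⟩ := mem_verts.1 hwC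
        obtain ⟨x, hx, hwx⟩ := mem_verts.1 hw.2
        exact Finset.disjoint_left.1 hdX (hW.region.mem_of_meets hx (h₁.bad c hc).1 (h₁.edge c hc)
          (meets_of_mem hwc hwx)) hc
      obtain ⟨M₁, ℓ₁, hW₁, hs₁, hl₁⟩ := hW.extend hI hp h₁.toRegion h₁.nonempty hdX hf
        (h₁.genFrom hg₁ hgf₁) (hC₂X hg₂) hgf₂
        (Or.inr ⟨hfb, hcol, hdet, fun g hg hgb => by
          have := hbad g hg hgb
          rw [Finset.mem_union] at this ⊢
          exact this.symm.imp_left fun h => hC₂X h, Or.inl ⟨hmono', hcard'⟩⟩)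
      obtain ⟨M', ℓ', hW', hs', hl'⟩ := ih M₁ _ ℓ₁ hW₁
        ⟨g₁, Finset.mem_union_right _ hg₁, hsub hg₁⟩
      have he : X ∪ C₁ ∪ A = X ∪ (A ∪ C₂) := by
        ext e
        simp only [Finset.mem_union]
        have h1 : e ∈ C₁ → e ∈ A := fun h => hsub h
        have h2 : e ∈ C₂ → e ∈ X := fun h => hC₂X h
        tauto
      rw [he] at hW'
      refine ⟨M', ℓ', hW', hs₁.trans hs', fun n hn hk => ?_⟩
      rcases hl' n hn hk with h | h
      · refine (hl₁ n h hk).imp_right fun h => ?_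
        exact hnear (h.imp_right Or.inr)
      · exact Or.inr (h.mono Finset.subset_union_left)

/-- A single node covers the component that it meets, together with further events. -/
theorem PreWitness.exists_witness (hI : Inv H k α s) {X : Finset (Finset V)} {S : Set (Finset V)}
    {M : Multiset (Node V)} (hW : PreWitness H k α s M X fun _ => 0) (hgen : GenFrom H X S)
    {n₀ : Node V} (hn₀ : n₀ ∈ M) (hl : n₀.lev = 0)
    (hM : ∀ n ∈ M, n.kind.IsElem → n.kind.IsCover ∧ n.lev = 0)
    (hS : ∀ c ∈ X, c ∈ S → Met M c ∨ c ∈ nbrs H n₀.edge) :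
    ∃ M' ℓ', Witness H k α s M' X ℓ' ∧ surplus M ≤ surplus M' ∧
      ∀ n ∈ M', n.kind.IsElem → n ∈ M ∨ n.edge ∈ X := by
  obtain ⟨M', -, h1, h2, h3, h4⟩ := PreWitness.absorb hI (n₀ := n₀) (N := X) (l := 0)
    subset_rfl (fun _ _ => rfl) hl hgen _ M hW hn₀ (fun n hn hk _ _ _ => hM n hn hk) hS le_rfl
  exact ⟨M', _, ⟨h1, h2⟩, h3, h4⟩

/-- Each linked set of components has a witness with surplus at least two: the tree that consists
of one bad edge has surplus two. -/
theorem Linked.exists_witness (hI : Inv H k α s) (hp : Params H k α) {A : Finset (Finset V)}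
    (hA : Linked H k α s A) : ∃ M ℓ, Witness H k α s M A ℓ ∧ 2 ≤ surplus M := by
  obtain ⟨a, ha⟩ := hA.exists_comp.1
  obtain ⟨C, hC, hCA, haC⟩ := hA.exists_comp.2 a ha
  have hP := PreWitness.single (k := k) (α := α) hC.toRegion (n := ⟨a, .bad, 0⟩)
    (hC.edge a haC) rfl
    (hC.colored a haC) (hC.det a haC)
    (fun g hg hm => hC.mem_of_meets haC hg (hI.bad_sub g hg) hm) (hC.bad a haC).1
  obtain ⟨w, hw, -⟩ := hI.not_accepted a (hC.bad a haC)
  obtain ⟨M, ℓ, hW, hs, -⟩ := hP.exists_witness hI (hC.conn a haC)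
    (Multiset.mem_singleton_self _) rfl
    (fun n hn _ => by rw [Multiset.mem_singleton.1 hn]; exact ⟨Or.inl rfl, rfl⟩)
    (fun c _ hc => Or.inl ⟨_, Multiset.mem_singleton_self _, by simp [Kind.IsElem], by
      rw [Set.mem_singleton_iff.1 hc]
      exact meets_of_mem hw hw⟩)
  obtain ⟨M', ℓ', hW', hs', -⟩ := hA.grow hI hp M C ℓ hW ⟨a, haC, ha⟩
  rw [Finset.union_eq_right.2 hCA] at hW'
  refine ⟨M', ℓ', hW', le_trans (le_trans ?_ hs) hs'⟩
  simp [surplus, Kind.credit]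

/-- The search areas whose amortizing configuration can be used as the root of a witness tree with
a larger surplus: they arise from a linked set `A`, and contain a monochromatic edge, or are
completed by the edges `N` next to an edge `f` that is monochromatic or meets two disjoint edges
of `N`. -/
inductive FinalArea (H : Hypergraph V) (k : ℕ) (α : ℝ) (s : Memory V) (A : Finset (Finset V)) :
    Finset (Finset V) → Prop
  | mono {g : Finset V} (h : Linked H k α s A) (hg : g ∈ A) (hm : s.Mono g) : FinalArea H k α s A A
  | expand {C N : Finset (Finset V)} {f x : Finset V} (h : Linked H k α s A) (hC : Comp H s C)
      (hCA : C ⊆ A) (hN : Region H s N) (hd : Disjoint A N) (hf : f ∈ edges H) (hfb : f ∉ s.bad)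
      (hcol : s.uncoloredPart f = ∅) (hdet : ∀ g ∈ nbrs H f, s.Det g)
      (hbad : ∀ g ∈ nbrs H f, g ∈ s.bad → g ∈ C ∪ N) (hgen : GenFrom H N {g | g ∈ nbrs H f})
      (hx : x ∈ C) (hxf : x ∈ nbrs H f)
      (hev : s.Mono f ∨ ∃ b₁ ∈ N, ∃ b₂ ∈ N, b₁ ∈ nbrs H f ∧ b₂ ∈ nbrs H f ∧ Disjoint b₁ b₂) :
      FinalArea H k α s A (A ∪ N)

theorem FinalArea.linked {A A' : Finset (Finset V)} (h : FinalArea H k α s A A') :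
    Linked H k α s A := by
  cases h <;> assumption

theorem FinalArea.region {A A' : Finset (Finset V)} (h : FinalArea H k α s A A') :
    Region H s A' := by
  cases h with
  | mono h => exact h.region
  | expand h _ _ hN => exact h.region.union hN

theorem FinalArea.subset {A A' : Finset (Finset V)} (h : FinalArea H k α s A A') : A ⊆ A' := by
  cases h with
  | mono => exact subset_rfl
  | expand => exact Finset.subset_union_left

/-- The tree that is rooted at the amortizing configuration has surplus three: a monochromatic edge
has credit three, and otherwise two disjoint bad edges next to `f` and one edge of `C` are connected
by a single `blank` node for `f`. -/
theorem FinalArea.exists_witness (hI : Inv H k α s) (hp : Params H k α) {A A' : Finset (Finset V)}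
    (h : FinalArea H k α s A A') : ∃ M ℓ, Witness H k α s M A' ℓ ∧ 3 ≤ surplus M ∧
      ∀ n ∈ M, n.kind.IsElem → n.edge ∈ A' ∨ ∃ a ∈ A, n.edge ∈ nbrs H a := by
  cases h with
  | @mono g h hg hm =>
    obtain ⟨C, hC, hCA, hgC⟩ := h.exists_comp.2 g hg
    have hP := PreWitness.single (k := k) (α := α) hC.toRegion (n := ⟨g, .full, 0⟩)
      (hC.edge g hgC) rfl
      (hC.colored g hgC) (hC.det g hgC)
      (fun e he hm => hC.mem_of_meets hgC he (hI.bad_sub e he) hm) (by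
        simp only [NodeSat, exempt, Finset.sdiff_empty]
        exact ⟨hm, (hp.unif g (hC.edge g hgC)).ge⟩)
    obtain ⟨w, hw, -⟩ := hI.not_accepted g (hC.bad g hgC)
    obtain ⟨M, ℓ, hW, hs, hl⟩ := hP.exists_witness hI (hC.conn g hgC)
      (Multiset.mem_singleton_self _) rfl
      (fun n hn _ => by
        rw [Multiset.mem_singleton.1 hn]; exact ⟨Or.inr (Or.inr (Or.inr rfl)), rfl⟩)
      (fun c _ hc => Or.inl ⟨_, Multiset.mem_singleton_self _, by simp [Kind.IsElem], by
        rw [Set.mem_singleton_iff.1 hc]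
        exact meets_of_mem hw hw⟩)
    obtain ⟨M', ℓ', hW', hs', hl'⟩ := h.grow hI hp M C ℓ hW ⟨g, hgC, hg⟩
    rw [Finset.union_eq_right.2 hCA] at hW'
    refine ⟨M', ℓ', hW', le_trans (le_trans ?_ hs) hs', fun n hn hk => ?_⟩
    · simp [surplus, Kind.credit]
    · rcases hl' n hn hk with h1 | h1
      · rcases hl n h1 hk with h2 | h2
        · rw [Multiset.mem_singleton.1 h2]; exact Or.inl hg
        · exact Or.inl (hCA h2)
      · exact h1
  | @expand C N f x h hC hCA hN hd hf hfb hcol hdet hbad hgen hx hxf hev =>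
    have hR := hC.toRegion.union hN
    have hgen' : GenFrom H (C ∪ N) {g | g ∈ nbrs H f} := by
      intro Z h1 h2 g hg
      rcases Finset.mem_union.1 hg with hg | hg
      · exact hC.genFrom (S := {g | g ∈ nbrs H f}) hx hxf Z
          (fun g hg => h1 g (Finset.mem_union_left _ hg))
          (fun a ha haZ c hc => h2 a (Finset.mem_union_left _ ha) haZ c
            (Finset.mem_union_left _ hc)) g hg
      · exact hgen Z (fun g hg => h1 g (Finset.mem_union_right _ hg))
          (fun a ha haZ c hc => h2 a (Finset.mem_union_right _ ha) haZ c
            (Finset.mem_union_right _ hc)) g hg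
    have hroot : ∃ M ℓ, Witness H k α s M (C ∪ N) ℓ ∧ 3 ≤ surplus M ∧
        ∀ n ∈ M, n.kind.IsElem → n.edge ∈ C ∪ N ∨ n.edge = f := by
      rcases hev with hm | ⟨b₁, h₁, b₂, h₂, hf₁, hf₂, hdis⟩
      · have hP := PreWitness.single (k := k) (α := α) hR (n := ⟨f, .full, 0⟩) hf rfl hcol hdet
          (fun e he hm => hbad e (mem_nbrs_of_meets (hI.bad_sub e he)
            (by rintro rfl; exact hfb he) hm) he) (by
            simp only [NodeSat, exempt, Finset.sdiff_empty]
            exact ⟨hm, (hp.unif f hf).ge⟩)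
        obtain ⟨M, ℓ, hW, hs, hl⟩ := hP.exists_witness hI hgen'
          (Multiset.mem_singleton_self _) rfl
          (fun n hn _ => by
            rw [Multiset.mem_singleton.1 hn]; exact ⟨Or.inr (Or.inr (Or.inr rfl)), rfl⟩)
          (fun c _ hc => Or.inr hc)
        refine ⟨M, ℓ, hW, le_trans ?_ hs, fun n hn hk => ?_⟩
        · simp [surplus, Kind.credit]
        · rcases hl n hn hk with h2 | h2
          · rw [Multiset.mem_singleton.1 h2]; exact Or.inr rfl
          · exact Or.inl h2
      · have hxN : ∀ b ∈ N, ¬ (b ∩ x).Nonempty := fun b hb hm =>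
          Finset.disjoint_left.1 (hd.mono_left hCA)
            (hC.mem_of_meets hx (hN.bad b hb).1 (hN.edge b hb) hm) hb
        have hxU : x ∈ C ∪ N := Finset.mem_union_left _ hx
        have hP := PreWitness.single (k := k) (α := α) hR (n := ⟨x, .bad, 0⟩) (hR.edge x hxU) rfl
          (hR.colored x hxU) (hR.det x hxU)
          (fun e he hm => hR.mem_of_meets hxU he (hI.bad_sub e he) hm) (hR.bad x hxU).1
        have hP₁ := hP.cons_blank (Multiset.mem_singleton_self _) (nbrs_symm hf hxf)
        have hP₂ := hP₁.cons_bad hI (Multiset.mem_cons_self _ _) (Finset.mem_union_right _ h₁) hf₁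
          rfl (by
            rintro ⟨n', hn', hk', hm'⟩
            rcases Multiset.mem_cons.1 hn' with rfl | hn'
            · exact hk' rfl
            · rw [Multiset.mem_singleton.1 hn'] at hm'
              exact hxN b₁ h₁ hm')
        have hP₃ := hP₂.cons_bad hI (Multiset.mem_cons_of_mem (Multiset.mem_cons_self _ _))
          (Finset.mem_union_right _ h₂) hf₂ rfl (by
            rintro ⟨n', hn', hk', hm'⟩
            rcases Multiset.mem_cons.1 hn' with rfl | hn'
            · exact not_meets_of_disjoint hdis.symm hm'
            rcases Multiset.mem_cons.1 hn' with rfl | hn'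
            · exact hk' rfl
            · rw [Multiset.mem_singleton.1 hn'] at hm'
              exact hxN b₂ h₂ hm')
        obtain ⟨M, ℓ, hW, hs, hl⟩ := hP₃.exists_witness hI hgen' (n₀ := ⟨f, .blank, 0⟩)
          (Multiset.mem_cons_of_mem (Multiset.mem_cons_of_mem (Multiset.mem_cons_self _ _))) rfl
          (fun n' hn' hk' => by
            rcases Multiset.mem_cons.1 hn' with rfl | hn'
            · exact ⟨Or.inl rfl, rfl⟩
            rcases Multiset.mem_cons.1 hn' with rfl | hn'
            · exact ⟨Or.inl rfl, rfl⟩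
            rcases Multiset.mem_cons.1 hn' with rfl | hn'
            · exact absurd rfl hk'
            rw [Multiset.mem_singleton.1 hn']
            exact ⟨Or.inl rfl, rfl⟩)
          (fun c _ hc => Or.inr hc)
        refine ⟨M, ℓ, hW, le_trans ?_ hs, fun n hn hk => ?_⟩
        · simp [surplus, Kind.credit]
        · rcases hl n hn hk with h2 | h2
          · refine Or.inl ?_
            rcases Multiset.mem_cons.1 h2 with rfl | hn'
            · exact Finset.mem_union_right _ h₂
            rcases Multiset.mem_cons.1 hn' with rfl | hn'
            · exact Finset.mem_union_right _ h₁
            rcases Multiset.mem_cons.1 hn' with rfl | hn'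
            · exact absurd rfl hk
            rw [Multiset.mem_singleton.1 hn']
            exact hxU
          · exact Or.inl h2
    obtain ⟨M, ℓ, hW, hs, hl⟩ := hroot
    obtain ⟨M', ℓ', hW', hs', hl'⟩ := h.grow hI hp M _ ℓ hW
      ⟨x, Finset.mem_union_left _ hx, hCA hx⟩
    have he : C ∪ N ∪ A = A ∪ N := by
      rw [Finset.union_right_comm, Finset.union_eq_right.2 hCA]
    rw [he] at hW'
    refine ⟨M', ℓ', hW', hs.trans hs', fun n hn hk => ?_⟩
    rcases hl' n hn hk with h1 | h1
    · rcases hl n h1 hk with h2 | h2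
      · exact Or.inl (Finset.union_subset_union_left hCA h2)
      · exact Or.inr ⟨x, hCA hx, h2 ▸ nbrs_symm hf hxf⟩
    · exact h1.imp_left fun h => Finset.mem_union_left _ h

/-- The completion of `A` can also be added when `A` has been covered. This is needed if the search
area is attached to the component elsewhere, without its own tree. -/
theorem FinalArea.complete (hI : Inv H k α s) (hp : Params H k α) {A A' : Finset (Finset V)}
    (h : FinalArea H k α s A A') {M : Multiset (Node V)} {X : Finset (Finset V)}
    {ℓ : Finset V → ℤ} (hW : Witness H k α s M X ℓ) (hAX : A ⊆ X) (hd : ∀ g ∈ X, g ∈ A' → g ∈ A) :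
    ∃ M' ℓ', Witness H k α s M' (X ∪ A') ℓ' ∧ surplus M ≤ surplus M' := by
  cases h with
  | mono => rw [Finset.union_eq_left.2 hAX]; exact ⟨M, ℓ, hW, le_rfl⟩
  | @expand C N f x h hC hCA hN hdN hf hfb hcol hdet hbad hgen hx hxf hev =>
    have he : X ∪ (A ∪ N) = X ∪ N := by
      rw [← Finset.union_assoc, Finset.union_eq_left.2 hAX]
    rw [he]
    rcases N.eq_empty_or_nonempty with rfl | hne
    · rw [Finset.union_empty]; exact ⟨M, ℓ, hW, le_rfl⟩
    have hdX : Disjoint X N := Finset.disjoint_left.2 fun g hgX hgN =>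
      Finset.disjoint_left.1 hdN (hd g hgX (Finset.mem_union_right _ hgN)) hgN
    obtain ⟨M', ℓ', h1, h2, -⟩ := hW.extend hI hp hN hne hdX hf hgen (hAX (hCA hx)) hxf (by
      rcases hev with hm | hb
      · exact Or.inr ⟨hfb, hcol, hdet, fun g hg hgb =>
          Finset.union_subset_union_left (hCA.trans hAX) (hbad g hg hgb), Or.inr (Or.inr hm)⟩
      · exact Or.inl hb)
    exact ⟨M', ℓ', h1, h2⟩

/-- The main component `B` can be enlarged by a successful search area `A'`, found from the
unsafe edge `f₀`. In general, the two witness trees are joined by the edge `f₀`, whose accepted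
vertices provide one more event; the larger surplus of the second tree pays for the connection. -/
theorem Witness.join_finalArea (hI : Inv H k α s) (hp : Params H k α)
    {M : Multiset (Node V)} {B A A' : Finset (Finset V)} {ℓ : Finset V → ℤ}
    (hW : Witness H k α s M B ℓ) (hs : 2 ≤ surplus M) (hA : FinalArea H k α s A A')
    (hd : Disjoint B A') {f₀ b x₀ : Finset V} (hf : f₀ ∈ edges H) (hfb : f₀ ∉ s.bad)
    (hcol : s.uncoloredPart f₀ = ∅) (hdet : ∀ g ∈ nbrs H f₀, s.Det g)
    (hbad : ∀ g ∈ nbrs H f₀, g ∈ s.bad → g ∈ B ∪ A') (hsafe : ¬ s.Safe f₀)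
    (hin : FewInside k α s B f₀) (hout : FewOutside k α s B f₀) (hb : b ∈ B)
    (hbf : b ∈ nbrs H f₀) (hx : x₀ ∈ A) (hxf : x₀ ∈ nbrs H f₀) :
    ∃ M' ℓ', Witness H k α s M' (B ∪ A') ℓ' ∧ 2 ≤ surplus M' := by
  have hdA : Disjoint B A := hd.mono_right hA.subset
  by_cases hcase : ∃ f ∈ edges H, (∃ a ∈ A, f ∈ nbrs H a) ∧ Met M f
  · -- Some edge next to `A` meets an event of the main component. Then the two trees might not be
    -- disjoint, but the search area can be covered from there, without any further event.
    obtain ⟨f, hfe, ⟨a, ha, hfa⟩, hmet⟩ := hcase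
    obtain ⟨C, hC, hCA, haC⟩ := hA.linked.exists_comp.2 a ha
    have haf := nbrs_symm (hC.edge a haC) hfa
    obtain ⟨M₁, ℓ₁, hW₁, hs₁, -⟩ := hW.extend_of_met hI hC.toRegion hC.nonempty
      (hdA.mono_right hCA) hfe (hC.genFrom haC haf) hmet
    obtain ⟨M₂, ℓ₂, hW₂, hs₂, -⟩ := hA.linked.grow hI hp _ _ _ hW₁
      ⟨a, Finset.mem_union_right _ haC, ha⟩
    rw [Finset.union_assoc, Finset.union_eq_right.2 hCA] at hW₂
    obtain ⟨M₃, ℓ₃, hW₃, hs₃⟩ := hA.complete hI hp hW₂ Finset.subset_union_right (by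
      intro g hg hgA
      rcases Finset.mem_union.1 hg with h | h
      · exact absurd hgA (Finset.disjoint_left.1 hd h)
      · exact h)
    rw [Finset.union_assoc, Finset.union_eq_right.2 hA.subset] at hW₃
    exact ⟨M₃, ℓ₃, hW₃, by omega⟩
  push Not at hcase
  obtain ⟨MA, ℓA, hWA, hsA, hlA⟩ := hA.exists_witness hI hp
  obtain ⟨nB, hnB, hkB, hmB, hlB⟩ := hW.cov b hb
  have hR := hW.region.union hA.region
  have hxe : x₀ ∈ edges H := hA.linked.region.edge x₀ hx
  have hfx := nbrs_symm hf hxf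
  have hfM : ¬ Met M f₀ := hcase f₀ hf ⟨x₀, hx, hfx⟩
  have hbn : b ≠ nB.edge := by
    rintro rfl
    exact hfM ⟨nB, hnB, hkB.isElem, meets_comm.1 (meets_of_mem_nbrs hbf)⟩
  -- The events of the two trees are disjoint.
  have hcross : ∀ n ∈ M, n.kind.IsElem → ∀ m ∈ MA, m.kind.IsElem →
      ¬ (m.edge ∩ n.edge).Nonempty := by
    intro n hn hk m hm hmk hne
    rcases hlA m hm hmk with h | ⟨a, ha, h⟩
    · exact Finset.disjoint_left.1 hd (hW.hit n hn hk _ (hA.region.bad _ h).1 hne) h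
    · exact hcase _ (hWA.tree.edge_mem hm) ⟨a, ha, h⟩ ⟨n, hn, hk, hne⟩
  -- The levels of the second tree are shifted by a constant `c`.
  have hshift : ∀ c : ℤ, PreWitness H k α s M (B ∪ A')
        (levelUnion A' ℓ fun g => ℓA g + c) ∧
      PreWitness H k α s (MA.map (Node.shift c)) (B ∪ A')
        (levelUnion A' ℓ fun g => ℓA g + c) ∧
      ∀ M', M ≤ M' → MA.map (Node.shift c) ≤ M' →
        PreWitness H k α s M' (B ∪ A') (levelUnion A' ℓ fun g => ℓA g + c) →
        Witness H k α s M' (B ∪ A') (levelUnion A' ℓ fun g => ℓA g + c) := by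
    intro c
    have hWc := hWA.shift c
    have hconst := levelUnion_const hd hW.region hA.region hW.const hWc.const
    refine ⟨hW.toPreWitness.of_subset Finset.subset_union_left hR
      (fun g hg => levelUnion_of_mem hd hg) hconst,
      hWc.toPreWitness.of_subset Finset.subset_union_right hR (fun g hg => if_pos hg) hconst,
      fun M' hM hMA hP => ⟨hP, fun g hg => ?_⟩⟩
    rcases Finset.mem_union.1 hg with hg | hg
    · obtain ⟨m, hm, h1, h2, h3⟩ := hW.cov g hg
      exact ⟨m, Multiset.mem_of_le hM hm, h1, h2, h3.trans (levelUnion_of_mem hd hg).symm⟩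
    · obtain ⟨m, hm, h1, h2, h3⟩ := hWc.cov g hg
      exact ⟨m, Multiset.mem_of_le hMA hm, h1, h2, h3.trans (if_pos hg).symm⟩
  by_cases hfA : Met MA f₀
  · -- The edge `f₀` meets an event of the second tree, and two `blank` nodes connect the trees.
    obtain ⟨nA, hnA, hkA, hmA⟩ := hfA
    have hfn : f₀ ≠ nA.edge := by
      rintro rfl
      have := hWA.hit nA hnA hkA b (hW.region.bad b hb).1 (meets_of_mem_nbrs hbf)
      exact Finset.disjoint_left.1 hd hb this
    obtain ⟨hP, hPA, hjoin⟩ := hshift (nB.lev - nA.lev)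
    have hP₁ := (hP.cons_blank hnB (mem_nbrs_of_meets (hW.region.edge b hb) hbn hmB)).cons_blank
      (Multiset.mem_cons_self _ _) (nbrs_symm hf hbf)
    have hJ := hP₁.join hPA (Multiset.mem_cons_self _ _) (Multiset.mem_map_of_mem _ hnA)
      (show nA.edge ∈ nbrs H f₀ from
        mem_nbrs_of_meets (hWA.tree.edge_mem hnA) (Ne.symm hfn) (meets_comm.1 hmA))
      (by simp only [Node.shift]; ring)
      (by
        intro n hn hk m hm hmk
        obtain ⟨m', hm', rfl⟩ := Multiset.mem_map.1 hm
        rcases Multiset.mem_cons.1 hn with rfl | hn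
        · exact absurd rfl hk
        rcases Multiset.mem_cons.1 hn with rfl | hn
        · exact absurd rfl hk
        exact hcross n hn hk m' hm' hmk)
    refine ⟨_, _, hjoin _ ?_ (Multiset.le_add_left _ _) hJ, ?_⟩
    · exact ((Multiset.le_cons_self _ _).trans (Multiset.le_cons_self _ _)).trans
        (Multiset.le_add_right _ _)
    · rw [surplus_add, surplus_cons, surplus_cons, surplus_shift]
      simp only [Kind.credit]
      omega
  · -- Otherwise `f₀` becomes an `acc` node, which pays for itself, between two `blank` nodes for `b`
    -- and `x₀`. It has at least `k - 2 α k` accepted vertices, all of the same color.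
    obtain ⟨nA, hnA, hkA, hmA, -⟩ := hWA.cov x₀ (hA.subset hx)
    have hxn : x₀ ≠ nA.edge := by
      rintro rfl
      exact hfA ⟨nA, hnA, hkA.isElem, meets_comm.1 (meets_of_mem_nbrs hxf)⟩
    obtain ⟨hP, hPA, hjoin⟩ := hshift (nB.lev - nA.lev)
    have hP₁ := hP.cons_blank hnB (mem_nbrs_of_meets (hW.region.edge b hb) hbn hmB)
    have hP₂ := hP₁.cons_elem (m := ⟨f₀, .acc, nB.lev⟩) (Multiset.mem_cons_self _ _)
      (nbrs_symm hf hbf) 0 (by simp) (by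
        rintro ⟨n', hn', hk', hm'⟩
        rcases Multiset.mem_cons.1 hn' with rfl | hn'
        · exact hk' rfl
        · exact hfM ⟨n', hn', hk', hm'⟩) hcol hdet
      (fun g hg hm => hbad g (mem_nbrs_of_meets (hI.bad_sub g hg)
        (by rintro rfl; exact hfb hg) hm) hg)
      (fun hc => by simp [Kind.IsCover] at hc) (by
        simp only [NodeSat, exempt]
        refine ⟨?_, Nat.ceil_le.2 ?_⟩
        · refine (not_not.1 hsafe).subset fun w hw => ?_
          rw [Finset.mem_sdiff, Memory.mem_troubledPart] at hw
          rw [Memory.mem_acceptedPart]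
          have hu := Memory.uncoloredPart_eq_empty.1 hcol w hw.1
          refine ⟨hw.1, ?_⟩
          cases hst : s.status w
          · exact absurd hst hu
          · rfl
          · exact absurd ⟨hw.1, hst⟩ hw.2
        · have h1 : f₀.card - (s.troubledPart f₀).card ≤ (f₀ \ s.troubledPart f₀).card :=
            Finset.le_card_sdiff _ _
          have h2 := Finset.card_inter_add_card_sdiff (s.troubledPart f₀) (verts B)
          rw [hp.unif f₀ hf] at h1
          have h3 : (k : ℝ) ≤ ((f₀ \ s.troubledPart f₀).card : ℝ) +
              (((s.troubledPart f₀ ∩ verts B).card : ℝ) +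
                ((s.troubledPart f₀ \ verts B).card : ℝ)) := by
            exact_mod_cast (by omega : k ≤ (f₀ \ s.troubledPart f₀).card +
              ((s.troubledPart f₀ ∩ verts B).card + (s.troubledPart f₀ \ verts B).card))
          unfold FewInside at hin
          unfold FewOutside at hout
          linarith)
    have hP₃ := hP₂.cons_blank (Multiset.mem_cons_self _ _) hxf
    have hJ := hP₃.join hPA (Multiset.mem_cons_self _ _) (Multiset.mem_map_of_mem _ hnA)
      (show nA.edge ∈ nbrs H x₀ from
        mem_nbrs_of_meets (hWA.tree.edge_mem hnA) (Ne.symm hxn) (meets_comm.1 hmA))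
      (by simp only [Node.shift]; ring)
      (by
        intro n hn hk m hm hmk
        obtain ⟨m', hm', rfl⟩ := Multiset.mem_map.1 hm
        rcases Multiset.mem_cons.1 hn with rfl | hn
        · exact absurd rfl hk
        rcases Multiset.mem_cons.1 hn with rfl | hn
        · exact fun h => hfA ⟨m', hm', hmk, meets_comm.1 h⟩
        rcases Multiset.mem_cons.1 hn with rfl | hn
        · exact absurd rfl hk
        exact hcross n hn hk m' hm' hmk)
    refine ⟨_, _, hjoin _ ?_ (Multiset.le_add_left _ _) hJ, ?_⟩
    · exact (((Multiset.le_cons_self _ _).trans (Multiset.le_cons_self _ _)).trans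
        (Multiset.le_cons_self _ _)).trans (Multiset.le_add_right _ _)
    · rw [surplus_add, surplus_cons, surplus_cons, surplus_cons, surplus_shift]
      simp only [Kind.credit]
      omega

end SearchAreas

/-! ### The subroutines that explore bad edges -/

section Programs

variable {V : Type u} [Fintype V] {H : Hypergraph V} {k : ℕ} {α : ℝ} {σ : Schedule V}

theorem Inv.log {s : Memory V} (h : Inv H k α s) (g : Finset V) : Inv H k α (s.log g) :=
  ⟨h.1, h.2, h.3, h.4, h.5⟩

theorem Inv.explore {s : Memory V} (h : Inv H k α s) (g : Finset V) : Inv H k α (s.explore g) :=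
  ⟨h.1, h.2, h.3, h.4, h.5⟩

theorem Ext.log (s : Memory V) (g : Finset V) : Ext H s (s.log g) :=
  ⟨fun _ _ => ⟨rfl, rfl⟩, subset_rfl, subset_rfl, fun _ _ _ h => h, fun _ h => h,
    fun _ h _ => h, rfl⟩

theorem Ext.explore (s : Memory V) (g : Finset V) : Ext H s (s.explore g) :=
  ⟨fun _ _ => ⟨rfl, rfl⟩, subset_rfl, Finset.subset_insert _ _, fun _ _ _ h => h, fun _ h => h,
    fun _ h _ => h, rfl⟩

/-- Determining an edge preserves the invariant, and does not increase the expected potential. -/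
theorem spec_determine (hp : Params H k α) (g : Finset V) {s : Memory V} (hI : Inv H k α s) :
    Spec (potential H k α) (determine H k α σ g s) (potential H k α s) fun s' =>
      Inv H k α s' ∧ Ext H s s' ∧ s'.explored = s.explored ∧ s'.Det g := by
  refine (spec_whileLoop_of_measure (I := fun y => Inv H k α y ∧ Ext H s y ∧
    y.explored = s.explored) (fun y => (y.uncoloredPart g).card) ?_ ⟨hI, Ext.refl s, rfl⟩).post ?_
  · rintro y ⟨hIy, hE, he⟩ ⟨hne, -⟩
    have hw := σ.vertex_mem y _ hne
    refine (spec_processVertex hp hIy (Memory.mem_uncoloredPart.1 hw).2).post ?_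
    rintro z ⟨hIz, hEz, hez, hu⟩
    refine ⟨⟨hIz, hE.trans hEz, hez.trans he⟩, ?_⟩
    rw [hu]
    exact Finset.card_erase_lt_of_mem hw
  · rintro y ⟨⟨hIy, hE, he⟩, hc⟩
    refine ⟨hIy, hE, he, ?_⟩
    by_cases hne : (y.uncoloredPart g).Nonempty
    · exact Or.inr (by by_contra h; exact hc ⟨hne, h⟩)
    · exact Or.inl (Finset.not_nonempty_iff_eq_empty.1 hne)

theorem spec_determineNbrs (hp : Params H k α) (f : Finset V) {a : Area V}
    (hI : Inv H k α a.mem) :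
    Spec (fun b : Area V => potential H k α b.mem) (determineNbrs H k α σ f a)
      (potential H k α a.mem) fun b =>
        (Inv H k α b.mem ∧ Ext H a.mem b.mem ∧ b.mem.explored = a.mem.explored ∧ b.B = a.B ∧
          b.U = a.U) ∧ ∀ g ∈ nbrs H f, b.mem.Det g := by
  refine (spec_forEach (fun R b => (Inv H k α b.mem ∧ Ext H a.mem b.mem ∧
    b.mem.explored = a.mem.explored ∧ b.B = a.B ∧ b.U = a.U) ∧
      ∀ g ∈ nbrs H f, b.mem.Det g ∨ g ∈ R) ?_ ⟨⟨hI, Ext.refl _, rfl, rfl, rfl⟩,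
      fun g hg => Or.inr hg⟩).post ?_
  · rintro R b g hg ⟨⟨hIb, hE, he, hB, hU⟩, hdet⟩
    refine (spec_determine hp g (s := b.mem.log g) (hIb.log g)).map ?_
    rintro s ⟨hIs, hEs, hes, hgs⟩
    have hE' := (Ext.log b.mem g).trans hEs
    refine ⟨⟨⟨hIs, hE.trans hE', hes.trans he, hB, hU⟩, fun h hh => ?_⟩, le_rfl⟩
    by_cases hhg : h = g
    · exact Or.inl (hhg ▸ hgs)
    · exact (hdet h hh).imp hE'.det fun hR => Finset.mem_erase.2 ⟨hhg, hR⟩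
  · rintro b ⟨h1, h2⟩
    exact ⟨h1, fun g hg => (h2 g hg).resolve_right (Finset.notMem_empty g)⟩

/-- The number of edges that have not been explored in the current query. -/
def numUnexplored (H : Hypergraph V) (s : Memory V) : ℕ := (edges H \ s.explored).card

theorem numUnexplored_insert {s s' : Memory V} {g : Finset V} (hg : g ∈ edges H)
    (hn : g ∉ s.explored) (he : s'.explored = insert g s.explored) :
    numUnexplored H s' + 1 = numUnexplored H s := by
  unfold numUnexplored
  rw [he, Finset.sdiff_insert]
  exact Finset.card_erase_add_one (Finset.mem_sdiff.2 ⟨hg, hn⟩)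

theorem GenFrom.insert {N : Finset (Finset V)} {S : Set (Finset V)} (h : GenFrom H N S)
    {g : Finset V} (hg : g ∈ S ∨ ∃ b ∈ N, g ∈ nbrs H b) : GenFrom H (insert g N) S := by
  intro Z h1 h2
  have h3 : ∀ e ∈ N, e ∈ Z := h Z (fun e he => h1 e (Finset.mem_insert_of_mem he))
    fun a ha haZ c hc => h2 a (Finset.mem_insert_of_mem ha) haZ c (Finset.mem_insert_of_mem hc)
  intro e he
  rcases Finset.mem_insert.1 he with rfl | he
  · rcases hg with hg | ⟨b, hb, hadj⟩
    · exact h1 e (Finset.mem_insert_self _ _) hg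
    · exact h2 b (Finset.mem_insert_of_mem hb) (h3 b hb) e (Finset.mem_insert_self _ _) hadj
  · exact h3 e he

/-- The state `s` arises from `s₀` by an exploration that has found the bad edges `N` and the
unsafe edges `Un`, starting from bad edges in `S`. It need not be complete: the neighbours of the
edges of `N` may still be unexplored. -/
structure Grown (H : Hypergraph V) (k : ℕ) (α : ℝ) (s₀ s : Memory V) (N Un : Finset (Finset V))
    (S : Set (Finset V)) : Prop where
  ext : Ext H s₀ s
  inv : Inv H k α s
  fresh : ∀ g, g ∈ N ∨ g ∈ Un → g ∈ edges H ∧ g ∈ s.explored ∧ g ∉ s₀.explored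
  bad : ∀ g ∈ N, s.Bad g ∧ s.uncoloredPart g = ∅
  unsafe' : ∀ g ∈ Un, s.Unsafe g ∧ ∃ b ∈ N, g ∈ nbrs H b
  expl : ∀ g ∈ s.explored,
    g ∈ s₀.explored ∨ (g ∈ edges H ∧ s.Det g ∧ (g ∈ N ∨ g ∈ Un ∨ s.Safe g))
  gen : GenFrom H N S

theorem Unsafe.ext {s s' : Memory V} (hE : Ext H s s') {g : Finset V} (hg : g ∈ edges H)
    (h : s.Unsafe g) : s'.Unsafe g :=
  ⟨hE.colored h.1, fun hb => h.2.1 (hE.bad_det g hg (Or.inl h.1) hb),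
    fun hs => h.2.2 (hE.safe_of_colored h.1 hs)⟩

theorem Grown.refl {s : Memory V} (hI : Inv H k α s) (S : Set (Finset V)) :
    Grown H k α s s ∅ ∅ S where
  ext := Ext.refl s
  inv := hI
  fresh g hg := by simp at hg
  bad g hg := absurd hg (Finset.notMem_empty g)
  unsafe' g hg := absurd hg (Finset.notMem_empty g)
  expl g hg := Or.inl hg
  gen _ _ _ g hg := absurd hg (Finset.notMem_empty g)

namespace Grown

variable {s₀ s s' : Memory V} {N Un : Finset (Finset V)} {S : Set (Finset V)}

/-- The exploration of one more edge `g`, which is added to `N` if it is bad, and to `Un` if it is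
unsafe. -/
theorem step (h : Grown H k α s₀ s N Un S) (hE : Ext H s s') (hI : Inv H k α s')
    {N' Un' : Finset (Finset V)} {g : Finset V} (hN : ∀ e, e ∈ N' ↔ e ∈ N ∨ (e = g ∧ s'.Bad g))
    (hU : ∀ e, e ∈ Un' ↔ e ∈ Un ∨ (e = g ∧ s'.Unsafe g ∧ ∃ b ∈ N, g ∈ nbrs H b))
    (hg : g ∈ edges H) (hn : g ∉ s.explored) (he : s'.explored = insert g s.explored)
    (hd : s'.Det g) (hgS : g ∈ S ∨ ∃ b ∈ N, g ∈ nbrs H b)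
    (hadj : s'.Unsafe g → ∃ b ∈ N, g ∈ nbrs H b) :
    Grown H k α s₀ s' N' Un' S where
  ext := h.ext.trans hE
  inv := hI
  fresh e hh := by
    have hold : ∀ e, e ∈ N ∨ e ∈ Un → e ∈ edges H ∧ e ∈ s'.explored ∧ e ∉ s₀.explored :=
      fun e hh => let ⟨h1, h2, h3⟩ := h.fresh e hh; ⟨h1, hE.explored h2, h3⟩
    have hnew : g ∈ edges H ∧ g ∈ s'.explored ∧ g ∉ s₀.explored :=
      ⟨hg, by rw [he]; exact Finset.mem_insert_self _ _, fun h' => hn (h.ext.explored h')⟩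
    rw [hN, hU] at hh
    rcases hh with (hh | ⟨rfl, -⟩) | (hh | ⟨rfl, -⟩)
    · exact hold e (Or.inl hh)
    · exact hnew
    · exact hold e (Or.inr hh)
    · exact hnew
  bad e hh := by
    rcases (hN e).1 hh with hh | ⟨rfl, hb⟩
    · exact ⟨hE.bad_stays e (h.bad e hh).1, hE.colored (h.bad e hh).2⟩
    · exact ⟨hb, hb.det_iff.1 hd⟩
  unsafe' e hh := by
    rcases (hU e).1 hh with hh | ⟨rfl, hb, b, hbN, hb'⟩
    · obtain ⟨h1, b, hb, h2⟩ := h.unsafe' e hh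
      exact ⟨Unsafe.ext hE (h.fresh e (Or.inr hh)).1 h1, b, (hN b).2 (Or.inl hb), h2⟩
    · exact ⟨hb, b, (hN b).2 (Or.inl hbN), hb'⟩
  expl e hh := by
    rw [he, Finset.mem_insert] at hh
    rcases hh with rfl | hh
    · refine Or.inr ⟨hg, hd, ?_⟩
      by_cases hs : s'.Safe e
      · exact Or.inr (Or.inr hs)
      · by_cases hb : e ∈ s'.bad
        · exact Or.inl ((hN e).2 (Or.inr ⟨rfl, hb, hs⟩))
        · have hu : s'.Unsafe e := ⟨hd.resolve_right hs, hb, hs⟩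
          exact Or.inr (Or.inl ((hU e).2 (Or.inr ⟨rfl, hu, hadj hu⟩)))
    · refine (h.expl e hh).imp_right fun ⟨h1, h2, h3⟩ => ⟨h1, hE.det h2, ?_⟩
      exact h3.imp (fun h3 => (hN e).2 (Or.inl h3))
        fun h3 => h3.imp (fun h3 => (hU e).2 (Or.inl h3)) hE.safe
  gen := by
    by_cases hb : s'.Bad g
    · have : N' = insert g N := by
        ext e; rw [hN, Finset.mem_insert]; tauto
      rw [this]
      exact h.gen.insert hgS
    · have : N' = N := by
        ext e; rw [hN]; tauto
      rw [this]
      exact h.gen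

theorem of_ext (h : Grown H k α s₀ s N Un S) (hE : Ext H s s') (hI : Inv H k α s')
    (he : s'.explored = s.explored) : Grown H k α s₀ s' N Un S where
  ext := h.ext.trans hE
  inv := hI
  fresh e hh := let ⟨h1, h2, h3⟩ := h.fresh e hh; ⟨h1, hE.explored h2, h3⟩
  bad e hh := ⟨hE.bad_stays e (h.bad e hh).1, hE.colored (h.bad e hh).2⟩
  unsafe' e hh := by
    obtain ⟨h1, h2⟩ := h.unsafe' e hh
    exact ⟨Unsafe.ext hE (h.fresh e (Or.inr hh)).1 h1, h2⟩
  expl e hh := by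
    rw [he] at hh
    exact (h.expl e hh).imp_right fun ⟨h1, h2, h3⟩ =>
      ⟨h1, hE.det h2, h3.imp_right fun h3 => h3.imp_right hE.safe⟩
  gen := h.gen

theorem log (h : Grown H k α s₀ s N Un S) (g : Finset V) : Grown H k α s₀ (s.log g) N Un S :=
  h.of_ext (Ext.log s g) (h.inv.log g) rfl

theorem numUnexplored_le (h : Grown H k α s₀ s N Un S) :
    numUnexplored H s + (Un.card + N.card) ≤ numUnexplored H s₀ := by
  have hd : Disjoint Un N := Finset.disjoint_left.2 fun g hU hN =>
    (h.unsafe' g hU).1.2.1 (h.bad g hN).1.1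
  rw [← Finset.card_union_of_disjoint hd]
  unfold numUnexplored
  rw [← Finset.card_union_of_disjoint]
  · refine Finset.card_le_card fun g hg => ?_
    rcases Finset.mem_union.1 hg with hg | hg
    · rw [Finset.mem_sdiff] at hg ⊢
      exact ⟨hg.1, fun h' => hg.2 (h.ext.explored h')⟩
    · obtain ⟨h1, -, h3⟩ := h.fresh g (Finset.mem_union.1 hg).symm
      exact Finset.mem_sdiff.2 ⟨h1, h3⟩
  · refine Finset.disjoint_left.2 fun g hg hg' => ?_
    exact (Finset.mem_sdiff.1 hg).2 (h.fresh g (Finset.mem_union.1 hg').symm).2.1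

end Grown

/-- The invariant of `expandBadComp`: the edges of the queue belong to the new bad edges `N`, and
all others of them have been expanded. -/
def ExpandInv (H : Hypergraph V) (k : ℕ) (α : ℝ) (s₀ : Memory V) (B₀ U₀ : Finset (Finset V))
    (S : Set (Finset V)) (a : Area V) : Prop :=
  ∃ N Un, Grown H k α s₀ a.mem N Un S ∧ a.B ∪ a.Q = B₀ ∪ N ∧ a.Q ⊆ N ∧ a.U = U₀ ∪ Un ∧
    ∀ b ∈ N, b ∈ a.Q ∨ ∀ h ∈ nbrs H b, h ∈ a.mem.explored

/-- One round of `expandBadComp`. The measure decreases since an edge that enters the queue has been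
unexplored before. -/
theorem spec_expandBadCompStep (hp : Params H k α) {s₀ : Memory V} {B₀ U₀ : Finset (Finset V)}
    {S : Set (Finset V)} {a : Area V}
    (ha : ExpandInv H k α s₀ B₀ U₀ S a) (hQ : a.Q.Nonempty) :
    Spec (fun b : Area V => potential H k α b.mem) (expandBadCompStep H k α σ a)
      (potential H k α a.mem) fun b => ExpandInv H k α s₀ B₀ U₀ S b ∧ Ext H a.mem b.mem ∧
        2 * numUnexplored H b.mem + b.Q.card < 2 * numUnexplored H a.mem + a.Q.card := by
  unfold expandBadCompStep
  set f := σ.edge a.mem a.Q with hf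
  have hfQ : f ∈ a.Q := σ.edge_mem a.mem a.Q hQ
  refine (spec_forEach (fun R b => ∃ N Un, f ∈ N ∧ Grown H k α s₀ b.mem N Un S ∧
      b.B ∪ b.Q = B₀ ∪ N ∧ b.Q ⊆ N ∧ b.U = U₀ ∪ Un ∧
      (∀ e ∈ N, e ∈ b.Q ∨ (∀ h ∈ nbrs H e, h ∈ b.mem.explored) ∨
        (e = f ∧ ∀ h ∈ nbrs H f, h ∈ b.mem.explored ∨ h ∈ R)) ∧ R ⊆ nbrs H f ∧ Ext H a.mem b.mem ∧
      2 * numUnexplored H b.mem + b.Q.card < 2 * numUnexplored H a.mem + a.Q.card) ?_ ?_).post ?_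
  · rintro R b g hgR ⟨N, Un, hfN, hG, hBQ, hQN, hU, hN, hR, hE₀, hm⟩
    dsimp only
    have hgf : g ∈ nbrs H f := hR hgR
    have hR' : R.erase g ⊆ nbrs H f := (Finset.erase_subset _ _).trans hR
    split_ifs with hex
    · refine Spec.pure ⟨N, Un, hfN, hG.log g, hBQ, hQN, hU, fun e he => ?_, hR',
        hE₀.trans (Ext.log b.mem g), hm⟩ le_rfl
      refine (hN e he).imp_right fun h => h.imp_right fun ⟨h1, h2⟩ => ⟨h1, fun h hh => ?_⟩
      by_cases hhg : h = g
      · exact Or.inl (hhg ▸ hex)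
      · exact (h2 h hh).imp_right fun h => Finset.mem_erase.2 ⟨hhg, h⟩
    · refine (spec_determine hp g (s := (b.mem.log g).explore g)
        ((hG.inv.log g).explore g)).map ?_
      rintro s ⟨hIs, hEs, hes, hgs⟩
      have hE' : Ext H b.mem s := ((Ext.log b.mem g).trans (Ext.explore _ g)).trans hEs
      have hge := mem_edges_of_mem_nbrs hgf
      have hins : s.explored = insert g b.mem.explored := hes
      have hcount := numUnexplored_insert (s := b.mem) hge hex hins
      have hexp : ∀ {Q' : Finset (Finset V)}, b.Q ⊆ Q' → ∀ e ∈ N, e ∈ Q' ∨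
          (∀ h ∈ nbrs H e, h ∈ s.explored) ∨
          (e = f ∧ ∀ h ∈ nbrs H f, h ∈ s.explored ∨ h ∈ R.erase g) := by
        intro Q' hQ' e he
        rcases hN e he with h | h | ⟨rfl, h⟩
        · exact Or.inl (hQ' h)
        · exact Or.inr (Or.inl fun h' hh' => hE'.explored (h h' hh'))
        · refine Or.inr (Or.inr ⟨rfl, fun h' hh' => ?_⟩)
          by_cases hhg : h' = g
          · exact Or.inl (by rw [hins, hhg]; exact Finset.mem_insert_self _ _)
          · exact (h h' hh').imp (fun h => hE'.explored h)
              fun h => Finset.mem_erase.2 ⟨hhg, h⟩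
      split_ifs with hb hu
      · have hG' := hG.step (N' := insert g N) (Un' := Un) hE' hIs
          (fun e => by rw [Finset.mem_insert]; tauto)
          (fun e => ⟨Or.inl, fun h => h.elim id fun h => absurd hb.1 h.2.1.2.1⟩) hge hex hins hgs
          (Or.inr ⟨f, hfN, hgf⟩) (fun _ => ⟨f, hfN, hgf⟩)
        refine ⟨⟨insert g N, Un, Finset.mem_insert_of_mem hfN, hG', ?_, ?_, hU, ?_, hR',
          hE₀.trans hE', ?_⟩,
          le_rfl⟩
        · show b.B ∪ insert g b.Q = B₀ ∪ insert g N
          rw [Finset.union_insert, Finset.union_insert, hBQ]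
        · exact Finset.insert_subset_insert g hQN
        · intro e he
          rcases Finset.mem_insert.1 he with rfl | he
          · exact Or.inl (Finset.mem_insert_self _ _)
          · exact hexp (Finset.subset_insert _ _) e he
        · have := Finset.card_insert_le g b.Q
          show 2 * numUnexplored H s + (insert g b.Q).card < _
          omega
      · have hG' := hG.step (N' := N) (Un' := insert g Un) hE' hIs
          (fun e => ⟨Or.inl, fun h => h.elim id fun h => absurd h.2.1 hu.2.1⟩)
          (fun e => by
            rw [Finset.mem_insert]
            have : ∃ b ∈ N, g ∈ nbrs H b := ⟨f, hfN, hgf⟩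
            tauto) hge hex hins hgs
          (Or.inr ⟨f, hfN, hgf⟩) (fun _ => ⟨f, hfN, hgf⟩)
        refine ⟨⟨N, insert g Un, hfN, hG', hBQ, hQN, ?_, hexp subset_rfl, hR',
          hE₀.trans hE', ?_⟩, le_rfl⟩
        · show insert g b.U = U₀ ∪ insert g Un
          rw [Finset.union_insert, hU]
        · show 2 * numUnexplored H s + b.Q.card < _
          omega
      · have hG' := hG.step (N' := N) (Un' := Un) hE' hIs
          (fun e => ⟨Or.inl, fun h => h.elim id fun h => absurd h.2 hb⟩)
          (fun e => ⟨Or.inl, fun h => h.elim id fun h => absurd h.2.1 hu⟩) hge hex hins hgs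
          (Or.inr ⟨f, hfN, hgf⟩) (fun _ => ⟨f, hfN, hgf⟩)
        refine ⟨⟨N, Un, hfN, hG', hBQ, hQN, hU, hexp subset_rfl, hR',
          hE₀.trans hE', ?_⟩, le_rfl⟩
        show 2 * numUnexplored H s + b.Q.card < _
        omega
  · obtain ⟨N, Un, hG, hBQ, hQN, hU, hN⟩ := ha
    refine ⟨N, Un, hQN hfQ, hG.log f, ?_, (Finset.erase_subset _ _).trans hQN, hU,
      fun e he => ?_, subset_rfl, Ext.log a.mem f, ?_⟩
    · rw [← hBQ]
      show insert f a.B ∪ a.Q.erase f = a.B ∪ a.Q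
      rw [Finset.insert_union, ← Finset.union_insert, Finset.insert_erase hfQ]
    · rcases hN e he with h | h
      · by_cases hef : e = f
        · exact Or.inr (Or.inr ⟨hef, fun h hh => Or.inr hh⟩)
        · exact Or.inl (Finset.mem_erase.2 ⟨hef, h⟩)
      · exact Or.inr (Or.inl h)
    · have := Finset.card_erase_lt_of_mem hfQ
      show 2 * numUnexplored H a.mem + (a.Q.erase f).card < _
      omega
  · rintro b ⟨N, Un, -, hG, hBQ, hQN, hU, hN, -, hE₀, hm⟩
    refine ⟨⟨N, Un, hG, hBQ, hQN, hU, fun e he => ?_⟩, hE₀, hm⟩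
    rcases hN e he with h | h | ⟨rfl, h⟩
    · exact Or.inl h
    · exact Or.inr h
    · exact Or.inr fun h' hh' => (h h' hh').resolve_right (Finset.notMem_empty _)

theorem spec_expandBadComp (hp : Params H k α) {s₀ : Memory V} {B₀ U₀ : Finset (Finset V)}
    {S : Set (Finset V)} {a : Area V} {e : Finset V}
    (ha : ExpandInv H k α s₀ B₀ U₀ S { a with Q := {e} }) :
    Spec (fun b : Area V => potential H k α b.mem) (expandBadComp H k α σ e a)
      (potential H k α a.mem) fun b => ExpandInv H k α s₀ B₀ U₀ S b ∧ Ext H a.mem b.mem ∧ b.Q = ∅ :=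
  (spec_whileLoop_of_measure (F := fun b : Area V => potential H k α b.mem)
    (I := fun b => ExpandInv H k α s₀ B₀ U₀ S b ∧ Ext H a.mem b.mem)
    (fun b : Area V => 2 * numUnexplored H b.mem + b.Q.card)
    (fun _ hx hc => (spec_expandBadCompStep hp hx.1 hc).post fun _ h =>
      ⟨⟨h.1, hx.2.trans h.2.1⟩, h.2.2⟩) ⟨ha, Ext.refl _⟩).post fun _ h =>
      ⟨h.1.1, h.1.2, Finset.not_nonempty_iff_eq_empty.1 h.2⟩

/-- The result of exploring all bad edges that are connected with the edge `f`: the surroundings of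
the new bad edges `N` have been explored, and no bad neighbour of `f` remains unexplored. -/
structure Expanded (H : Hypergraph V) (k : ℕ) (α : ℝ) (s₀ s : Memory V) (N Un : Finset (Finset V))
    (f : Finset V) : Prop extends Grown H k α s₀ s N Un {g | g ∈ nbrs H f} where
  around : ∀ b ∈ N, ∀ h ∈ nbrs H b, h ∈ s.explored
  det : ∀ g ∈ nbrs H f, s.Det g
  via : ∀ g ∈ nbrs H f, s.Bad g → g ∈ s.explored

theorem spec_expandViaUnsafe (hp : Params H k α) (f : Finset V) {a : Area V}
    (hI : Inv H k α a.mem) (hex : ∀ g ∈ a.mem.explored, a.mem.Det g) :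
    Spec (fun b : Area V => potential H k α b.mem) (expandViaUnsafe H k α σ f a)
      (potential H k α a.mem) fun b => ∃ N Un, Expanded H k α a.mem b.mem N Un f ∧
        b.B = a.B ∪ N ∧ b.U = a.U ∪ Un := by
  refine (spec_forEach (fun R b => ∃ N Un, Grown H k α a.mem b.mem N Un {g | g ∈ nbrs H f} ∧
      b.B = a.B ∪ N ∧ b.U = a.U ∪ Un ∧ (∀ e ∈ N, ∀ h ∈ nbrs H e, h ∈ b.mem.explored) ∧
      (∀ h ∈ nbrs H f, h ∈ R ∨ (b.mem.Det h ∧ (b.mem.Bad h → h ∈ b.mem.explored))) ∧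
      R ⊆ nbrs H f) ?_ ?_).post ?_
  · rintro R b g hgR ⟨N, Un, hG, hB, hU, hN, hdet, hR⟩
    dsimp only
    have hgf : g ∈ nbrs H f := hR hgR
    have hge := mem_edges_of_mem_nbrs hgf
    have hR' : R.erase g ⊆ nbrs H f := (Finset.erase_subset _ _).trans hR
    -- What is known about the other neighbours of `f` remains true.
    have hrest : ∀ {s : Memory V}, Ext H b.mem s → s.Det g → (s.Bad g → g ∈ s.explored) →
        ∀ h ∈ nbrs H f, h ∈ R.erase g ∨ (s.Det h ∧ (s.Bad h → h ∈ s.explored)) := by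
      intro s hE h1 h2 h hh
      by_cases hhg : h = g
      · exact Or.inr (hhg ▸ ⟨h1, h2⟩)
      · refine (hdet h hh).imp (fun h => Finset.mem_erase.2 ⟨hhg, h⟩) fun ⟨h3, h4⟩ =>
          ⟨hE.det h3, fun hb => hE.explored (h4 (hE.Bad_of (mem_edges_of_mem_nbrs hh) h3 hb))⟩
    split_ifs with hexp
    · refine Spec.pure ⟨N, Un, hG.log g, hB, hU, hN,
        hrest (Ext.log b.mem g) ?_ fun _ => hexp, hR'⟩ le_rfl
      rcases hG.expl g hexp with h | h
      · exact hG.ext.det (hex g h)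
      · exact h.2.1
    · refine (spec_determine hp g (s := b.mem.log g) (hG.inv.log g)).bind ?_
      rintro s ⟨hIs, hEs, hes, hgs⟩
      have hE' : Ext H b.mem s := (Ext.log b.mem g).trans hEs
      have hes' : s.explored = b.mem.explored := hes
      split_ifs with hb
      · have hE₁ : Ext H b.mem (s.explore g) := hE'.trans (Ext.explore s g)
        have hins : (s.explore g).explored = insert g b.mem.explored := by
          rw [← hes']; rfl
        have hG' := hG.step (N' := insert g N) (Un' := Un) hE₁ (hIs.explore g)
          (fun e => by
            have hb' : (s.explore g).Bad g := hb
            rw [Finset.mem_insert]; tauto)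
          (fun e => ⟨Or.inl, fun h => h.elim id fun h => absurd hb.1 h.2.1.2.1⟩) hge hexp hins hgs
          (Or.inl hgf) (fun h => absurd hb.1 h.2.1)
        refine (spec_expandBadComp hp (s₀ := a.mem) (B₀ := a.B) (U₀ := a.U)
          (S := {g | g ∈ nbrs H f}) (a := { b with mem := s.explore g }) ⟨insert g N, Un, hG', ?_, ?_, hU, ?_⟩).post ?_
        · show b.B ∪ {g} = _
          rw [hB, Finset.union_insert, Finset.union_comm, ← Finset.insert_eq]
        · exact Finset.singleton_subset_iff.2 (Finset.mem_insert_self _ _)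
        · intro e he
          rcases Finset.mem_insert.1 he with rfl | he
          · exact Or.inl (Finset.mem_singleton_self _)
          · exact Or.inr fun h hh => hE₁.explored (hN e he h hh)
        · rintro c ⟨⟨N', Un', hG₁, hBQ, -, hU₁, hN₁⟩, hEc, hQ⟩
          have hE₂ : Ext H b.mem c.mem := hE₁.trans hEc
          rw [hQ, Finset.union_empty] at hBQ
          refine ⟨N', Un', hG₁, hBQ, hU₁, fun e he => (hN₁ e he).resolve_left (by simp [hQ]),
            hrest hE₂ (hEc.det hgs) fun _ => hEc.explored (Finset.mem_insert_self _ _), hR'⟩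
      · have hG' := hG.of_ext hE' hIs hes'
        refine Spec.pure ⟨N, Un, hG', hB, hU, fun e he h hh => hE'.explored (hN e he h hh),
          hrest hE' hgs fun h => absurd h hb, hR'⟩ le_rfl
  · exact ⟨∅, ∅, Grown.refl hI _, by simp, by simp, by simp, fun h hh => Or.inl hh, subset_rfl⟩
  · rintro b ⟨N, Un, hG, hB, hU, hN, hdet, -⟩
    exact ⟨N, Un, ⟨hG, hN, fun g hg => ((hdet g hg).resolve_left (Finset.notMem_empty _)).1,
      fun g hg => ((hdet g hg).resolve_left (Finset.notMem_empty _)).2⟩, hB, hU⟩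

end Programs

/-! ### The invariant of the construction of a final component -/

section Invariant

variable {V : Type u} [Fintype V] {H : Hypergraph V} {k : ℕ} {α : ℝ} {s s' : Memory V}

theorem NodeSat.transfer {ℓ : Finset V → ℤ} {n : Node V} (hn : NodeSat k α s ℓ n)
    (hb : s.bad ⊆ s'.bad)
    (hst : n.kind.IsElem → ∀ w ∈ n.edge, s'.status w = s.status w ∧ s'.color w = s.color w)
    (hbad : n.kind.IsElem → ∀ g ∈ s'.bad, (g ∩ n.edge).Nonempty → g ∈ s.bad) :
    NodeSat k α s' ℓ n := by
  obtain ⟨e, κ, l⟩ := n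
  by_cases hκ : κ = .blank
  · subst hκ; trivial
  replace hst := hst hκ
  replace hbad := hbad hκ
  have hex : exempt s' ℓ ⟨e, κ, l⟩ = exempt s ℓ ⟨e, κ, l⟩ := by
    have key : ∀ P : ℤ → Prop, ∀ w ∈ e,
        (∃ g ∈ s'.bad, w ∈ g ∧ P (ℓ g)) ↔ ∃ g ∈ s.bad, w ∈ g ∧ P (ℓ g) := fun P w hw =>
      ⟨fun ⟨g, hg, hwg, h⟩ => ⟨g, hbad g hg (meets_of_mem hwg hw), hwg, h⟩,
        fun ⟨g, hg, hwg, h⟩ => ⟨g, hb hg, hwg, h⟩⟩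
    cases κ
    · rfl
    · rfl
    · ext w
      simp only [exempt, Finset.mem_filter]
      exact and_congr_right fun hw =>
        and_congr (by rw [(hst w hw).1]) (key (fun x => x < l) w hw)
    · ext w
      simp only [exempt, Finset.mem_filter]
      exact and_congr_right fun hw =>
        and_congr (by rw [(hst w hw).1]) (key (fun x => ¬ x < l) w hw)
    · rfl
    · ext w
      simp only [exempt, Memory.mem_troubledPart]
      exact and_congr_right fun hw => by rw [(hst w hw).1]
  have hmono : s.Mono (e \ exempt s ℓ ⟨e, κ, l⟩) → s'.Mono (e \ exempt s ℓ ⟨e, κ, l⟩) := by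
    intro h v hv w hw
    rw [(hst v (Finset.mem_sdiff.1 hv).1).2, (hst w (Finset.mem_sdiff.1 hw).1).2]
    exact h v hv w hw
  cases κ
  · trivial
  · exact hb hn
  all_goals
    simp only [NodeSat] at hn ⊢
    rw [hex]
    exact ⟨hmono hn.1, hn.2⟩

/-- A witness remains a witness as long as nothing changes at the edges of its events. -/
theorem Witness.transfer {M : Multiset (Node V)} {X : Finset (Finset V)} {ℓ : Finset V → ℤ}
    (hW : Witness H k α s M X ℓ) (hX : Region H s' X) (hb : s.bad ⊆ s'.bad)
    (hdet : ∀ g, s.Det g → s'.Det g)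
    (hst : ∀ n ∈ M, n.kind.IsElem → ∀ w ∈ n.edge,
      s'.status w = s.status w ∧ s'.color w = s.color w)
    (hbad : ∀ n ∈ M, n.kind.IsElem → ∀ g ∈ s'.bad, (g ∩ n.edge).Nonempty → g ∈ s.bad) :
    Witness H k α s' M X ℓ where
  tree := hW.tree
  disj := hW.disj
  colored n hn hk := by
    have := hW.colored n hn hk
    rw [Memory.uncoloredPart_eq_empty] at this ⊢
    intro w hw
    rw [(hst n hn hk w hw).1]
    exact this w hw
  det n hn hk g hg := hdet g (hW.det n hn hk g hg)
  hit n hn hk g hg hm := hW.hit n hn hk g (hbad n hn hk g hg hm) hm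
  lev := hW.lev
  region := hX
  const := hW.const
  sat n hn := (hW.sat n hn).transfer hb (hst n hn) (hbad n hn)
  cov := hW.cov

theorem Region.of_ext {X : Finset (Finset V)} (hX : Region H s X) (hE : Ext H s s') :
    Region H s' X where
  edge := hX.edge
  bad g hg := hE.bad_stays g (hX.bad g hg)
  colored g hg := hE.colored (hX.colored g hg)
  det g hg h hh := hE.det (hX.det g hg h hh)
  closed g hg h hh hb :=
    hX.closed g hg h hh (hE.bad_det h (mem_edges_of_mem_nbrs hh) (hX.det g hg h hh) hb)

theorem Witness.of_ext {M : Multiset (Node V)} {X : Finset (Finset V)} {ℓ : Finset V → ℤ}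
    (hW : Witness H k α s M X ℓ) (hE : Ext H s s') (hI' : Inv H k α s') :
    Witness H k α s' M X ℓ := by
  refine hW.transfer (hW.region.of_ext hE) hE.bad_mono (fun g => hE.det)
    (fun n hn hk w hw => hE.keep w (Memory.uncoloredPart_eq_empty.1 (hW.colored n hn hk) w hw))
    fun n hn hk g hg hm => ?_
  by_cases hne : g = n.edge
  · rw [hne] at hg ⊢
    exact hE.bad_det _ (hW.tree.edge_mem hn) (Or.inl (hW.colored n hn hk)) hg
  · have hge := hI'.bad_sub g hg
    exact hE.bad_det g hge (hW.det n hn hk g (mem_nbrs_of_meets hge hne hm)) hg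

/-- All neighbours of `f` are determined, and the bad ones belong to `B`. -/
def Done (H : Hypergraph V) (s : Memory V) (B : Finset (Finset V)) (f : Finset V) : Prop :=
  (∀ g ∈ nbrs H f, s.Det g) ∧ ∀ g ∈ nbrs H f, s.Bad g → g ∈ B

/-- The bad neighbours of `f` outside of `B` intersect pairwise. -/
def Clustered (H : Hypergraph V) (s : Memory V) (B : Finset (Finset V)) (f : Finset V) : Prop :=
  ∀ g₁ ∈ nbrs H f, ∀ g₂ ∈ nbrs H f, s.Bad g₁ → s.Bad g₂ → g₁ ∉ B → g₂ ∉ B → ¬ Disjoint g₁ g₂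

/-- The edge `f` does not justify to extend `B` via `f`, and this is certain to remain so: all bad
neighbours of `f` belong to `B`, or those outside of `B` intersect pairwise and `f` has two colors
outside of the troubled vertices of `B`. In the second case, an enlargement of `B` that meets `f`
contains all bad neighbours of `f`. -/
def Quiet (H : Hypergraph V) (s : Memory V) (B : Finset (Finset V)) (f : Finset V) : Prop :=
  (∀ g ∈ nbrs H f, s.Det g) ∧ ((∀ g ∈ nbrs H f, s.Bad g → g ∈ B) ∨
    (Clustered H s B f ∧ ¬ s.Mono (f \ (s.troubledPart f ∩ verts B))))

/-- Some neighbour of `f` has been bad and is safe now. Such an edge cannot be used in a witness,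
because its event is killed. -/
def Touched (H : Hypergraph V) (s : Memory V) (f : Finset V) : Prop :=
  ∃ g ∈ nbrs H f, g ∈ s.bad ∧ s.Safe g

theorem Touched.det (hI : Inv H k α s) {f : Finset V} (hf : f ∈ edges H) (h : Touched H s f) :
    s.Det f :=
  let ⟨_, hg, hb, hs⟩ := h
  (hI.settled _ hb hs f (nbrs_symm hf hg)).1

theorem Touched.of_ext (hE : Ext H s s') {f : Finset V} (h : Touched H s' f) : Touched H s f :=
  let ⟨g, hg, hb, hs⟩ := h
  ⟨g, hg, hE.new_bad g hb hs, hE.safe_of_mem_bad (hE.new_bad g hb hs) hs⟩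

theorem bad_of_not_touched {f g : Finset V} (h : ¬ Touched H s f) (hg : g ∈ nbrs H f)
    (hb : g ∈ s.bad) : s.Bad g := ⟨hb, fun hs => h ⟨g, hg, hb, hs⟩⟩

theorem Done.of_ext (hE : Ext H s s') {B : Finset (Finset V)} {f : Finset V} (h : Done H s B f) :
    Done H s' B f :=
  ⟨fun g hg => hE.det (h.1 g hg),
    fun g hg hb => h.2 g hg (hE.Bad_of (mem_edges_of_mem_nbrs hg) (h.1 g hg) hb)⟩

theorem Clustered.of_ext (hE : Ext H s s') {B : Finset (Finset V)} {f : Finset V}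
    (hd : ∀ g ∈ nbrs H f, s.Det g) (h : Clustered H s B f) : Clustered H s' B f :=
  fun g₁ h₁ g₂ h₂ b₁ b₂ => h g₁ h₁ g₂ h₂ (hE.Bad_of (mem_edges_of_mem_nbrs h₁) (hd g₁ h₁) b₁)
    (hE.Bad_of (mem_edges_of_mem_nbrs h₂) (hd g₂ h₂) b₂)

theorem Quiet.of_ext (hE : Ext H s s') {B : Finset (Finset V)} {f : Finset V}
    (hf : s.uncoloredPart f = ∅) (h : Quiet H s B f) : Quiet H s' B f := by
  refine ⟨fun g hg => hE.det (h.1 g hg), ?_⟩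
  rcases h.2 with h2 | ⟨h2, h3⟩
  · exact Or.inl (Done.of_ext hE ⟨h.1, h2⟩).2
  · refine Or.inr ⟨h2.of_ext hE h.1, ?_⟩
    rwa [hE.troubledPart_eq hf, hE.mono_iff hf Finset.sdiff_subset]

theorem Done.mono {B B' : Finset (Finset V)} {f : Finset V} (h : Done H s B f) (hB : B ⊆ B') :
    Done H s B' f := ⟨h.1, fun g hg hb => hB (h.2 g hg hb)⟩

theorem Clustered.mono {B B' : Finset (Finset V)} {f : Finset V} (h : Clustered H s B f)
    (hB : B ⊆ B') : Clustered H s B' f :=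
  fun g₁ h₁ g₂ h₂ b₁ b₂ n₁ n₂ => h g₁ h₁ g₂ h₂ b₁ b₂ (fun h => n₁ (hB h)) fun h => n₂ (hB h)

theorem FewInside.mono {B B' : Finset (Finset V)} {f : Finset V} (h : FewInside k α s B' f)
    (hB : B ⊆ B') : FewInside k α s B f := by
  refine lt_of_le_of_lt (Nat.cast_le.2 (Finset.card_le_card ?_)) h
  exact Finset.inter_subset_inter_left (Finset.biUnion_subset_biUnion_of_subset_left _ hB)

theorem FewOutside.mono {B B' : Finset (Finset V)} {f : Finset V} (h : FewOutside k α s B f)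
    (hB : B ⊆ B') : FewOutside k α s B' f := by
  refine lt_of_le_of_lt (Nat.cast_le.2 (Finset.card_le_card ?_)) h
  exact Finset.sdiff_subset_sdiff subset_rfl
    (Finset.biUnion_subset_biUnion_of_subset_left _ hB)

/-- Two bad neighbours of `f` that intersect belong to the same region. -/
theorem mem_of_clustered {B X : Finset (Finset V)} {f g h : Finset V} (hX : Region H s X)
    (hc : Clustered H s B f) (hg : g ∈ nbrs H f) (hgX : g ∈ X) (hgB : g ∉ B) (hh : h ∈ nbrs H f)
    (hb : s.Bad h) (hhB : h ∉ B) : h ∈ X := by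
  have := hc h hh g hg hb (hX.bad g hgX) hhB hgB
  rw [Finset.not_disjoint_iff_nonempty_inter] at this
  exact hX.mem_of_meets hgX hb.1 (mem_edges_of_mem_nbrs hh) this

/-- If `f` is quiet already with respect to the empty set, then a single region next to `f` contains
all its bad neighbours. -/
theorem done_of_quiet {X : Finset (Finset V)} {f g : Finset V} (hX : Region H s X)
    (h : Quiet H s ∅ f) (hg : g ∈ nbrs H f) (hgX : g ∈ X) : Done H s X f := by
  refine ⟨h.1, fun e he hb => ?_⟩
  rcases h.2 with h2 | ⟨h2, -⟩
  · exact absurd (h2 e he hb) (Finset.notMem_empty e)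
  · exact mem_of_clustered hX h2 hg hgX (Finset.notMem_empty _) he hb (Finset.notMem_empty _)

theorem inter_verts_union {W : Finset V} {B A : Finset (Finset V)}
    (h : ∀ a ∈ A, ¬ (a ∩ W).Nonempty) : W ∩ verts (B ∪ A) = W ∩ verts B := by
  ext w
  simp only [Finset.mem_inter, mem_verts, Finset.mem_union]
  refine and_congr_right fun hw => ⟨?_, fun ⟨b, hb, hwb⟩ => ⟨b, Or.inl hb, hwb⟩⟩
  rintro ⟨b, hb | hb, hwb⟩
  · exact ⟨b, hb, hwb⟩
  · exact absurd (meets_of_mem hwb hw) (h b hb)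

/-- Quiet edges remain quiet when a region is added. -/
theorem Quiet.union {B A : Finset (Finset V)} (hA : Region H s A) (hd : Disjoint B A)
    {f : Finset V} (h : Quiet H s B f) : Quiet H s (B ∪ A) f := by
  refine ⟨h.1, ?_⟩
  by_cases hfA : f ∈ A
  · exact Or.inl fun g hg hb => Finset.mem_union_right _ (hA.closed f hfA g hg hb.1)
  rcases h.2 with h2 | ⟨h2, h3⟩
  · exact Or.inl fun g hg hb => Finset.mem_union_left _ (h2 g hg hb)
  by_cases hadj : ∃ a ∈ A, (a ∩ f).Nonempty
  · obtain ⟨a, ha, hm⟩ := hadj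
    refine Or.inl fun g hg hb => ?_
    by_cases hgB : g ∈ B
    · exact Finset.mem_union_left _ hgB
    · exact Finset.mem_union_right _ (mem_of_clustered hA h2
        (mem_nbrs_of_meets (hA.edge a ha) (by rintro rfl; exact hfA ha) hm) ha
        (Finset.disjoint_right.1 hd ha) hg hb hgB)
  · push Not at hadj
    refine Or.inr ⟨h2.mono Finset.subset_union_left, ?_⟩
    rw [inter_verts_union]
    · exact h3
    · intro a ha hne
      refine (Finset.not_nonempty_iff_eq_empty.2 (hadj a ha)) (hne.mono ?_)
      exact Finset.inter_subset_inter_left (Finset.filter_subset _ _)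

/-- The invariant during the construction of a final component. Here `B` is the current component,
`A` the current search area, `U` the set of the unsafe edges that have to be treated, and `Us` the
set of those that are kept for conditional expansions.

* `around`, `expl`: the surroundings of `B ∪ A` have been explored, and all explored bad edges belong
  to `B ∪ A`;
* `touched`: no new bad edges will be found via an edge next to a formerly bad edge that is safe now,
  so the events of such edges are not needed;
* `rest`: an explored edge that is not dealt with any more will be safe after the final coloring, or
  is quiet;
* `memUs`: the edges of `Us` are useless or can serve as the first edge `f₀` of a search;
* `wit`: there is a witness that covers `B`. -/
structure Growing (H : Hypergraph V) (k : ℕ) (α : ℝ) (s : Memory V) (B A U Us : Finset (Finset V)) :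
    Prop where
  inv : Inv H k α s
  alive : s.failed = false
  regB : Region H s B
  regA : Region H s A
  disj : Disjoint B A
  around : ∀ b ∈ B ∪ A, b ∈ s.explored ∧ ∀ h ∈ nbrs H b, h ∈ s.explored
  expl : ∀ g ∈ s.explored, g ∈ edges H ∧ s.Det g ∧ (s.Bad g → g ∈ B ∪ A)
  touched : ∀ f ∈ edges H, Touched H s f →
    s.Safe f ∨ ¬ FewInside k α s B f ∨ Done H s B f ∨ Quiet H s ∅ f
  rest : ∀ f ∈ s.explored, f ∈ B ∪ A ∨ f ∈ U ∨ s.Safe f ∨ ¬ FewInside k α s B f ∨ Quiet H s B f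
  memU : ∀ f ∈ U, f ∈ edges H ∧ s.Unsafe f ∧ f ∈ s.explored ∧ ∃ b ∈ B ∪ A, f ∈ nbrs H b
  memUs : ∀ f ∈ Us, f ∈ edges H ∧ s.uncoloredPart f = ∅ ∧ f ∉ s.bad ∧ f ∈ s.explored ∧
    (∃ b ∈ B, f ∈ nbrs H b) ∧ (Done H s B f ∨
      (¬ Touched H s f ∧ ¬ s.Safe f ∧ Quiet H s B f ∧ FewOutside k α s B f))
  wit : ∃ M ℓ, Witness H k α s M B ℓ ∧ 2 ≤ surplus M

theorem FewInside.ext_iff (hE : Ext H s s') {B : Finset (Finset V)} {f : Finset V}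
    (hf : s.uncoloredPart f = ∅) : FewInside k α s' B f ↔ FewInside k α s B f := by
  unfold FewInside
  rw [hE.troubledPart_eq hf]

theorem FewOutside.ext_iff (hE : Ext H s s') {B : Finset (Finset V)} {f : Finset V}
    (hf : s.uncoloredPart f = ∅) : FewOutside k α s' B f ↔ FewOutside k α s B f := by
  unfold FewOutside
  rw [hE.troubledPart_eq hf]

/-- New bad edges form a region as soon as their neighbours have been explored. -/
theorem Grown.region {N Un : Finset (Finset V)} {S : Set (Finset V)}
    (hG : Grown H k α s s' N Un S) (hn : ∀ b ∈ N, ∀ e ∈ nbrs H b, e ∈ s'.explored)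
    (hs : ∀ g ∈ s.explored, g ∈ edges H ∧ s.Det g ∧
      (s.Bad g → ∀ h ∈ nbrs H g, h ∈ s.explored)) : Region H s' N where
  edge g hg := (hG.fresh g (Or.inl hg)).1
  bad g hg := (hG.bad g hg).1
  colored g hg := (hG.bad g hg).2
  det g hg e he := by
    rcases hG.expl e (hn g hg e he) with h1 | h1
    · exact hG.ext.det (hs e h1).2.1
    · exact h1.2.1
  closed g hg e he heb := by
    have hge := (hG.fresh g (Or.inl hg)).1
    have hgb := (hG.bad g hg).1
    have hns : ¬ s'.Safe e := fun hs =>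
      hgb.2 ((hG.inv.settled e heb hs g (nbrs_symm hge he)).2 hgb.1)
    rcases hG.expl e (hn g hg e he) with h1 | ⟨-, -, h1 | h1 | h1⟩
    · have hb : s.Bad e := hG.ext.Bad_of (hs e h1).1 (hs e h1).2.1 ⟨heb, hns⟩
      exact absurd ((hs e h1).2.2 hb g (nbrs_symm hge he)) (hG.fresh g (Or.inl hg)).2.2
    · exact h1
    · exact absurd heb (hG.unsafe' e h1).1.2.1
    · exact absurd h1 hns

namespace Growing

variable {B A U Us N Un : Finset (Finset V)} {S : Set (Finset V)}

theorem not_adjacent (h : Growing H k α s B A U Us) (hG : Grown H k α s s' N Un S)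
    {g : Finset V} (hg : g ∈ N ∨ g ∈ Un) {b : Finset V} (hb : b ∈ B ∪ A) : g ∉ nbrs H b :=
  fun hadj => (hG.fresh g hg).2.2 ((h.around b hb).2 g hadj)

theorem notMem (h : Growing H k α s B A U Us) (hG : Grown H k α s s' N Un S)
    {g : Finset V} (hg : g ∈ N ∨ g ∈ Un) : g ∉ B ∪ A :=
  fun hb => (hG.fresh g hg).2.2 (h.around g hb).1

theorem region_new (h : Growing H k α s B A U Us) (hG : Grown H k α s s' N Un S)
    (hn : ∀ b ∈ N, ∀ e ∈ nbrs H b, e ∈ s'.explored) : Region H s' N :=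
  hG.region hn fun g hg => ⟨(h.expl g hg).1, (h.expl g hg).2.1,
    fun hb => (h.around g ((h.expl g hg).2.2 hb)).2⟩

theorem disjoint_new (h : Growing H k α s B A U Us) (hG : Grown H k α s s' N Un S) :
    Disjoint (B ∪ A) N :=
  Finset.disjoint_left.2 fun _ hg hgN => h.notMem hG (Or.inl hgN) hg

/-- The invariant is preserved when `A` is extended. -/
theorem expand (h : Growing H k α s B A U Us) (hG : Grown H k α s s' N Un S)
    (hn : ∀ b ∈ N, ∀ e ∈ nbrs H b, e ∈ s'.explored) :
    Growing H k α s' B (A ∪ N) (U ∪ Un) Us where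
  inv := hG.inv
  alive := hG.ext.failed.trans h.alive
  regB := h.regB.of_ext hG.ext
  regA := (h.regA.of_ext hG.ext).union (h.region_new hG hn)
  disj := by
    rw [Finset.disjoint_union_right]
    exact ⟨h.disj, (h.disjoint_new hG).mono_left Finset.subset_union_left⟩
  around b hb := by
    rw [← Finset.union_assoc, Finset.mem_union] at hb
    rcases hb with hb | hb
    · exact ⟨hG.ext.explored (h.around b hb).1, fun e he =>
        hG.ext.explored ((h.around b hb).2 e he)⟩
    · exact ⟨(hG.fresh b (Or.inl hb)).2.1, hn b hb⟩
  expl g hg := by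
    rw [← Finset.union_assoc]
    rcases hG.expl g hg with h1 | ⟨h1, h2, h3⟩
    · obtain ⟨h1, h2, h3⟩ := h.expl g h1
      exact ⟨h1, hG.ext.det h2, fun hb =>
        Finset.mem_union_left _ (h3 (hG.ext.Bad_of h1 h2 hb))⟩
    · refine ⟨h1, h2, fun hb => ?_⟩
      rcases h3 with h3 | h3 | h3
      · exact Finset.mem_union_right _ h3
      · exact absurd hb.1 (hG.unsafe' g h3).1.2.1
      · exact absurd h3 hb.2
  touched f hf ht := by
    have ht' := ht.of_ext hG.ext
    rcases ht'.det h.inv hf with hcol | hs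
    · rcases h.touched f hf ht' with h1 | h1 | h1 | h1
      · exact Or.inl (hG.ext.safe h1)
      · exact Or.inr (Or.inl (by rwa [FewInside.ext_iff hG.ext hcol]))
      · exact Or.inr (Or.inr (Or.inl (h1.of_ext hG.ext)))
      · exact Or.inr (Or.inr (Or.inr (h1.of_ext hG.ext hcol)))
    · exact Or.inl (hG.ext.safe hs)
  rest f hf := by
    rw [← Finset.union_assoc]
    rcases hG.expl f hf with h1 | ⟨-, -, h3⟩
    · rcases (h.expl f h1).2.1 with hcol | hs
      · rcases h.rest f h1 with h1 | h1 | h1 | h1 | h1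
        · exact Or.inl (Finset.mem_union_left _ h1)
        · exact Or.inr (Or.inl (Finset.mem_union_left _ h1))
        · exact Or.inr (Or.inr (Or.inl (hG.ext.safe h1)))
        · exact Or.inr (Or.inr (Or.inr (Or.inl (by rwa [FewInside.ext_iff hG.ext hcol]))))
        · exact Or.inr (Or.inr (Or.inr (Or.inr (h1.of_ext hG.ext hcol))))
      · exact Or.inr (Or.inr (Or.inl (hG.ext.safe hs)))
    · rcases h3 with h3 | h3 | h3
      · exact Or.inl (Finset.mem_union_right _ h3)
      · exact Or.inr (Or.inl (Finset.mem_union_right _ h3))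
      · exact Or.inr (Or.inr (Or.inl h3))
  memU f hf := by
    rw [← Finset.union_assoc]
    rcases Finset.mem_union.1 hf with hf | hf
    · obtain ⟨h1, h2, h3, b, hb, h4⟩ := h.memU f hf
      exact ⟨h1, Unsafe.ext hG.ext h1 h2, hG.ext.explored h3, b, Finset.mem_union_left _ hb, h4⟩
    · obtain ⟨h1, h2, -⟩ := hG.fresh f (Or.inr hf)
      obtain ⟨h3, b, hb, h4⟩ := hG.unsafe' f hf
      exact ⟨h1, h3, h2, b, Finset.mem_union_right _ hb, h4⟩
  memUs f hf := by
    obtain ⟨h1, h2, h3, h4, h5, h6⟩ := h.memUs f hf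
    refine ⟨h1, hG.ext.colored h2, fun hb => h3 (hG.ext.bad_det f h1 (Or.inl h2) hb),
      hG.ext.explored h4, h5, ?_⟩
    refine h6.imp (fun h6 => h6.of_ext hG.ext) fun ⟨h6, h7, h8, h9⟩ => ⟨fun ht =>
      h6 (ht.of_ext hG.ext), fun hs => h7 (hG.ext.safe_of_colored h2 hs), h8.of_ext hG.ext h2,
      by rwa [FewOutside.ext_iff hG.ext h2]⟩
  wit := by
    obtain ⟨M, ℓ, hW, hs⟩ := h.wit
    exact ⟨M, ℓ, hW.of_ext hG.ext hG.inv, hs⟩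

theorem of_ext (h : Growing H k α s B A U Us) (hE : Ext H s s') (hI : Inv H k α s')
    (he : s'.explored = s.explored) : Growing H k α s' B A U Us := by
  have := h.expand ((Grown.refl h.inv ∅).of_ext hE hI he) (by simp)
  rwa [Finset.union_empty, Finset.union_empty] at this

theorem log (h : Growing H k α s B A U Us) (g : Finset V) : Growing H k α (s.log g) B A U Us :=
  h.of_ext (Ext.log s g) (h.inv.log g) rfl

/-- The search area `A` is added to the component `B`. -/
theorem merge (h : Growing H k α s B A U Us)
    (hW : ∃ M ℓ, Witness H k α s M (B ∪ A) ℓ ∧ 2 ≤ surplus M) :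
    Growing H k α s (B ∪ A) ∅ U Us where
  inv := h.inv
  alive := h.alive
  regB := h.regB.union h.regA
  regA := ⟨by simp, by simp, by simp, by simp, by simp⟩
  disj := Finset.disjoint_empty_right _
  around b hb := h.around b (by rwa [Finset.union_empty] at hb)
  expl g hg := by rw [Finset.union_empty]; exact h.expl g hg
  touched f hf ht := by
    rcases h.touched f hf ht with h1 | h1 | h1 | h1
    · exact Or.inl h1
    · exact Or.inr (Or.inl fun h2 => h1 (h2.mono Finset.subset_union_left))
    · exact Or.inr (Or.inr (Or.inl (h1.mono Finset.subset_union_left)))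
    · exact Or.inr (Or.inr (Or.inr h1))
  rest f hf := by
    rw [Finset.union_empty]
    rcases h.rest f hf with h1 | h1 | h1 | h1 | h1
    · exact Or.inl h1
    · exact Or.inr (Or.inl h1)
    · exact Or.inr (Or.inr (Or.inl h1))
    · exact Or.inr (Or.inr (Or.inr (Or.inl fun h2 => h1 (h2.mono Finset.subset_union_left))))
    · exact Or.inr (Or.inr (Or.inr (Or.inr (h1.union h.regA h.disj))))
  memU f hf := by rw [Finset.union_empty]; exact h.memU f hf
  memUs f hf := by
    obtain ⟨h1, h2, h3, h4, ⟨b, hb, h5⟩, h6⟩ := h.memUs f hf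
    refine ⟨h1, h2, h3, h4, ⟨b, Finset.mem_union_left _ hb, h5⟩, ?_⟩
    refine h6.imp (fun h6 => h6.mono Finset.subset_union_left) fun ⟨h6, h7, h8, h9⟩ =>
      ⟨h6, h7, h8.union h.regA h.disj, h9.mono Finset.subset_union_left⟩
  wit := hW

end Growing

end Invariant

/-! ### Accepting the troubled vertices of a set of bad edges -/

section Accepting

variable {V : Type u} [Fintype V] {H : Hypergraph V} {k : ℕ} {α : ℝ} {s s' : Memory V}
  {A : Finset (Finset V)}

theorem mem_troubledVerts {w : V} :
    w ∈ s.troubledVerts A ↔ s.status w = Status.troubled ∧ ∃ a ∈ A, w ∈ a := by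
  rw [Memory.troubledVerts, Memory.mem_troubledPart, mem_verts, and_comm]

theorem sdiff_troubledVerts (f : Finset V) :
    f \ s.troubledVerts A = f \ (s.troubledPart f ∩ verts A) := by
  ext w
  simp only [Finset.mem_sdiff, mem_troubledVerts, Finset.mem_inter, Memory.mem_troubledPart,
    mem_verts]
  refine and_congr_right fun hw => ?_
  simp [hw]

theorem inter_troubledVerts (f : Finset V) :
    f ∩ s.troubledVerts A = s.troubledPart f ∩ verts A := by
  ext w
  simp only [mem_troubledVerts, Finset.mem_inter, Memory.mem_troubledPart, mem_verts, and_assoc]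

theorem notMem_troubledVerts {f : Finset V} (h : ∀ a ∈ A, ¬ (a ∩ f).Nonempty) :
    ∀ w ∈ f, w ∉ s.troubledVerts A := fun _ hw hwA =>
  let ⟨_, a, ha, hwa⟩ := mem_troubledVerts.1 hwA
  h a ha (meets_of_mem hwa hw)

theorem Region.not_meets (hA : Region H s A) (hI : Inv H k α s) {g : Finset V} (hg : g ∈ s.bad)
    (hgA : g ∉ A) : ∀ a ∈ A, ¬ (a ∩ g).Nonempty := fun _ ha hm =>
  hgA (hA.mem_of_meets ha hg (hI.bad_sub g hg) (meets_comm.1 hm))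

namespace AcceptLike

theorem bad_iff (h : AcceptLike H (s.troubledVerts A) s s') (hI : Inv H k α s)
    (hA : Region H s A) (hsafe : ∀ a ∈ A, s'.Safe a) {g : Finset V} :
    s'.Bad g ↔ s.Bad g ∧ g ∉ A := by
  constructor
  · rintro ⟨hb, hs⟩
    exact ⟨⟨h.bad ▸ hb, fun h' => hs (h.safe h')⟩, fun hg => hs (hsafe g hg)⟩
  · rintro ⟨⟨hb, hs⟩, hg⟩
    refine ⟨h.bad.symm ▸ hb, ?_⟩
    rwa [h.safe_iff (notMem_troubledVerts (hA.not_meets hI hb hg))]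

theorem inv (h : AcceptLike H (s.troubledVerts A) s s') (hI : Inv H k α s)
    (hA : Region H s A) (hsafe : ∀ a ∈ A, s'.Safe a) : Inv H k α s' where
  bad_sub g hg := hI.bad_sub g (h.bad ▸ hg)
  troubled w hw := by
    rw [h.status] at hw
    split_ifs at hw with hwW
    obtain ⟨g, hg, hwg, hb⟩ := hI.troubled w hw
    exact ⟨g, hg, hwg, (h.bad_iff hI hA hsafe).2
      ⟨hb, fun hgA => hwW (mem_troubledVerts.2 ⟨hw, g, hgA, hwg⟩)⟩⟩
  settled g hg hs e he := by
    rw [h.bad] at hg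
    by_cases hs0 : s.Safe g
    · obtain ⟨h1, h2⟩ := hI.settled g hg hs0 e he
      exact ⟨h.det_of h1, fun hb => h.safe (h2 (h.bad ▸ hb))⟩
    · have hgA : g ∈ A := by
        by_contra hgA
        exact ((h.bad_iff hI hA hsafe).2 ⟨⟨hg, hs0⟩, hgA⟩).2 hs
      exact ⟨h.det_of (hA.det g hgA e he),
        fun hb => hsafe e (hA.closed g hgA e he (h.bad ▸ hb))⟩
  few g hg hgb hd := by
    have hd0 : ¬ s.Det g := fun h' => hd (h.det_of h')
    rw [h.acceptedPart fun w hw hwW => hd0 (h.det g hg ⟨w, hw, hwW⟩)]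
    exact hI.few g hg (h.bad ▸ hgb) hd0
  not_accepted g hg := by
    obtain ⟨hb, hgA⟩ := (h.bad_iff hI hA hsafe).1 hg
    obtain ⟨w, hw, hwa⟩ := hI.not_accepted g hb
    refine ⟨w, hw, ?_⟩
    rwa [h.status, if_neg (notMem_troubledVerts (hA.not_meets hI hb.1 hgA) w hw)]

theorem touched (h : AcceptLike H (s.troubledVerts A) s s') (hI : Inv H k α s)
    (hA : Region H s A) (hsafe : ∀ a ∈ A, s'.Safe a) {f : Finset V} (ht : Touched H s' f) :
    Touched H s f ∨ ∃ a ∈ A, a ∈ nbrs H f := by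
  obtain ⟨g, hg, hb, hs⟩ := ht
  rw [h.bad] at hb
  by_cases hs0 : s.Safe g
  · exact Or.inl ⟨g, hg, hb, hs0⟩
  · refine Or.inr ⟨g, ?_, hg⟩
    by_contra hgA
    exact ((h.bad_iff hI hA hsafe).2 ⟨⟨hb, hs0⟩, hgA⟩).2 hs

theorem done (h : AcceptLike H (s.troubledVerts A) s s') (hI : Inv H k α s)
    (hA : Region H s A) (hsafe : ∀ a ∈ A, s'.Safe a) {B B' : Finset (Finset V)} {f : Finset V}
    (hd : Done H s B f) (hB : ∀ b ∈ B, b ∉ A → b ∈ B') : Done H s' B' f :=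
  ⟨fun g hg => h.det_of (hd.1 g hg), fun g hg hb =>
    let ⟨h1, h2⟩ := (h.bad_iff hI hA hsafe).1 hb
    hB g (hd.2 g hg h1) h2⟩

theorem clustered (h : AcceptLike H (s.troubledVerts A) s s') (hI : Inv H k α s)
    (hA : Region H s A) (hsafe : ∀ a ∈ A, s'.Safe a) {B B' : Finset (Finset V)} {f : Finset V}
    (hc : Clustered H s B f) (hB : ∀ b ∈ B, b ∉ A → b ∈ B') : Clustered H s' B' f := by
  intro g₁ h₁ g₂ h₂ b₁ b₂ n₁ n₂
  obtain ⟨c₁, m₁⟩ := (h.bad_iff hI hA hsafe).1 b₁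
  obtain ⟨c₂, m₂⟩ := (h.bad_iff hI hA hsafe).1 b₂
  exact hc g₁ h₁ g₂ h₂ c₁ c₂ (fun h => n₁ (hB _ h m₁)) fun h => n₂ (hB _ h m₂)

theorem region (h : AcceptLike H (s.troubledVerts A) s s') (hI : Inv H k α s)
    (hA : Region H s A) (hsafe : ∀ a ∈ A, s'.Safe a) {B : Finset (Finset V)}
    (hB : Region H s B) (hd : Disjoint B A) : Region H s' B where
  edge := hB.edge
  bad g hg := (h.bad_iff hI hA hsafe).2 ⟨hB.bad g hg, Finset.disjoint_left.1 hd hg⟩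
  colored g hg := (h.uncoloredPart g).trans (hB.colored g hg)
  det g hg e he := h.det_of (hB.det g hg e he)
  closed g hg e he heb := hB.closed g hg e he (h.bad ▸ heb)

theorem witness (h : AcceptLike H (s.troubledVerts A) s s') (hI : Inv H k α s)
    (hA : Region H s A) (hsafe : ∀ a ∈ A, s'.Safe a) {B : Finset (Finset V)} (hd : Disjoint B A)
    {M : Multiset (Node V)} {ℓ : Finset V → ℤ} (hW : Witness H k α s M B ℓ) :
    Witness H k α s' M B ℓ := by
  refine hW.transfer (h.region hI hA hsafe hW.region hd) h.bad.ge (fun g => h.det_of) ?_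
    fun n hn hk g hg _ => h.bad ▸ hg
  intro n hn hk w hw
  have hwW : w ∉ s.troubledVerts A := by
    refine notMem_troubledVerts (fun a ha hm => ?_) w hw
    exact Finset.disjoint_right.1 hd ha (hW.hit n hn hk a (hA.bad a ha).1 hm)
  exact ⟨by rw [h.status, if_neg hwW], h.color w hwW⟩

end AcceptLike

/-- Determined edges are safe as soon as accepted vertices of both colors occur. -/
theorem safe_of_not_mono {f W : Finset V} (hW : W ⊆ f)
    (hst : ∀ w ∈ W, s.status w = Status.accepted) (h : ¬ s.Mono W) : s.Safe f := by
  intro hm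
  exact h (hm.subset fun w hw => Memory.mem_acceptedPart.2 ⟨hW hw, hst w hw⟩)

theorem Growing.det_of_meets {B U Us : Finset (Finset V)} (h : Growing H k α s B A U Us)
    {X : Finset (Finset V)} (hX : X ⊆ B ∪ A) {f : Finset V} (hf : f ∈ edges H)
    (hm : ∃ w ∈ f, w ∈ s.troubledVerts X) : s.Det f := by
  obtain ⟨w, hw, hwX⟩ := hm
  obtain ⟨-, x, hx, hwx⟩ := mem_troubledVerts.1 hwX
  by_cases hne : f = x
  · rw [hne]
    exact (h.expl x (h.around x (hX hx)).1).2.1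
  · exact (h.expl f ((h.around x (hX hx)).2 f (mem_nbrs_of_mem hf hne hw hwx))).2.1

/-- The acceptance of an unsuccessful search area makes all its bad edges safe, since none of them is
monochromatic. -/
theorem acceptLike_accept {B U Us : Finset (Finset V)} (h : Growing H k α s B A U Us)
    (hmono : ∀ a ∈ A, ¬ s.Mono a) :
    AcceptLike H (s.troubledVerts A) s (s.accept (s.troubledVerts A)) ∧
      ∀ a ∈ A, (s.accept (s.troubledVerts A)).Safe a := by
  have hsafe : ∀ a ∈ A, (s.accept (s.troubledVerts A)).Safe a := by
    intro a ha
    refine safe_of_not_mono (W := a) subset_rfl (fun w hw => ?_) (hmono a ha)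
    have hu := Memory.uncoloredPart_eq_empty.1 (h.regA.colored a ha) w hw
    simp only [Memory.accept]
    split_ifs with hwA
    · rfl
    · cases hst : s.status w
      · exact absurd hst hu
      · rfl
      · exact absurd (mem_troubledVerts.2 ⟨hst, a, ha, hw⟩) hwA
  refine ⟨⟨fun w hw => (mem_troubledVerts.1 hw).1, fun v => rfl, fun v _ => rfl, rfl,
    fun f hf hm => h.det_of_meets Finset.subset_union_right hf hm, fun w hw => ?_⟩, hsafe⟩
  obtain ⟨-, a, ha, hwa⟩ := mem_troubledVerts.1 hw
  exact ⟨a, (h.regA.bad a ha).1, hwa, hsafe a ha⟩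

/-- The invariant is restored when the troubled vertices of an unsuccessful search area have been
accepted. The unsafe edges `U` found by the search become quiet with respect to the empty set: their
bad neighbours outside of the search area intersect pairwise, and their vertices have two colors. -/
theorem Growing.accept {B U Us : Finset (Finset V)} (h : Growing H k α s B A U Us)
    (hU : ∀ f ∈ U, (∀ g ∈ nbrs H f, s.Det g) ∧ Clustered H s A f ∧ ¬ s.Mono f)
    (hB : ∀ f ∈ U, ∀ b ∈ B, f ∉ nbrs H b) (hmono : ∀ a ∈ A, ¬ s.Mono a) :
    Growing H k α (s.accept (s.troubledVerts A)) B ∅ ∅ Us := by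
  obtain ⟨hAL, hsafe⟩ := acceptLike_accept h hmono
  set s' := s.accept (s.troubledVerts A) with hs'
  have hI := h.inv
  have hnB : ∀ b ∈ B, b ∉ A := fun b hb => Finset.disjoint_left.1 h.disj hb
  have hexp : s'.explored = s.explored := rfl
  have hMono : ∀ W, s'.Mono W ↔ s.Mono W := fun W => Iff.rfl
  -- The number of troubled vertices in the main component does not change.
  have hfew : ∀ f, s'.troubledPart f ∩ verts B = s.troubledPart f ∩ verts B := by
    intro f
    ext w
    simp only [Finset.mem_inter, Memory.mem_troubledPart, mem_verts]
    constructor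
    · rintro ⟨⟨hw, ht⟩, hb⟩
      rw [hAL.status] at ht
      split_ifs at ht
      exact ⟨⟨hw, ht⟩, hb⟩
    · rintro ⟨⟨hw, ht⟩, b, hb, hwb⟩
      refine ⟨⟨hw, ?_⟩, b, hb, hwb⟩
      rw [hAL.status, if_neg, ht]
      exact notMem_troubledVerts (h.regA.not_meets hI (h.regB.bad b hb).1 (hnB b hb)) w hwb
  have hIn : ∀ f, FewInside k α s' B f ↔ FewInside k α s B f := by
    intro f
    unfold FewInside
    rw [hfew]
  have hquiet : ∀ f, Quiet H s B f → Quiet H s' B f := by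
    rintro f ⟨h1, h2⟩
    refine ⟨fun g hg => hAL.det_of (h1 g hg), ?_⟩
    rcases h2 with h2 | ⟨h2, h3⟩
    · exact Or.inl (hAL.done hI h.regA hsafe ⟨h1, h2⟩ fun b hb _ => hb).2
    · refine Or.inr ⟨hAL.clustered hI h.regA hsafe h2 fun b hb _ => hb, ?_⟩
      rwa [hfew, hMono]
  have hquiet0 : ∀ f, Quiet H s ∅ f → Quiet H s' ∅ f := by
    rintro f ⟨h1, h2⟩
    refine ⟨fun g hg => hAL.det_of (h1 g hg), ?_⟩
    rcases h2 with h2 | ⟨h2, h3⟩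
    · exact Or.inl (hAL.done hI h.regA hsafe ⟨h1, h2⟩ fun b hb _ => hb).2
    · refine Or.inr ⟨hAL.clustered hI h.regA hsafe h2 fun b hb _ => hb, ?_⟩
      simpa [verts, hMono] using h3
  -- A quiet edge next to the search area has no bad neighbours outside of `B` any more: they would
  -- intersect an edge of the search area, and belong to it.
  have hnew : ∀ f, (∃ a ∈ A, a ∈ nbrs H f) → Quiet H s B f → Done H s' B f := by
    rintro f ⟨a, ha, haf⟩ ⟨h1, h2⟩
    refine ⟨fun g hg => hAL.det_of (h1 g hg), fun g hg hb => ?_⟩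
    obtain ⟨hb, hgA⟩ := (hAL.bad_iff hI h.regA hsafe).1 hb
    rcases h2 with h2 | ⟨h2, -⟩
    · exact h2 g hg hb
    · by_contra hgB
      exact hgA (mem_of_clustered h.regA h2 haf ha (Finset.disjoint_right.1 h.disj ha) hg hb hgB)
  have hnewU : ∀ f ∈ U, Quiet H s' ∅ f := by
    intro f hf
    obtain ⟨h1, h2, h3⟩ := hU f hf
    refine ⟨fun g hg => hAL.det_of (h1 g hg), Or.inr ⟨hAL.clustered hI h.regA hsafe h2
      fun b hb hb' => absurd hb hb', ?_⟩⟩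
    simpa [verts, hMono] using h3
  refine ⟨hAL.inv hI h.regA hsafe, h.alive, hAL.region hI h.regA hsafe h.regB h.disj,
    ⟨by simp, by simp, by simp, by simp, by simp⟩, Finset.disjoint_empty_right _, ?_, ?_, ?_, ?_,
    by simp, ?_, ?_⟩
  · intro b hb
    rw [Finset.union_empty] at hb
    exact h.around b (Finset.mem_union_left _ hb)
  · intro g hg
    obtain ⟨h1, h2, h3⟩ := h.expl g hg
    refine ⟨h1, hAL.det_of h2, fun hb => ?_⟩
    obtain ⟨hb, hgA⟩ := (hAL.bad_iff hI h.regA hsafe).1 hb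
    rw [Finset.union_empty]
    exact (Finset.mem_union.1 (h3 hb)).resolve_right hgA
  · intro f hf ht
    rw [hIn]
    rcases hAL.touched hI h.regA hsafe ht with ht | ⟨a, ha, haf⟩
    · rcases h.touched f hf ht with h1 | h1 | h1 | h1
      · exact Or.inl (hAL.safe h1)
      · exact Or.inr (Or.inl h1)
      · exact Or.inr (Or.inr (Or.inl (hAL.done hI h.regA hsafe h1 fun b hb _ => hb)))
      · exact Or.inr (Or.inr (Or.inr (hquiet0 f h1)))
    · have hfa := nbrs_symm hf haf
      have hfe := (h.around a (Finset.mem_union_right _ ha)).2 f hfa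
      rcases h.rest f hfe with h1 | h1 | h1 | h1 | h1
      · rcases Finset.mem_union.1 h1 with h1 | h1
        · exact absurd (h.regB.closed f h1 a haf (h.regA.bad a ha).1)
            (Finset.disjoint_right.1 h.disj ha)
        · exact Or.inl (hsafe f h1)
      · exact Or.inr (Or.inr (Or.inr (hnewU f h1)))
      · exact Or.inl (hAL.safe h1)
      · exact Or.inr (Or.inl h1)
      · exact Or.inr (Or.inr (Or.inl (hnew f ⟨a, ha, haf⟩ h1)))
  · intro f hf
    rw [hIn, Finset.union_empty]
    rcases h.rest f hf with h1 | h1 | h1 | h1 | h1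
    · rcases Finset.mem_union.1 h1 with h1 | h1
      · exact Or.inl h1
      · exact Or.inr (Or.inr (Or.inl (hsafe f h1)))
    · refine Or.inr (Or.inr (Or.inr (Or.inr ?_)))
      obtain ⟨hfe, hun, -⟩ := h.memU f h1
      obtain ⟨h2, h3⟩ := hnewU f h1
      refine ⟨h2, h3.imp (fun h3 g hg hb => absurd (h3 g hg hb) (Finset.notMem_empty g))
        fun ⟨h3, h4⟩ => ⟨h3.mono (Finset.empty_subset _), ?_⟩⟩
      have he : s'.troubledPart f ∩ verts B = ∅ := by
        refine Finset.eq_empty_of_forall_notMem fun w hw => ?_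
        rw [Finset.mem_inter, Memory.mem_troubledPart, mem_verts] at hw
        obtain ⟨⟨hwf, -⟩, b, hb, hwb⟩ := hw
        exact hB f h1 b hb (mem_nbrs_of_mem hfe
          (by rintro rfl; exact hun.2.1 (h.regB.bad f hb).1) hwf hwb)
      rw [he]
      simpa [verts] using h4
    · exact Or.inr (Or.inr (Or.inl (hAL.safe h1)))
    · exact Or.inr (Or.inr (Or.inr (Or.inl h1)))
    · exact Or.inr (Or.inr (Or.inr (Or.inr (hquiet f h1))))
  · intro f hf
    obtain ⟨h1, h2, h3, h4, h5, h6⟩ := h.memUs f hf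
    refine ⟨h1, (hAL.uncoloredPart f).trans h2, h3, h4, h5, ?_⟩
    rcases h6 with h6 | ⟨h6, h7, h8, h9⟩
    · exact Or.inl (hAL.done hI h.regA hsafe h6 fun b hb _ => hb)
    · by_cases hadj : ∃ a ∈ A, a ∈ nbrs H f
      · exact Or.inl (hnew f hadj h8)
      · have hW : ∀ w ∈ f, w ∉ s.troubledVerts A := by
          refine notMem_troubledVerts fun a ha hm => hadj ⟨a, ha, ?_⟩
          exact mem_nbrs_of_meets (h.regA.edge a ha)
            (by rintro rfl; exact h3 (h.regA.bad a ha).1) hm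
        refine Or.inr ⟨fun ht => ?_, ?_, hquiet f h8, ?_⟩
        · exact (hAL.touched hI h.regA hsafe ht).elim h6 hadj
        · rwa [hAL.safe_iff hW]
        · refine lt_of_le_of_lt (Nat.cast_le.2 (Finset.card_le_card ?_)) h9
          refine Finset.sdiff_subset_sdiff (fun w hw => ?_) subset_rfl
          rw [Memory.mem_troubledPart] at hw ⊢
          refine ⟨hw.1, ?_⟩
          have := hw.2
          rwa [hAL.status, if_neg (hW w hw.1)] at this
  · obtain ⟨M, ℓ, hW, hs⟩ := h.wit
    exact ⟨M, ℓ, hAL.witness hI h.regA hsafe h.disj hW, hs⟩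

end Accepting

/-! ### Extending the component and the search area -/

section Extending

variable {V : Type u} [Fintype V] {H : Hypergraph V} {k : ℕ} {α : ℝ} {s s' : Memory V}
  {B A U Us N Un : Finset (Finset V)} {f : Finset V}

theorem clustered_of_not_meetsTwoDisjointBad (h : ¬ MeetsTwoDisjointBad H s B f) :
    Clustered H s B f := fun g₁ h₁ g₂ h₂ b₁ b₂ n₁ n₂ hd =>
  h ⟨g₁, (mem_nbrs.1 h₁).1, g₂, (mem_nbrs.1 h₂).1, b₁, b₂, n₁, n₂, (mem_nbrs.1 h₁).2.2,
    (mem_nbrs.1 h₂).2.2, hd⟩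

theorem MeetsTwoDisjointBad.exists_nbrs (h : MeetsTwoDisjointBad H s B f) (hf : f ∉ s.bad) :
    ∃ g₁ ∈ nbrs H f, ∃ g₂ ∈ nbrs H f, s.Bad g₁ ∧ s.Bad g₂ ∧ g₁ ∉ B ∧ g₂ ∉ B ∧ Disjoint g₁ g₂ := by
  obtain ⟨g₁, h₁, g₂, h₂, b₁, b₂, n₁, n₂, m₁, m₂, hd⟩ := h
  exact ⟨g₁, mem_nbrs.2 ⟨h₁, by rintro rfl; exact hf b₁.1, m₁⟩, g₂,
    mem_nbrs.2 ⟨h₂, by rintro rfl; exact hf b₂.1, m₂⟩, b₁, b₂, n₁, n₂, hd⟩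

/-- If the bad edges from which `N` is generated intersect pairwise, then `N` is connected. -/
theorem comp_of_pairwise_meet (hN : Region H s N) (hne : N.Nonempty) {S : Set (Finset V)}
    (hgen : GenFrom H N S) (hS : ∀ g₁ ∈ N, ∀ g₂ ∈ N, g₁ ∈ S → g₂ ∈ S → ¬ Disjoint g₁ g₂) :
    Comp H s N where
  toRegion := hN
  nonempty := hne
  conn c hc Z h1 h2 := by
    have hcZ : c ∈ Z := h1 c hc rfl
    by_cases hex : ∃ n ∈ N, n ∈ S ∧ n ∈ Z
    · obtain ⟨n, hn, hnS, hnZ⟩ := hex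
      refine hgen Z (fun g hg hgS => ?_) h2
      by_cases hgn : g = n
      · exact hgn ▸ hnZ
      · have := hS g hg n hn hgS hnS
        rw [Finset.not_disjoint_iff_nonempty_inter] at this
        exact h2 n hn hnZ g hg (mem_nbrs_of_meets (hN.edge g hg) hgn this)
    · push Not at hex
      -- Otherwise the complement of `Z` contains all of `N`.
      refine absurd hcZ (hgen Zᶜ (fun g hg hgS => hex g hg hgS) (fun a ha haZ e he hadj heZ => ?_)
        c hc)
      exact haZ (h2 e he heZ a ha (nbrs_symm (hN.edge a ha) hadj))

theorem Comp.of_ext {C : Finset (Finset V)} (hC : Comp H s C) (hE : Ext H s s') : Comp H s' C where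
  toRegion := hC.toRegion.of_ext hE
  nonempty := hC.nonempty
  conn := hC.conn

theorem MayActivate.ext_iff (hE : Ext H s s') {C : Finset (Finset V)}
    (hf : s.uncoloredPart f = ∅) : MayActivate s' C f ↔ MayActivate s C f := by
  unfold MayActivate
  rw [hE.acceptedPart_eq hf, hE.troubledPart_eq hf, hE.mono_iff hf]
  exact Finset.union_subset (Finset.filter_subset _ _)
    (Finset.inter_subset_left.trans (Finset.filter_subset _ _))

theorem Linked.of_ext (hA : Linked H k α s A) (hE : Ext H s s') : Linked H k α s' A := by
  induction hA with
  | comp h => exact .comp (h.of_ext hE)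
  | link h h₁ hsub h₂ hd hf hfb hcol hdet hbad hm₁ hm₂ hmono hcard ih =>
    exact .link ih (h₁.of_ext hE) hsub (h₂.of_ext hE) hd hf
      (fun hb => hfb (hE.bad_det _ hf (Or.inl hcol) hb)) (hE.colored hcol)
      (fun g hg => hE.det (hdet g hg))
      (fun g hg hb => hbad g hg (hE.bad_det g (mem_edges_of_mem_nbrs hg) (hdet g hg) hb)) hm₁ hm₂
      ((MayActivate.ext_iff hE hcol).2 hmono) ((FewOutside.ext_iff hE hcol).2 hcard)

namespace Growing

/-- The edges of `U` and `Us` may be replaced. -/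
theorem replace (h : Growing H k α s B A U Us) {U' Us' : Finset (Finset V)} (hU : U' ⊆ U)
    (hdrop : ∀ f ∈ U, f ∉ U' → s.Safe f ∨ ¬ FewInside k α s B f ∨ Quiet H s B f)
    (hUs : ∀ f ∈ Us', f ∈ Us ∨ (f ∈ U ∧ (∃ b ∈ B, f ∈ nbrs H b) ∧ (Done H s B f ∨
      (¬ Touched H s f ∧ ¬ s.Safe f ∧ Quiet H s B f ∧ FewOutside k α s B f)))) :
    Growing H k α s B A U' Us' where
  inv := h.inv
  alive := h.alive
  regB := h.regB
  regA := h.regA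
  disj := h.disj
  around := h.around
  expl := h.expl
  touched := h.touched
  rest f hf := by
    rcases h.rest f hf with h1 | h1 | h1
    · exact Or.inl h1
    · by_cases hf' : f ∈ U'
      · exact Or.inr (Or.inl hf')
      · exact Or.inr (Or.inr (hdrop f h1 hf'))
    · exact Or.inr (Or.inr h1)
  memU f hf := h.memU f (hU hf)
  memUs f hf := by
    rcases hUs f hf with h1 | ⟨h1, h2, h3⟩
    · exact h.memUs f h1
    · obtain ⟨h4, h5, h6, -⟩ := h.memU f h1
      exact ⟨h4, h5.1, h5.2.1, h6, h2, h3⟩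
  wit := h.wit

theorem eraseUs (h : Growing H k α s B A U Us) (f : Finset V) :
    Growing H k α s B A U (Us.erase f) :=
  h.replace subset_rfl (fun _ h1 h2 => absurd h1 h2) fun _ hg => Or.inl (Finset.mem_of_mem_erase hg)

/-- Nothing new is found via an edge all of whose bad neighbours belong to `B`. -/
theorem eq_empty_of_done (h : Growing H k α s B A U Us) (hG : Expanded H k α s s' N Un f)
    {X : Finset (Finset V)} (hX : X ⊆ B ∪ A) (hd : Done H s X f) : N = ∅ := by
  by_contra hne
  obtain ⟨g, hg, hgf⟩ := hG.gen.exists_mem (Finset.nonempty_iff_ne_empty.2 hne)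
  exact h.notMem hG.toGrown (Or.inl hg) (hX ((hd.of_ext hG.ext).2 g hgf (hG.bad g hg).1))

/-- After the expansion via `f`, all bad neighbours of `f` have been found. -/
theorem done_expanded (h : Growing H k α s B A U Us) (hG : Expanded H k α s s' N Un f) :
    Done H s' (B ∪ (A ∪ N)) f :=
  ⟨hG.det, fun g hg hb => ((h.expand hG.toGrown hG.around).expl g (hG.via g hg hb)).2.2 hb⟩

/-- A touched edge of `U` or `Us` next to the component has no bad neighbours outside of it, and
extending via this edge is pointless. -/
theorem done_of_touched (h : Growing H k α s B A U Us) (hf : f ∈ edges H) (ht : Touched H s f)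
    (hs : ¬ s.Safe f) (hin : FewInside k α s B f) (hb : ∃ b ∈ B, f ∈ nbrs H b) : Done H s B f := by
  obtain ⟨b, hb, hfb⟩ := hb
  rcases h.touched f hf ht with h1 | h1 | h1 | h1
  · exact absurd h1 hs
  · exact absurd hin h1
  · exact h1
  · exact done_of_quiet h.regB h1 (nbrs_symm (h.regB.edge b hb) hfb) hb

theorem exists_adj (h : Growing H k α s B ∅ U Us) (hf : f ∈ U) : ∃ b ∈ B, f ∈ nbrs H b := by
  obtain ⟨-, -, -, b, hb, h1⟩ := h.memU f hf
  exact ⟨b, by rwa [Finset.union_empty] at hb, h1⟩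

/-- The extension of the component by one of the first two rules. -/
theorem extend (h : Growing H k α s B ∅ U Us) (hp : Params H k α) (hf : f ∈ U)
    (hin : FewInside k α s B f)
    (hev : MeetsTwoDisjointBad H s B f ∨ s.Mono (f \ s.troubledVerts B))
    (hG : Expanded H k α s s' N Un f) : Growing H k α s' (B ∪ N) ∅ (U.erase f ∪ Un) Us := by
  have hexp := h.expand hG.toGrown hG.around
  have hdone := h.done_expanded hG
  rw [Finset.empty_union] at hexp hdone
  obtain ⟨hfe, ⟨hcol, hfb, hsafe⟩, hfx, -⟩ := h.memU f hf
  have hcol' := hG.ext.colored hcol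
  have hfb' : f ∉ s'.bad := fun hb => hfb (hG.ext.bad_det f hfe (Or.inl hcol) hb)
  obtain ⟨b, hb, hbf⟩ := h.exists_adj hf
  have hW : ∃ M ℓ, Witness H k α s' M (B ∪ N) ℓ ∧ 2 ≤ surplus M := by
    rcases N.eq_empty_or_nonempty with rfl | hne
    · rw [Finset.union_empty]
      exact hexp.wit
    -- New bad edges have been found, so `f` is not touched, and its event is not killed.
    have ht : ¬ Touched H s' f := fun ht => hne.ne_empty <|
      h.eq_empty_of_done hG (X := B) Finset.subset_union_left
        (h.done_of_touched hfe (ht.of_ext hG.ext) hsafe hin ⟨b, hb, hbf⟩)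
    obtain ⟨M, ℓ, hW, hs⟩ := hexp.wit
    obtain ⟨M', ℓ', hW', hs', -⟩ := hW.extend hG.inv hp hexp.regA hne hexp.disj hfe hG.gen hb
      (nbrs_symm (h.regB.edge b hb) hbf) (by
        rcases hev with hev | hev
        · obtain ⟨g₁, h₁, g₂, h₂, b₁, b₂, n₁, n₂, hd⟩ := hev.exists_nbrs hfb
          exact Or.inl ⟨g₁, (Finset.mem_union.1 (hdone.2 g₁ h₁ (hG.ext.bad_stays _ b₁))).resolve_left
            n₁, g₂, (Finset.mem_union.1 (hdone.2 g₂ h₂ (hG.ext.bad_stays _ b₂))).resolve_left n₂,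
            h₁, h₂, hd⟩
        · refine Or.inr ⟨hfb', hcol', hG.det, fun g hg hgb =>
            hdone.2 g hg (bad_of_not_touched ht hg hgb), Or.inl ⟨?_, ?_⟩⟩
          · rwa [hG.ext.troubledPart_eq hcol, hG.ext.mono_iff hcol Finset.sdiff_subset,
              ← sdiff_troubledVerts]
          · exact (FewInside.ext_iff hG.ext hcol).2 hin)
    exact ⟨M', ℓ', hW', hs.trans hs'⟩
  refine (hexp.merge hW).replace
    (Finset.union_subset_union_left (Finset.erase_subset _ _)) (fun g hg hg' => ?_)
    fun g hg => Or.inl hg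
  have hgf : g = f := by
    by_contra hne
    rw [Finset.mem_union, Finset.mem_erase] at hg'
    rcases Finset.mem_union.1 hg with h1 | h1
    · exact hg' (Or.inl ⟨hne, h1⟩)
    · exact hg' (Or.inr h1)
  rw [hgf]
  exact Or.inr (Or.inr ⟨hG.det, Or.inl hdone.2⟩)

/-- An unsafe edge that meets neither of the first two rules is put into `Us` or dropped. -/
theorem keep (h : Growing H k α s B ∅ U Us) (hf : f ∈ U) (hin : FewInside k α s B f)
    (hdet : ∀ g ∈ nbrs H f, s.Det g)
    (hev : ¬ (MeetsTwoDisjointBad H s B f ∨ s.Mono (f \ s.troubledVerts B))) :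
    Growing H k α s B ∅ (U.erase f) Us ∧
      (FewOutside k α s B f → Growing H k α s B ∅ (U.erase f) (insert f Us)) := by
  rw [not_or] at hev
  obtain ⟨hfe, ⟨hcol, hfb, hsafe⟩, hfx, -⟩ := h.memU f hf
  have hq : Quiet H s B f := ⟨hdet, Or.inr ⟨clustered_of_not_meetsTwoDisjointBad hev.1, by
    rw [← sdiff_troubledVerts]; exact hev.2⟩⟩
  have hdrop : ∀ g ∈ U, g ∉ U.erase f → s.Safe g ∨ ¬ FewInside k α s B g ∨ Quiet H s B g := by
    intro g hg hg'
    have : g = f := by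
      by_contra hne
      exact hg' (Finset.mem_erase.2 ⟨hne, hg⟩)
    rw [this]
    exact Or.inr (Or.inr hq)
  refine ⟨h.replace (Finset.erase_subset _ _) hdrop fun g hg => Or.inl hg, fun hout =>
    h.replace (Finset.erase_subset _ _) hdrop fun g hg => ?_⟩
  rcases Finset.mem_insert.1 hg with rfl | hg
  · refine Or.inr ⟨hf, h.exists_adj hf, ?_⟩
    by_cases ht : Touched H s g
    · exact Or.inl (h.done_of_touched hfe ht hsafe hin (h.exists_adj hf))
    · exact Or.inr ⟨ht, hsafe, hq, hout⟩
  · exact Or.inl hg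

/-- An edge with many troubled vertices in `V(B)` may be dropped: the final coloring makes it
safe. -/
theorem drop (h : Growing H k α s B A U Us) (hin : ¬ FewInside k α s B f) :
    Growing H k α s B A (U.erase f) Us :=
  h.replace (Finset.erase_subset _ _) (fun g hg hg' => by
    have : g = f := by
      by_contra hne
      exact hg' (Finset.mem_erase.2 ⟨hne, hg⟩)
    rw [this]
    exact Or.inr (Or.inl hin)) fun g hg => Or.inl hg

/-- An unsafe edge that is next to the search area, but not next to the component, is quiet if it is
touched: the other possibilities of `Growing.touched` require an adjacent edge of `B`. -/
theorem quiet_of_touched (h : Growing H k α s B A U Us) (hp : Params H k α) (hf : f ∈ U)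
    (hB : ∀ b ∈ B, f ∉ nbrs H b) (ht : Touched H s f) : Quiet H s ∅ f := by
  obtain ⟨hfe, ⟨hcol, hfb, hsafe⟩, -, a, ha, hfa⟩ := h.memU f hf
  have haB : a ∉ B := fun haB => hB a haB hfa
  have haA := (Finset.mem_union.1 ha).resolve_left haB
  have haf := nbrs_symm (h.regA.edge a haA) hfa
  rcases h.touched f hfe ht with h1 | h1 | h1 | h1
  · exact absurd h1 hsafe
  · refine absurd ?_ h1
    have : s.troubledPart f ∩ verts B = ∅ := by
      refine Finset.eq_empty_of_forall_notMem fun w hw => ?_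
      rw [Finset.mem_inter, Memory.mem_troubledPart, mem_verts] at hw
      obtain ⟨⟨hwf, -⟩, b, hb, hwb⟩ := hw
      exact hB b hb (mem_nbrs_of_mem hfe (by rintro rfl; exact hfb (h.regB.bad f hb).1) hwf hwb)
    unfold FewInside
    rw [this]
    simpa using lt_of_lt_of_le one_pos hp.one_le
  · exact absurd (h1.2 a haf (h.regA.bad a haA)) haB
  · exact h1

end Growing

end Extending

/-! ### The conditional expansion -/

section ConditionalExpansion

variable {V : Type u} [Fintype V] {H : Hypergraph V} {k : ℕ} {α : ℝ} {σ : Schedule V}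
  {s₀ s s' : Memory V} {B A U Us Q N Un : Finset (Finset V)} {f f₀ : Finset V}

/-- The edge `f` may link a component `C` of the search area to further bad edges. These form one
component, because `f` does not meet two disjoint bad edges outside of `C`. -/
def Connector (H : Hypergraph V) (k : ℕ) (α : ℝ) (s : Memory V) (A : Finset (Finset V))
    (f : Finset V) : Prop :=
  ∃ C, Comp H s C ∧ C ⊆ A ∧ (∃ g ∈ C, g ∈ nbrs H f) ∧ MayActivate s C f ∧ FewOutside k α s C f ∧
    Clustered H s C f ∧ ∀ g ∈ nbrs H f, s.Det g

theorem Connector.of_ext {A' : Finset (Finset V)} (h : Connector H k α s A f) (hE : Ext H s s')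
    (hf : s.uncoloredPart f = ∅) (hA : A ⊆ A') : Connector H k α s' A' f := by
  obtain ⟨C, h1, h2, h3, h4, h5, h6, h7⟩ := h
  exact ⟨C, h1.of_ext hE, h2.trans hA, h3, (MayActivate.ext_iff hE hf).2 h4,
    (FewOutside.ext_iff hE hf).2 h5, h6.of_ext hE h7, fun g hg => hE.det (h7 g hg)⟩

/-- The part of the invariant of the conditional expansion that holds at every time. Here `s₀` is the
memory at the beginning of the search, and `apart` says that the unsafe edges found around the
search area are not adjacent to the component `B`, whose neighbours had been explored before. -/
structure Searching (H : Hypergraph V) (k : ℕ) (α : ℝ) (s₀ : Memory V) (B Us : Finset (Finset V))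
    (f₀ : Finset V) (s : Memory V) (A U : Finset (Finset V)) : Prop where
  grow : Growing H k α s B A U Us
  few : FewInside k α s B f₀
  expl : s₀.explored ⊆ s.explored
  count : numUnexplored H s + U.card ≤ numUnexplored H s₀
  apart : ∀ f ∈ U, ∀ b ∈ B, f ∉ nbrs H b

/-- The search area is joined to the component by `f₀`. -/
def Attached (H : Hypergraph V) (s : Memory V) (B A : Finset (Finset V)) (f₀ : Finset V) : Prop :=
  (∃ x ∈ A, x ∈ nbrs H f₀) ∧ Done H s (B ∪ A) f₀

theorem Attached.of_ext {A' : Finset (Finset V)} (h : Attached H s B A f₀) (hE : Ext H s s')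
    (hA : A ⊆ A') : Attached H s' B A' f₀ :=
  ⟨let ⟨x, hx, hxf⟩ := h.1; ⟨x, hA hx, hxf⟩,
    (h.2.of_ext hE).mono (Finset.union_subset_union_right hA)⟩

/-- The part of the invariant that holds as long as the search has not been stopped. The search area
is empty before the first expansion, and remains so if nothing is found via `f₀`; otherwise it is
linked. -/
structure Running (H : Hypergraph V) (k : ℕ) (α : ℝ) (B : Finset (Finset V)) (f₀ : Finset V)
    (s : Memory V) (A U Q : Finset (Finset V)) : Prop where
  quiet : ∀ f ∈ U, (∀ g ∈ nbrs H f, s.Det g) ∧ Clustered H s A f ∧ ¬ s.Mono f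
  not_mono : ∀ a ∈ A, ¬ s.Mono a
  queue : (A = ∅ ∧ Q ⊆ {f₀}) ∨ (Linked H k α s A ∧ Attached H s B A f₀ ∧
    ∀ f ∈ Q, f ∈ U ∧ Connector H k α s A f)

theorem Searching.expand (h : Searching H k α s₀ B Us f₀ s A U) (hf₀ : f₀ ∈ Us)
    (hG : Expanded H k α s s' N Un f) : Searching H k α s₀ B Us f₀ s' (A ∪ N) (U ∪ Un) where
  grow := h.grow.expand hG.toGrown hG.around
  few := (FewInside.ext_iff hG.ext (h.grow.memUs f₀ hf₀).2.1).2 h.few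
  expl := h.expl.trans hG.ext.explored
  count := by
    have h1 := h.count
    have h2 := hG.numUnexplored_le
    have h3 := Finset.card_union_le U Un
    omega
  apart g hg b hb := by
    rcases Finset.mem_union.1 hg with hg | hg
    · exact h.apart g hg b hb
    · exact h.grow.not_adjacent hG.toGrown (Or.inr hg) (Finset.mem_union_left _ hb)

theorem Searching.of_ext (h : Searching H k α s₀ B Us f₀ s A U) (hf₀ : f₀ ∈ Us) (hE : Ext H s s')
    (hI : Inv H k α s') (he : s'.explored = s.explored) :
    Searching H k α s₀ B Us f₀ s' A U where
  grow := h.grow.of_ext hE hI he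
  few := (FewInside.ext_iff hE (h.grow.memUs f₀ hf₀).2.1).2 h.few
  expl := he ▸ h.expl
  count := by
    have := h.count
    unfold numUnexplored at *
    rwa [he]
  apart := h.apart

theorem Running.of_ext (h : Running H k α B f₀ s A U Q) (hg : Growing H k α s B A U Us)
    (hE : Ext H s s') : Running H k α B f₀ s' A U Q where
  quiet f hf := by
    obtain ⟨h1, h2, h3⟩ := h.quiet f hf
    exact ⟨fun g hg => hE.det (h1 g hg), h2.of_ext hE h1, by
      rwa [hE.mono_iff (hg.memU f hf).2.1.1 subset_rfl]⟩
  not_mono a ha := by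
    rw [hE.mono_iff (hg.regA.colored a ha) subset_rfl]
    exact h.not_mono a ha
  queue := h.queue.imp_right fun ⟨h1, h2, h3⟩ => ⟨h1.of_ext hE, h2.of_ext hE subset_rfl,
    fun f hf => ⟨(h3 f hf).1, (h3 f hf).2.of_ext hE (hg.memU f (h3 f hf).1).2.1.1 subset_rfl⟩⟩

/-- The bad edges found from an edge of the queue form one component, which is linked to the
search area. -/
theorem Running.link (hp : Params H k α) (hr : Running H k α B f₀ s A U Q)
    (h : Searching H k α s₀ B Us f₀ s A U) (hf₀ : f₀ ∈ Us) (hf : f ∈ Q)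
    (hG : Expanded H k α s s' N Un f) (hne : N.Nonempty) :
    Comp H s' N ∧ Linked H k α s' (A ∪ N) ∧ Attached H s' B (A ∪ N) f₀ := by
  have hreg := h.grow.region_new hG.toGrown hG.around
  have hdone := h.grow.done_expanded hG
  have hdis := h.grow.disjoint_new hG.toGrown
  obtain ⟨n, hn, hnf⟩ := hG.gen.exists_mem hne
  rcases hr.queue with ⟨rfl, hQ⟩ | ⟨hL, hatt, hQ⟩
  · -- The first expansion, via `f₀`: its bad neighbours outside of `B` intersect pairwise.
    obtain rfl := Finset.mem_singleton.1 (hQ hf)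
    rw [Finset.empty_union] at hdone ⊢
    rw [Finset.union_empty] at hdis
    obtain ⟨-, -, -, -, -, h6⟩ := h.grow.memUs f hf₀
    have hnd : ¬ Done H s B f := fun h6 =>
      hne.ne_empty (h.grow.eq_empty_of_done hG Finset.subset_union_left h6)
    obtain ⟨h7, h8 | ⟨h8, -⟩⟩ := (h6.resolve_left hnd).2.2.1
    · exact absurd ⟨h7, h8⟩ hnd
    have hc := h8.of_ext hG.ext h7
    have hcomp := comp_of_pairwise_meet hreg hne hG.gen fun g₁ h₁ g₂ h₂ m₁ m₂ =>
      hc g₁ m₁ g₂ m₂ (hG.bad g₁ h₁).1 (hG.bad g₂ h₂).1 (Finset.disjoint_right.1 hdis h₁)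
        (Finset.disjoint_right.1 hdis h₂)
    exact ⟨hcomp, .comp hcomp, ⟨n, hn, hnf⟩, hdone⟩
  · obtain ⟨hfU, C, hC, hCA, ⟨c, hcC, hcf⟩, hact, hout, hclu, hdet⟩ := hQ f hf
    obtain ⟨hfe, ⟨hcol, hfb, hsafe⟩, -, -⟩ := h.grow.memU f hfU
    have hNC : ∀ g ∈ N, g ∉ C := fun g hg hgC =>
      Finset.disjoint_right.1 hdis hg (Finset.mem_union_right _ (hCA hgC))
    -- A touched edge would be quiet, and would not lead from `C` to new bad edges.
    have ht : ¬ Touched H s' f := fun ht => hne.ne_empty <|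
      h.grow.eq_empty_of_done hG (X := C) (hCA.trans Finset.subset_union_right)
        (done_of_quiet hC.toRegion
          (h.grow.quiet_of_touched hp hfU (h.apart f hfU) (ht.of_ext hG.ext)) hcf hcC)
    have hc := hclu.of_ext hG.ext hdet
    have hcomp := comp_of_pairwise_meet hreg hne hG.gen fun g₁ h₁ g₂ h₂ m₁ m₂ =>
      hc g₁ m₁ g₂ m₂ (hG.bad g₁ h₁).1 (hG.bad g₂ h₂).1 (hNC g₁ h₁) (hNC g₂ h₂)
    refine ⟨hcomp, .link (hL.of_ext hG.ext) (hC.of_ext hG.ext) hCA hcomp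
      (hdis.mono_left Finset.subset_union_right) hfe
      (fun hb => hfb (hG.ext.bad_det f hfe (Or.inl hcol) hb)) (hG.ext.colored hcol) hG.det
      (fun g hg hgb => ?_) ⟨c, hcC, hcf⟩ ⟨n, hn, hnf⟩ ((MayActivate.ext_iff hG.ext hcol).2 hact)
      ((FewOutside.ext_iff hG.ext hcol).2 hout), hatt.of_ext hG.ext Finset.subset_union_left⟩
    by_cases hgC : g ∈ C
    · exact Finset.mem_union_left _ hgC
    · exact Finset.mem_union_right _ (mem_of_clustered hreg hc hnf hn (hNC n hn) hg
        (bad_of_not_touched ht hg hgb) hgC)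

/-- If no amortizing configuration has been found, then the search goes on. -/
theorem Running.continue (hr : Running H k α B f₀ s A U Q) (hf : f ∈ Q)
    (hg' : Growing H k α s B A U Us) (hE : Ext H s s')
    (hlink : N = ∅ ∨ (Comp H s' N ∧ Linked H k α s' (A ∪ N) ∧ Attached H s' B (A ∪ N) f₀))
    (hN : ∀ g ∈ N, ¬ s'.Mono g) (hUn : ∀ g ∈ Un, (∀ e ∈ nbrs H g, s'.Det e) ∧
      (∃ b ∈ N, g ∈ nbrs H b) ∧ Clustered H s' N g ∧ ¬ s'.Mono g) :
    Running H k α B f₀ s' (A ∪ N) (U ∪ Un)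
      (Q.erase f ∪ Un.filter fun g => MayActivate s' N g ∧ FewOutside k α s' N g) := by
  have hr' := hr.of_ext hg' hE
  refine ⟨fun g hgU => ?_, fun g hgA => ?_, ?_⟩
  · rcases Finset.mem_union.1 hgU with h1 | h1
    · obtain ⟨h2, h3, h4⟩ := hr'.quiet g h1
      exact ⟨h2, h3.mono Finset.subset_union_left, h4⟩
    · obtain ⟨h2, -, h3, h4⟩ := hUn g h1
      exact ⟨h2, h3.mono Finset.subset_union_right, h4⟩
  · rcases Finset.mem_union.1 hgA with h1 | h1
    · exact hr'.not_mono g h1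
    · exact hN g h1
  · rcases hlink with rfl | ⟨hC, hL, hatt⟩
    · have hUn0 : Un = ∅ := Finset.eq_empty_of_forall_notMem fun g hg => by
        obtain ⟨-, ⟨b, hb, -⟩, -⟩ := hUn g hg
        exact absurd hb (Finset.notMem_empty b)
      rw [hUn0, Finset.filter_empty, Finset.union_empty, Finset.union_empty, Finset.union_empty]
      exact hr'.queue.imp (fun ⟨h1, h2⟩ => ⟨h1, (Finset.erase_subset _ _).trans h2⟩)
        fun ⟨h1, h2, h3⟩ => ⟨h1, h2, fun g hg => h3 g (Finset.mem_of_mem_erase hg)⟩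
    · have hnew : ∀ g ∈ Un.filter fun g => MayActivate s' N g ∧ FewOutside k α s' N g,
          g ∈ U ∪ Un ∧ Connector H k α s' (A ∪ N) g := fun g hg => by
        obtain ⟨hgU, h1, h2⟩ := Finset.mem_filter.1 hg
        obtain ⟨h3, ⟨b, hb, hgb⟩, h4, h5⟩ := hUn g hgU
        exact ⟨Finset.mem_union_right _ hgU, N, hC, Finset.subset_union_right,
          ⟨b, hb, nbrs_symm (hC.edge b hb) hgb⟩, h1, h2, h4, h3⟩
      refine Or.inr ⟨hL, hatt, fun g hg => ?_⟩
      rcases Finset.mem_union.1 hg with h1 | h1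
      · rcases hr.queue with ⟨-, hQ⟩ | ⟨-, -, h3⟩
        · have hgf := Finset.mem_erase.1 h1
          exact absurd ((Finset.mem_singleton.1 (hQ hgf.2)).trans
            (Finset.mem_singleton.1 (hQ hf)).symm) hgf.1
        · obtain ⟨h4, h5⟩ := h3 g (Finset.mem_of_mem_erase h1)
          exact ⟨Finset.mem_union_left _ h4,
            h5.of_ext hE (hg'.memU g h4).2.1.1 Finset.subset_union_left⟩
      · exact hnew g h1

/-- The result of a search that has been stopped by an amortizing configuration. Here `A₀` is the
linked part of the search area `A`, and `f₀` connects it with the component `B`. -/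
def Stopped (H : Hypergraph V) (k : ℕ) (α : ℝ) (B : Finset (Finset V)) (f₀ : Finset V)
    (s : Memory V) (A : Finset (Finset V)) : Prop :=
  ∃ A₀, FinalArea H k α s A₀ A ∧ (∃ x ∈ A₀, x ∈ nbrs H f₀) ∧ Done H s (B ∪ A) f₀

/-- The search is stopped successfully after the expansion via an amortizing edge `f`. -/
theorem Searching.stopped {N₂ Un₂ : Finset (Finset V)} (hp : Params H k α)
    (h : Searching H k α s₀ B Us f₀ s (A ∪ N) U) (hf : f ∈ U) (hN : Comp H s N)
    (hL : Linked H k α s (A ∪ N)) (hatt : Attached H s B (A ∪ N) f₀)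
    (hadj : ∃ b ∈ N, f ∈ nbrs H b) (hA : ∀ a ∈ A, f ∉ nbrs H a)
    (hev : s.Mono f ∨ MeetsTwoDisjointBad H s N f) (hG : Expanded H k α s s' N₂ Un₂ f) :
    Stopped H k α B f₀ s' (A ∪ N ∪ N₂) := by
  have hreg := h.grow.region_new hG.toGrown hG.around
  have hdone := h.grow.done_expanded hG
  have hdis := h.grow.disjoint_new hG.toGrown
  obtain ⟨hfe, ⟨hcol, hfb, hsafe⟩, -, -⟩ := h.grow.memU f hf
  obtain ⟨b, hb, hfadj⟩ := hadj
  have hbf := nbrs_symm (hN.edge b hb) hfadj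
  -- A quiet edge has two colors, and does not meet two disjoint bad edges.
  have ht : ¬ Touched H s f := by
    intro ht
    obtain ⟨-, hq⟩ := h.grow.quiet_of_touched hp hf (h.apart f hf) ht
    have hq := hq.resolve_left fun hq => absurd (hq b hbf (hN.bad b hb)) (Finset.notMem_empty b)
    rcases hev with hm | hm
    · exact hq.2 (hm.subset Finset.sdiff_subset)
    · obtain ⟨g₁, h₁, g₂, h₂, b₁, b₂, -, -, hd⟩ := hm.exists_nbrs hfb
      exact hq.1 g₁ h₁ g₂ h₂ b₁ b₂ (Finset.notMem_empty _) (Finset.notMem_empty _) hd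
  have hbad : ∀ g ∈ nbrs H f, s'.Bad g → g ∈ N ∪ N₂ := by
    intro g hg hgb
    have hgf := nbrs_symm hfe hg
    rcases Finset.mem_union.1 (hdone.2 g hg hgb) with h1 | h1
    · exact absurd hgf (h.apart f hf g h1)
    · rw [Finset.union_assoc, Finset.mem_union] at h1
      exact h1.resolve_left fun h1 => hA g h1 hgf
  refine ⟨A ∪ N, .expand (hL.of_ext hG.ext) (hN.of_ext hG.ext) Finset.subset_union_right hreg
    (hdis.mono_left Finset.subset_union_right) hfe
    (fun hb => hfb (hG.ext.bad_det f hfe (Or.inl hcol) hb)) (hG.ext.colored hcol) hG.det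
    (fun g hg hgb => hbad g hg (bad_of_not_touched (fun h => ht (h.of_ext hG.ext)) hg hgb)) hG.gen
    hb hbf ?_, hatt.1, (hatt.of_ext hG.ext Finset.subset_union_left).2⟩
  rcases hev with hm | hm
  · exact Or.inl ((hG.ext.mono_iff hcol subset_rfl).2 hm)
  · obtain ⟨g₁, h₁, g₂, h₂, b₁, b₂, n₁, n₂, hd⟩ := hm.exists_nbrs hfb
    exact Or.inr ⟨g₁, (Finset.mem_union.1 (hbad g₁ h₁ (hG.ext.bad_stays _ b₁))).resolve_left n₁,
      g₂, (Finset.mem_union.1 (hbad g₂ h₂ (hG.ext.bad_stays _ b₂))).resolve_left n₂, h₁, h₂, hd⟩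

/-- The invariant of the conditional expansion via `f₀`. -/
def SearchInv (H : Hypergraph V) (k : ℕ) (α : ℝ) (s₀ : Memory V) (B Us : Finset (Finset V))
    (f₀ : Finset V) (t : Search V) : Prop :=
  Searching H k α s₀ B Us f₀ t.mem t.A t.U ∧
    (t.stopped = false → Running H k α B f₀ t.mem t.A t.U t.Q) ∧
    (t.stopped = true → Stopped H k α B f₀ t.mem t.A)

theorem spec_forEach_determineNbrs (hp : Params H k α) (S : Finset (Finset V)) {a : Area V}
    (hI : Inv H k α a.mem) :
    Spec (fun b : Area V => potential H k α b.mem) (forEach σ S (determineNbrs H k α σ) a)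
      (potential H k α a.mem) fun b =>
        (Inv H k α b.mem ∧ Ext H a.mem b.mem ∧ b.mem.explored = a.mem.explored ∧ b.B = a.B ∧
          b.U = a.U) ∧ ∀ f ∈ S, ∀ g ∈ nbrs H f, b.mem.Det g := by
  refine (spec_forEach (fun R b => (Inv H k α b.mem ∧ Ext H a.mem b.mem ∧
    b.mem.explored = a.mem.explored ∧ b.B = a.B ∧ b.U = a.U) ∧
      ∀ f ∈ S, (∀ g ∈ nbrs H f, b.mem.Det g) ∨ f ∈ R) ?_ ⟨⟨hI, Ext.refl _, rfl, rfl, rfl⟩,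
      fun g hg => Or.inr hg⟩).post ?_
  · rintro R b g hg ⟨⟨hIb, hE, he, hB, hU⟩, hdet⟩
    refine (spec_determineNbrs hp g (a := { b with mem := b.mem.log g }) (hIb.log g)).post ?_
    rintro c ⟨⟨hIc, hEc, hec, hBc, hUc⟩, hgc⟩
    have hE' := (Ext.log b.mem g).trans hEc
    refine ⟨⟨hIc, hE.trans hE', hec.trans he, hBc.trans hB, hUc.trans hU⟩, fun h hh => ?_⟩
    by_cases hhg : h = g
    · exact Or.inl (hhg ▸ hgc)
    · exact (hdet h hh).imp (fun h1 e he => hE'.det (h1 e he))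
        fun hR => Finset.mem_erase.2 ⟨hhg, hR⟩
  · rintro b ⟨h1, h2⟩
    exact ⟨h1, fun g hg => (h2 g hg).resolve_right (Finset.notMem_empty g)⟩

/-- One round of the conditional expansion. If it stops, the amortizing configuration is an edge of the
component found last, or an unsafe edge next to it. -/
theorem spec_searchStep (hp : Params H k α) (hf₀ : f₀ ∈ Us) {t : Search V}
    (ht : SearchInv H k α s₀ B Us f₀ t) (hQ : t.Q.Nonempty) (hst : t.stopped = false) :
    Spec (fun t : Search V => potential H k α t.mem) (searchStep H k α σ t)
      (potential H k α t.mem) (SearchInv H k α s₀ B Us f₀) := by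
  obtain ⟨hS, hR, -⟩ := ht
  replace hR := hR hst
  unfold searchStep
  set f := σ.edge t.mem t.Q with hf
  have hfQ : f ∈ t.Q := σ.edge_mem _ _ hQ
  have hSl := hS.of_ext hf₀ (Ext.log t.mem f) (hS.grow.inv.log f) rfl
  have hRl := hR.of_ext hS.grow (Ext.log t.mem f)
  refine (spec_expandViaUnsafe hp f (a := { mem := t.mem.log f, B := ∅, U := ∅, Q := ∅ })
    (hS.grow.inv.log f) fun g hg => (hS.grow.expl g hg).2.1).bind ?_
  rintro c ⟨N, Un, hG, hN, hUn⟩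
  rw [Finset.empty_union] at hN hUn
  subst hN hUn
  have hSc := hSl.expand hf₀ hG
  have hlink : c.B = ∅ ∨ (Comp H c.mem c.B ∧ Linked H k α c.mem (t.A ∪ c.B) ∧
      Attached H c.mem B (t.A ∪ c.B) f₀) :=
    c.B.eq_empty_or_nonempty.imp_right (hRl.link hp hSl hf₀ hfQ hG)
  have hUadj : ∀ g ∈ c.U, ∃ b ∈ c.B, g ∈ nbrs H b := fun g hg => (hG.unsafe' g hg).2
  split_ifs with he
  · refine Spec.pure ⟨hSc, fun h => absurd h (by simp), fun _ => ?_⟩ le_rfl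
    obtain ⟨g, hg, hm⟩ := he
    obtain ⟨-, hL, hatt⟩ := hlink.resolve_left (Finset.ne_empty_of_mem hg)
    exact ⟨_, .mono hL (Finset.mem_union_right _ hg) hm, hatt.1, hatt.2⟩
  · push Not at he
    refine (spec_forEach_determineNbrs hp c.U
      (a := { mem := c.mem, B := t.A ∪ c.B, U := t.U ∪ c.U, Q := ∅ }) hG.inv).bind ?_
    rintro d ⟨⟨hId, hEd, hed, hBd, hUd⟩, hdet⟩
    dsimp only at hEd hed hBd hUd ⊢
    have hSd := hSc.of_ext hf₀ hEd hId hed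
    have hlinkd : c.B = ∅ ∨ (Comp H d.mem c.B ∧ Linked H k α d.mem (t.A ∪ c.B) ∧
        Attached H d.mem B (t.A ∪ c.B) f₀) := hlink.imp_right fun ⟨h1, h2, h3⟩ =>
      ⟨h1.of_ext hEd, h2.of_ext hEd, h3.of_ext hEd subset_rfl⟩
    split_ifs with ham
    · set g := σ.edge d.mem (c.U.filter fun g => d.mem.Mono g ∨ MeetsTwoDisjointBad H d.mem c.B g)
        with hg
      have hgm := σ.edge_mem d.mem _ ham
      rw [← hg, Finset.mem_filter] at hgm
      obtain ⟨hgU, hev⟩ := hgm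
      have hadj := hUadj g hgU
      obtain ⟨hC, hL, hatt⟩ := hlinkd.resolve_left
        (Finset.ne_empty_of_mem hadj.choose_spec.1)
      have hElog := Ext.log (H := H) d.mem g
      have hSg := hSd.of_ext hf₀ hElog (hId.log g) rfl
      refine (spec_expandViaUnsafe hp g (a := { d with mem := d.mem.log g })
        (hId.log g) fun g hg => (hSd.grow.expl g hg).2.1).map ?_
      rintro a ⟨N₂, Un₂, hG₂, hN₂, hUn₂⟩
      dsimp only at hN₂ hUn₂ hG₂ ⊢
      rw [hBd] at hN₂
      rw [hUd] at hUn₂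
      have hA : ∀ x ∈ t.A, g ∉ nbrs H x := fun x hx hgx =>
        hSl.grow.not_adjacent hG.toGrown (Or.inr hgU) (Finset.mem_union_right _ hx) hgx
      refine ⟨⟨?_, fun h => absurd h (by simp), fun _ => ?_⟩, le_rfl⟩
      · rw [hN₂, hUn₂]
        exact hSg.expand hf₀ hG₂
      · show Stopped H k α B f₀ a.mem a.B
        rw [hN₂]
        exact hSg.stopped hp (Finset.mem_union_right _ hgU) (hC.of_ext hElog) (hL.of_ext hElog)
          (hatt.of_ext hElog subset_rfl) hadj hA hev hG₂
    · refine Spec.pure ⟨?_, fun _ => ?_, fun h => absurd h (by simp)⟩ le_rfl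
      · show Searching H k α s₀ B Us f₀ d.mem d.B d.U
        rw [hBd, hUd]
        exact hSd
      · dsimp only
        rw [hBd, hUd]
        refine hRl.continue hfQ hSl.grow (hG.ext.trans hEd) hlinkd (fun g hg => ?_)
          fun g hg => ?_
        · rw [hEd.mono_iff (hG.bad g hg).2 subset_rfl]
          exact he g hg
        · rw [Finset.not_nonempty_iff_eq_empty, Finset.filter_eq_empty_iff] at ham
          have hg' := ham hg
          rw [not_or] at hg'
          exact ⟨hdet g hg, hUadj g hg, clustered_of_not_meetsTwoDisjointBad hg'.2, hg'.1⟩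

theorem Inv.record (h : Inv H k α s) (C : Finset (Finset V)) : Inv H k α (s.record C) :=
  ⟨h.1, h.2, h.3, h.4, h.5⟩

theorem Ext.record (s : Memory V) (C : Finset (Finset V)) : Ext H s (s.record C) :=
  ⟨fun _ _ => ⟨rfl, rfl⟩, subset_rfl, subset_rfl, fun _ _ _ h => h, fun _ h => h,
    fun _ h _ => h, rfl⟩

/-- A set of bad edges with a witness may be recorded: if it is large, then the potential has
reached the value one before. -/
theorem potential_record_le {C : Finset (Finset V)} (hI : Inv H k α s) (hs : s.failed = false)
    (hC : componentBound H < (C.card : ℝ) → ∃ M ℓ, Witness H k α s M C ℓ ∧ 2 ≤ surplus M) :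
    potential H k α (s.record C) ≤ potential H k α s := by
  by_cases hlarge : componentBound H < (C.card : ℝ)
  · obtain ⟨M, ℓ, hW, h2⟩ := hC hlarge
    have h1 : LargeFound H (s.record C) := ⟨C, List.mem_cons_self, hlarge⟩
    rw [potential, if_pos h1]
    exact hW.one_le_potential hI h2 hlarge hs
  · have h1 : LargeFound H (s.record C) ↔ LargeFound H s := by
      simp [LargeFound, Memory.record, hlarge]
    unfold potential
    simp only [h1]
    exact le_rfl

theorem componentBound_nonneg (H : Hypergraph V) : 0 ≤ componentBound H := by
  unfold componentBound
  refine mul_nonneg (by positivity) ?_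
  rcases (edges H).card.eq_zero_or_pos with h | h
  · simp [h]
  · exact Real.logb_nonneg one_lt_two (by exact_mod_cast h)

/-- The conditional expansion via `f₀` preserves the invariant, and the search area that is recorded
has a witness of its own, whether the search has been successful or not. -/
theorem spec_expandOrAccept (hp : Params H k α) (hg : Growing H k α s B ∅ ∅ Us) (hf₀ : f₀ ∈ Us)
    (hin : FewInside k α s B f₀) :
    Spec (fun b : Area V => potential H k α b.mem) (expandOrAccept H k α σ f₀ s)
      (potential H k α s) fun b => Growing H k α b.mem (B ∪ b.B) ∅ b.U (Us.erase f₀) ∧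
        s.explored ⊆ b.mem.explored ∧
        numUnexplored H b.mem + b.U.card ≤ numUnexplored H s := by
  unfold expandOrAccept
  have hinit : SearchInv H k α s B Us f₀
      { mem := s, A := ∅, U := ∅, Q := {f₀}, stopped := false } :=
    ⟨⟨hg, hin, subset_rfl, le_rfl, by simp⟩, fun _ => ⟨by simp, by simp, Or.inl ⟨rfl, subset_rfl⟩⟩,
      fun h => absurd h (by simp)⟩
  refine (spec_whileLoop (F := fun t : Search V => potential H k α t.mem)
    (I := SearchInv H k α s B Us f₀) (fun t ht hc => spec_searchStep hp hf₀ ht hc.1 hc.2)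
    hinit).map ?_
  rintro t ⟨hS, hR, hT⟩
  have hI := hS.grow.inv
  have hrec := hS.of_ext hf₀ (Ext.record (H := H) t.mem t.A) (hI.record t.A) rfl
  by_cases hst : t.stopped = true
  · simp only [hst, if_true]
    obtain ⟨A₀, hfin, ⟨x, hx, hxf⟩, hdone⟩ := hT hst
    obtain ⟨M, ℓ, hW, hs⟩ := hS.grow.wit
    obtain ⟨h1, h2, h3, h4, ⟨b, hb, h5⟩, h6⟩ := hS.grow.memUs f₀ hf₀
    have hxA := hfin.subset hx
    have hnd : ¬ Done H t.mem B f₀ := fun hd =>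
      Finset.disjoint_right.1 hS.grow.disj hxA (hd.2 x hxf (hfin.region.bad x hxA))
    -- Since `f₀` led to new bad edges, it is neither touched nor safe, and its accepted vertices can
    -- be used to join the trees.
    obtain ⟨h7, h8, -, h9⟩ := h6.resolve_left hnd
    have hjoin := hW.join_finalArea hI hp hs hfin hS.grow.disj h1 h3 h2 hdone.1
      (fun g hg hgb => hdone.2 g hg (bad_of_not_touched h7 hg hgb)) h8 hS.few h9 hb
      (nbrs_symm (hS.grow.regB.edge b hb) h5) hx hxf
    obtain ⟨M', ℓ', hW', hs'⟩ := hjoin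
    refine ⟨⟨(hrec.grow.merge ⟨M', ℓ', hW'.of_ext (Ext.record _ _) (hI.record _), hs'⟩).eraseUs f₀,
      hS.expl, hS.count⟩, potential_record_le hI hS.grow.alive fun _ => ?_⟩
    obtain ⟨M, ℓ, hW, hs, -⟩ := hfin.exists_witness hI hp
    exact ⟨M, ℓ, hW, by omega⟩
  · simp only [hst, Bool.false_eq_true, if_false]
    have hrun := hR (by simpa using hst)
    have hrun' := hrun.of_ext hS.grow (Ext.record (H := H) t.mem t.A)
    refine ⟨⟨?_, hS.expl, ?_⟩, ?_⟩
    · rw [Finset.union_empty]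
      exact (hrec.grow.accept hrun'.quiet hS.apart hrun'.not_mono).eraseUs f₀
    · have := hS.count
      show numUnexplored H t.mem + 0 ≤ _
      omega
    · have hacc := (acceptLike_accept hrec.grow hrun'.not_mono).1.potential_le
        (k := k) (α := α) rfl rfl
      refine le_trans hacc (potential_record_le hI hS.grow.alive fun hlarge => ?_)
      rcases hrun.queue with ⟨h1, -⟩ | ⟨h1, -⟩
      · rw [h1, Finset.card_empty, Nat.cast_zero] at hlarge
        exact absurd hlarge (componentBound_nonneg H).not_gt
      · exact h1.exists_witness hI hp

end ConditionalExpansion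

/-! ### The construction of a final component -/

section Construction

variable {V : Type u} [Fintype V] {H : Hypergraph V} {k : ℕ} {α : ℝ} {σ : Schedule V}
  {s s' : Memory V}

/-- The invariant of the loops of `buildFinalComponent`. -/
def BuildInv (H : Hypergraph V) (k : ℕ) (α : ℝ) (r : Area V × Finset (Finset V)) : Prop :=
  Growing H k α r.1.mem r.1.B ∅ r.1.U r.2

/-- The measure that decreases in both loops of `buildFinalComponent`: an edge of `U` costs one
unexplored edge, and is possibly moved to `Us`. -/
def buildMeasure (H : Hypergraph V) (r : Area V × Finset (Finset V)) : ℕ :=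
  3 * numUnexplored H r.1.mem + 2 * r.1.U.card + r.2.card

theorem numUnexplored_congr (h : s'.explored = s.explored) :
    numUnexplored H s' = numUnexplored H s := by
  unfold numUnexplored
  rw [h]

/-- The treatment of an edge `f` of `U`: the component is extended via `f`, or `f` is kept in `Us`,
or it is dropped. -/
theorem spec_extendStep (hp : Params H k α) {r : Area V × Finset (Finset V)}
    (hr : BuildInv H k α r) (hU : r.1.U.Nonempty) :
    Spec (fun r : Area V × Finset (Finset V) => potential H k α r.1.mem) (extendStep H k α σ r)
      (potential H k α r.1.mem) fun q => BuildInv H k α q ∧ buildMeasure H q < buildMeasure H r := by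
  unfold extendStep
  set f := σ.edge r.1.mem r.1.U with hf
  have hfU : f ∈ r.1.U := σ.edge_mem _ _ hU
  have hcard := Finset.card_erase_add_one hfU
  have hl : Growing H k α (r.1.mem.log f) r.1.B ∅ r.1.U r.2 := Growing.log hr f
  dsimp only
  split_ifs with hin
  · refine (spec_determineNbrs hp f
      (a := { r.1 with mem := r.1.mem.log f, U := r.1.U.erase f }) hl.inv).bind ?_
    rintro b ⟨⟨hIb, hEb, heb, hBb, hUb⟩, hdet⟩
    dsimp only at hEb heb hBb hUb ⊢
    have hb := hl.of_ext hEb hIb heb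
    have hfin : FewInside k α b.mem r.1.B f :=
      (FewInside.ext_iff hEb (hl.memU f hfU).2.1.1).2 hin
    have hnum : numUnexplored H b.mem = numUnexplored H r.1.mem := numUnexplored_congr heb
    rw [hBb]
    split_ifs with hev hout
    · refine (spec_expandViaUnsafe hp f hIb fun g hg => (hb.expl g hg).2.1).map ?_
      rintro c ⟨N, Un, hG, hBc, hUc⟩
      rw [hBb] at hBc
      rw [hUb] at hUc
      refine ⟨⟨?_, ?_⟩, le_rfl⟩
      · unfold BuildInv
        dsimp only
        rw [hBc, hUc]
        exact hb.extend hp hfU hfin hev hG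
      · have h1 := hG.numUnexplored_le
        have h2 := Finset.card_union_le (r.1.U.erase f) Un
        unfold buildMeasure
        dsimp only
        rw [hUc]
        omega
    · refine Spec.pure ⟨?_, ?_⟩ le_rfl
      · unfold BuildInv
        dsimp only
        rw [hBb, hUb]
        exact (hb.keep hfU hfin hdet hev).2 hout
      · have h2 := Finset.card_insert_le f r.2
        unfold buildMeasure
        dsimp only
        rw [hUb]
        omega
    · refine Spec.pure ⟨?_, ?_⟩ le_rfl
      · unfold BuildInv
        dsimp only
        rw [hBb, hUb]
        exact (hb.keep hfU hfin hdet hev).1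
      · unfold buildMeasure
        dsimp only
        rw [hUb]
        omega
  · refine Spec.pure ⟨hl.drop hin, ?_⟩ le_rfl
    have hnum : numUnexplored H (r.1.mem.log f) = numUnexplored H r.1.mem := rfl
    unfold buildMeasure
    dsimp only
    omega

/-- One round of the main loop: the inner loop empties `U`, and then one edge of `Us` is removed. -/
theorem spec_buildStep (hp : Params H k α) {r : Area V × Finset (Finset V)}
    (hr : BuildInv H k α r) (hc : r.1.U.Nonempty ∨ r.2.Nonempty) :
    Spec (fun r : Area V × Finset (Finset V) => potential H k α r.1.mem) (buildStep H k α σ r)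
      (potential H k α r.1.mem) fun q => BuildInv H k α q ∧ buildMeasure H q < buildMeasure H r := by
  unfold buildStep
  refine (spec_whileLoop_of_measure
    (F := fun r : Area V × Finset (Finset V) => potential H k α r.1.mem)
    (I := fun q => BuildInv H k α q ∧ (q = r ∨ buildMeasure H q < buildMeasure H r))
    (buildMeasure H) (fun q hq hU => (spec_extendStep hp hq.1 hU).post fun y hy =>
      ⟨⟨hy.1, Or.inr ?_⟩, hy.2⟩) ⟨hr, Or.inl rfl⟩).bind ?_
  · rcases hq.2 with h | h
    · exact h ▸ hy.2
    · exact hy.2.trans h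
  · rintro q ⟨⟨hq, hm⟩, hU⟩
    replace hU : q.1.U = ∅ := Finset.not_nonempty_iff_eq_empty.1 hU
    have hle : buildMeasure H q ≤ buildMeasure H r := hm.elim (fun h => h ▸ le_rfl) le_of_lt
    split_ifs with hUs
    · set f := σ.edge q.1.mem q.2 with hf
      have hfUs : f ∈ q.2 := σ.edge_mem _ _ hUs
      have hcard := Finset.card_erase_add_one hfUs
      have hl : Growing H k α (q.1.mem.log f) q.1.B ∅ q.1.U q.2 := Growing.log hq f
      dsimp only
      split_ifs with hin
      · have hl' := hl
        rw [hU] at hl'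
        refine (spec_expandOrAccept hp hl' hfUs hin).map ?_
        rintro b ⟨hb, -, hnum⟩
        refine ⟨⟨?_, lt_of_lt_of_le ?_ hle⟩, le_rfl⟩
        · unfold BuildInv
          dsimp only
          rw [hU, Finset.empty_union]
          exact hb
        · have hnum' : numUnexplored H (q.1.mem.log f) = numUnexplored H q.1.mem := rfl
          unfold buildMeasure
          dsimp only
          rw [hU, Finset.empty_union, Finset.card_empty]
          omega
      · refine Spec.pure ⟨hl.eraseUs f, lt_of_lt_of_le ?_ hle⟩ le_rfl
        have hnum : numUnexplored H (q.1.mem.log f) = numUnexplored H q.1.mem := rfl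
        unfold buildMeasure
        dsimp only
        omega
    · -- If `Us` is empty, too, then the inner loop has been executed at least once.
      refine Spec.pure ⟨hq, hm.resolve_left ?_⟩ le_rfl
      rintro rfl
      rw [hU] at hc
      exact hc.elim Finset.not_nonempty_empty hUs

/-- The invariant between two queries: each edge next to a bad edge that has become safe is safe
itself, or will not be treated any more. -/
structure Idle (H : Hypergraph V) (k : ℕ) (α : ℝ) (s : Memory V) : Prop where
  inv : Inv H k α s
  touched : ∀ f ∈ edges H, Touched H s f → s.Safe f ∨ Quiet H s ∅ f

theorem Idle.of_ext (h : Idle H k α s) (hE : Ext H s s') (hI : Inv H k α s') :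
    Idle H k α s' where
  inv := hI
  touched f hf ht := by
    have ht' := ht.of_ext hE
    rcases ht'.det h.inv hf with hcol | hs
    · exact (h.touched f hf ht').imp hE.safe fun h1 => h1.of_ext hE hcol
    · exact Or.inl (hE.safe hs)

/-- The exploration of the first component of bad edges establishes the invariant. The edges that have
been touched in earlier queries are safe or quiet by `Idle`. -/
theorem growing_of_expandInv (hp : Params H k α) (hs : Idle H k α s) (hal : s.failed = false)
    (hex : s.explored = ∅) {e : Finset V} {a : Area V} (hbad : a.mem.Bad e)
    (he : e ∈ a.mem.explored) (ha : ExpandInv H k α s ∅ ∅ {e} a) (hQ : a.Q = ∅) :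
    Growing H k α a.mem a.B ∅ a.U ∅ := by
  obtain ⟨N, Un, hG, hBQ, -, hUn, hN⟩ := ha
  rw [hQ, Finset.union_empty, Finset.empty_union] at hBQ
  rw [Finset.empty_union] at hUn
  have hn : ∀ b ∈ N, ∀ g ∈ nbrs H b, g ∈ a.mem.explored := fun b hb =>
    (hN b hb).resolve_left (by simp [hQ])
  rw [hBQ, hUn]
  have hold : ∀ g, g ∉ s.explored := by simp [hex]
  have hexp : ∀ g ∈ a.mem.explored, g ∈ edges H ∧ a.mem.Det g ∧
      (g ∈ N ∨ g ∈ Un ∨ a.mem.Safe g) := fun g hg => (hG.expl g hg).resolve_left (hold g)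
  have hreg : Region H a.mem N := hG.region hn fun g hg => absurd hg (hold g)
  have heN : e ∈ N := by
    rcases (hexp e he).2.2 with h | h | h
    · exact h
    · exact absurd hbad.1 (hG.unsafe' e h).1.2.1
    · exact absurd h hbad.2
  have hcomp : Comp H a.mem N := by
    refine comp_of_pairwise_meet hreg ⟨e, heN⟩ hG.gen fun g₁ _ g₂ _ h₁ h₂ => ?_
    rw [Set.mem_singleton_iff] at h₁ h₂
    obtain ⟨w, hw, -⟩ := hG.inv.not_accepted e hbad
    rw [h₁, h₂, Finset.not_disjoint_iff]
    exact ⟨w, hw, hw⟩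
  have hidle := hs.of_ext hG.ext hG.inv
  refine ⟨hG.inv, hG.ext.failed.trans hal, hreg, ⟨by simp, by simp, by simp, by simp, by simp⟩,
    Finset.disjoint_empty_right _, fun b hb => ?_, fun g hg => ?_, fun f hf ht => ?_,
    fun f hf => ?_, fun f hf => ?_, by simp, (Linked.comp hcomp).exists_witness hG.inv hp⟩
  · rw [Finset.union_empty] at hb
    exact ⟨(hG.fresh b (Or.inl hb)).2.1, hn b hb⟩
  · obtain ⟨h1, h2, h3⟩ := hexp g hg
    rw [Finset.union_empty]
    refine ⟨h1, h2, fun hb => ?_⟩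
    rcases h3 with h | h | h
    · exact h
    · exact absurd hb.1 (hG.unsafe' g h).1.2.1
    · exact absurd h hb.2
  · exact (hidle.touched f hf ht).imp_right fun h => Or.inr (Or.inr h)
  · rw [Finset.union_empty]
    exact (hexp f hf).2.2.imp_right fun h => h.imp_right Or.inl
  · obtain ⟨h1, h2, -⟩ := hG.fresh f (Or.inr hf)
    obtain ⟨h3, b, hb, h4⟩ := hG.unsafe' f hf
    exact ⟨h1, h3, h2, b, by rwa [Finset.union_empty], h4⟩

/-- The construction of a final component terminates with empty sets `U` and `Us`, and when the
component is recorded, it is covered by the witness in the invariant. -/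
theorem spec_buildFinalComponent (hp : Params H k α) (hs : Idle H k α s) (hal : s.failed = false)
    {v : V} (hv : s.status v = Status.troubled) :
    Spec (fun a : Area V => potential H k α a.mem) (buildFinalComponent H k α σ v s)
      (potential H k α s) fun a => Growing H k α a.mem a.B ∅ ∅ ∅ := by
  unfold buildFinalComponent
  have hne : ((edges H).filter fun e => v ∈ e ∧ s.Bad e).Nonempty := by
    obtain ⟨g, hg, hvg, hb⟩ := hs.inv.troubled v hv
    exact ⟨g, Finset.mem_filter.2 ⟨hg, hvg, hb⟩⟩
  set e := σ.edge s ((edges H).filter fun e => v ∈ e ∧ s.Bad e) with he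
  have hemem := σ.edge_mem s _ hne
  rw [← he, Finset.mem_filter] at hemem
  obtain ⟨heH, hve, heb⟩ := hemem
  -- The flags of the previous query are removed.
  set sb : Memory V := { s.log e with explored := ∅ } with hsb
  have hIb : Inv H k α sb := ⟨hs.inv.1, hs.inv.2, hs.inv.3, hs.inv.4, hs.inv.5⟩
  have hidle : Idle H k α sb := ⟨hIb, hs.touched⟩
  have hI0 : Inv H k α { s.log e with explored := {e} } :=
    ⟨hs.inv.1, hs.inv.2, hs.inv.3, hs.inv.4, hs.inv.5⟩
  have hE0 : Ext H sb { s.log e with explored := {e} } :=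
    ⟨fun _ _ => ⟨rfl, rfl⟩, subset_rfl, Finset.empty_subset _, fun _ _ _ h => h, fun _ h => h,
      fun _ h _ => h, rfl⟩
  refine (spec_determine hp e hI0).bind ?_
  rintro s₁ ⟨hI₁, hE₁, he₁, hdet⟩
  have hE := hE0.trans hE₁
  have heb₁ : s₁.Bad e := hE.bad_stays e heb
  have he₁' : s₁.explored = {e} := he₁
  have hG : Grown H k α sb s₁ {e} ∅ {e} :=
    (Grown.refl hIb {e}).step (g := e) hE hI₁ (fun g => by
        rw [Finset.mem_singleton]
        simp [heb₁])
      (fun g => by simp) heH (Finset.notMem_empty e) (by rw [he₁']; rfl) hdet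
      (Or.inl (Set.mem_singleton e)) (fun h => absurd heb₁.1 h.2.1)
  refine (spec_expandBadComp hp (s₀ := sb) (B₀ := ∅) (U₀ := ∅) (S := {e})
    (a := { mem := s₁, B := ∅, U := ∅, Q := ∅ }) ⟨{e}, ∅, hG, rfl, subset_rfl, rfl,
      fun b hb => Or.inl hb⟩).bind ?_
  rintro a ⟨ha, hEa, hQa⟩
  have hgrow := growing_of_expandInv hp hidle hal rfl (hEa.bad_stays e heb₁)
    (hEa.explored (show e ∈ s₁.explored by rw [he₁']; exact Finset.mem_singleton_self e)) ha hQa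
  refine (spec_whileLoop_of_measure
    (F := fun r : Area V × Finset (Finset V) => potential H k α r.1.mem)
    (I := BuildInv H k α) (buildMeasure H)
    (fun q hq hc => spec_buildStep hp hq hc) (x := (a, ∅)) hgrow).map ?_
  rintro r ⟨hr, hc⟩
  push Not at hc
  obtain ⟨hU, hUs⟩ := hc
  have hr' : Growing H k α r.1.mem r.1.B ∅ ∅ ∅ := by
    unfold BuildInv at hr
    rwa [hU, hUs] at hr
  exact ⟨hr'.of_ext (Ext.record _ _) (hr'.inv.record _) rfl,
    potential_record_le hr'.inv hr'.alive fun _ => hr'.wit⟩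

end Construction

/-! ### The coloring of a final component, and the queries -/

section Coloring

variable {V : Type u} [Fintype V] {H : Hypergraph V} {k : ℕ} {α : ℝ} {σ : Schedule V}
  {s s' t : Memory V} {W : Finset V} {B F : Finset (Finset V)}

/-- The memory `t` arises from `s` by changing the colors of some vertices of `W`. -/
structure Recolored (W : Finset V) (s t : Memory V) : Prop where
  status : t.status = s.status
  bad : t.bad = s.bad
  found : t.found = s.found
  failed : t.failed = s.failed
  color : ∀ v, v ∉ W → t.color v = s.color v

theorem Recolored.refl (W : Finset V) (s : Memory V) : Recolored W s s :=
  ⟨rfl, rfl, rfl, rfl, fun _ _ => rfl⟩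

theorem Recolored.trans {t' : Memory V} (h : Recolored W s t) (h' : Recolored W t t') :
    Recolored W s t' :=
  ⟨h'.status.trans h.status, h'.bad.trans h.bad, h'.found.trans h.found, h'.failed.trans h.failed,
    fun v hv => (h'.color v hv).trans (h.color v hv)⟩

theorem recolored_of_mem_support {W' : Finset V} (hW : W' ⊆ W)
    (ht : t ∈ (recolor W' s).support) : Recolored W s t := by
  unfold recolor at ht
  obtain ⟨c, -, rfl⟩ := (PMF.mem_support_map_iff _ _ _).1 ht
  exact ⟨rfl, rfl, rfl, rfl, fun v hv => if_neg fun h => hv (hW h)⟩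

theorem resample_support (hF : ∀ f ∈ F, f ⊆ W) (n : ℕ) :
    ∀ s : Memory V, ∀ y ∈ (resample σ W F n s).support,
      (∃ t, y = Sum.inr t ∧ Recolored W s t) ∨
      ∃ t, y = Sum.inl (t.accept W) ∧ Recolored W s t ∧ ∀ f ∈ F, ¬ t.Mono f := by
  induction n with
  | zero =>
    intro s y hy
    rw [resample, PMF.mem_support_pure_iff] at hy
    exact Or.inl ⟨s, hy, Recolored.refl W s⟩
  | succ n ih =>
    intro s y hy
    rw [resample] at hy
    split_ifs at hy with hne
    · obtain ⟨t, ht, hy⟩ := (PMF.mem_support_bind_iff _ _ _).1 hy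
      have hmem := σ.edge_mem s _ hne
      have hlog : Recolored W s (s.log (σ.edge s (F.filter fun f => s.Mono f))) :=
        ⟨rfl, rfl, rfl, rfl, fun _ _ => rfl⟩
      have hst := hlog.trans (recolored_of_mem_support (hF _ (Finset.mem_filter.1 hmem).1) ht)
      rcases ih t y hy with ⟨u, rfl, hu⟩ | ⟨u, rfl, hu, hm⟩
      · exact Or.inl ⟨u, rfl, hst.trans hu⟩
      · exact Or.inr ⟨u, rfl, hst.trans hu, hm⟩
    · rw [PMF.mem_support_pure_iff] at hy
      refine Or.inr ⟨s, hy, Recolored.refl W s, fun f hf hm => hne ⟨f, ?_⟩⟩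
      exact Finset.mem_filter.2 ⟨hf, hm⟩

/-- The outcomes of the coloring phase: it fails, or all members of `F` have got two colors. Nothing
is needed about the probabilities of these outcomes. -/
theorem resampleTrials_support (hF : ∀ f ∈ F, f ⊆ W) (m n : ℕ) :
    ∀ s : Memory V, ∀ y ∈ (resampleTrials σ W F m n s).support,
      (y.failed = true ∧ y.found = s.found) ∨
      ∃ t, y = t.accept W ∧ Recolored W s t ∧ ∀ f ∈ F, ¬ t.Mono f := by
  induction n with
  | zero =>
    intro s y hy
    rw [resampleTrials, PMF.mem_support_pure_iff] at hy
    exact Or.inl ⟨by rw [hy], by rw [hy]⟩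
  | succ n ih =>
    intro s y hy
    rw [resampleTrials] at hy
    obtain ⟨s₁, h₁, hy⟩ := (PMF.mem_support_bind_iff _ _ _).1 hy
    obtain ⟨z, hz, hy⟩ := (PMF.mem_support_bind_iff _ _ _).1 hy
    have hs₁ : Recolored W s s₁ :=
      recolored_of_mem_support subset_rfl h₁
    rcases resample_support hF m s₁ z hz with ⟨t, rfl, ht⟩ | ⟨t, rfl, ht, hm⟩
    · rcases ih t y hy with ⟨h1, h2⟩ | ⟨u, h1, h2, h3⟩
      · exact Or.inl ⟨h1, h2.trans (ht.found.trans hs₁.found)⟩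
      · exact Or.inr ⟨u, h1, (hs₁.trans ht).trans h2, h3⟩
    · rw [PMF.mem_support_pure_iff] at hy
      exact Or.inr ⟨t, hy, hs₁.trans ht, hm⟩

/-- After a successful coloring of a final component, the invariant holds, and the potential has
not increased. -/
theorem Growing.color (hp : Params H k α) (h : Growing H k α s B ∅ ∅ ∅)
    (ht : Recolored (s.troubledVerts B) s t)
    (hB : ∀ g ∈ B, (g ∩ s.troubledVerts B).Nonempty → ¬ t.Mono (g ∩ s.troubledVerts B))
    (hU : ∀ f ∈ edges H, s.Unsafe f → α * k ≤ ((f ∩ s.troubledVerts B).card : ℝ) →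
      ¬ t.Mono (f ∩ s.troubledVerts B)) :
    Idle H k α (t.accept (s.troubledVerts B)) ∧
      potential H k α (t.accept (s.troubledVerts B)) ≤ potential H k α s := by
  set W := s.troubledVerts B with hW
  set s' := t.accept W with hs'
  have hI := h.inv
  have hsafe_of : ∀ f, ¬ t.Mono (f ∩ W) → s'.Safe f := fun f hm =>
    safe_of_not_mono (s := s') (W := f ∩ W) Finset.inter_subset_left
      (fun w hw => if_pos (Finset.mem_inter.1 hw).2) hm
  have hsafe : ∀ g ∈ B, s'.Safe g := by
    intro g hg
    refine hsafe_of g (hB g hg ?_)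
    obtain ⟨w, hw, hwa⟩ := hI.not_accepted g (h.regB.bad g hg)
    refine ⟨w, Finset.mem_inter.2 ⟨hw, mem_troubledVerts.2 ⟨?_, g, hg, hw⟩⟩⟩
    have := Memory.uncoloredPart_eq_empty.1 (h.regB.colored g hg) w hw
    cases hst : s.status w
    · exact absurd hst this
    · exact absurd hst hwa
    · rfl
  have hAL : AcceptLike H W s s' := by
    refine ⟨fun w hw => (mem_troubledVerts.1 hw).1, fun v => ?_, ht.color, ht.bad,
      fun f hf hm => h.det_of_meets Finset.subset_union_left hf hm, fun w hw => ?_⟩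
    · show (if v ∈ W then Status.accepted else t.status v) = _
      rw [ht.status]
    · obtain ⟨-, b, hb, hwb⟩ := mem_troubledVerts.1 hw
      exact ⟨b, (h.regB.bad b hb).1, hwb, hsafe b hb⟩
  have hdone : ∀ f, Done H s B f → Quiet H s' ∅ f := fun f hd =>
    ⟨fun g hg => hAL.det_of (hd.1 g hg), Or.inl
      (hAL.done hI h.regB hsafe (B' := ∅) hd fun b hb hb' => absurd hb hb').2⟩
  -- The edges with many troubled vertices in `W` are unsafe edges whose coloring is part of the
  -- resampling instance, if they are neither safe nor bad.
  have hinside : ∀ f ∈ edges H, s.Det f → ¬ FewInside k α s B f → s'.Safe f := by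
    intro f hf hd hin
    rcases hd with hcol | hs
    · by_cases hsf : s.Safe f
      · exact hAL.safe hsf
      have hcard : α * k ≤ ((f ∩ W).card : ℝ) := by
        rw [hW, inter_troubledVerts]
        exact not_lt.1 hin
      by_cases hfb : f ∈ s.bad
      · have hpos : 0 < (f ∩ W).card := by
          have h1 : (0 : ℝ) < ((f ∩ W).card : ℝ) := by linarith [hp.one_le]
          exact_mod_cast h1
        obtain ⟨w, hw⟩ := Finset.card_pos.1 hpos
        obtain ⟨hwf, hwW⟩ := Finset.mem_inter.1 hw
        obtain ⟨-, b, hb, hwb⟩ := mem_troubledVerts.1 hwW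
        exact hsafe f (h.regB.mem_of_meets hb hfb hf (meets_of_mem hwf hwb))
      · exact hsafe_of f (hU f hf ⟨hcol, hfb, hsf⟩ hcard)
    · exact hAL.safe hs
  refine ⟨⟨hAL.inv hI h.regB hsafe, fun f hf htf => ?_⟩, hAL.potential_le ht.found ht.failed⟩
  by_cases hadj : ∃ b ∈ B, b ∈ nbrs H f
  · obtain ⟨b, hb, hbf⟩ := hadj
    have hfx := (h.around b (Finset.mem_union_left _ hb)).2 f (nbrs_symm hf hbf)
    rcases h.rest f hfx with h1 | h1 | h1 | h1 | ⟨h1, h2⟩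
    · rw [Finset.union_empty] at h1
      exact Or.inl (hsafe f h1)
    · exact absurd h1 (Finset.notMem_empty f)
    · exact Or.inl (hAL.safe h1)
    · exact Or.inl (hinside f hf (h.expl f hfx).2.1 h1)
    · refine Or.inr ?_
      rcases h2 with h2 | ⟨h2, h3⟩
      · exact hdone f ⟨h1, h2⟩
      · refine ⟨fun g hg => hAL.det_of (h1 g hg), Or.inr
          ⟨hAL.clustered hI h.regB hsafe (B' := ∅) h2 fun b hb hb' => absurd hb hb', fun hm => ?_⟩⟩
        rw [← sdiff_troubledVerts] at h3
        refine h3 ((hAL.mono_iff fun w hw => (Finset.mem_sdiff.1 hw).2).1 (hm.subset ?_))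
        simp [verts]
  · have htf' := (hAL.touched hI h.regB hsafe htf).resolve_right hadj
    rcases h.touched f hf htf' with h1 | h1 | h1 | h1
    · exact Or.inl (hAL.safe h1)
    · exact Or.inl (hinside f hf (htf'.det hI hf) h1)
    · exact Or.inr (hdone f h1)
    · by_cases hfB : f ∈ B
      · exact Or.inl (hsafe f hfB)
      have hfW : ∀ w ∈ f, w ∉ W := notMem_troubledVerts fun b hb hm => hadj
        ⟨b, hb, mem_nbrs_of_meets (h.regB.edge b hb) (by rintro rfl; exact hfB hb) hm⟩
      obtain ⟨h2, h3 | ⟨h3, h4⟩⟩ := h1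
      · exact Or.inr (hdone f ⟨h2, fun g hg hb => absurd (h3 g hg hb) (Finset.notMem_empty g)⟩)
      · refine Or.inr ⟨fun g hg => hAL.det_of (h2 g hg), Or.inr
          ⟨hAL.clustered hI h.regB hsafe (B' := ∅) h3 fun b hb _ => hb, fun hm => h4 ?_⟩⟩
        rw [hAL.mono_iff fun w hw => hfW w (Finset.mem_sdiff.1 hw).1] at hm
        simpa [verts] using hm

/-- After a failure, nothing is recorded any more. -/
theorem potential_of_failed (hf : s'.failed = true) (hfound : s'.found = s.found) :
    potential H k α s' ≤ potential H k α s := by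
  have h1 : LargeFound H s' ↔ LargeFound H s := by rw [LargeFound, LargeFound, hfound]
  unfold potential
  simp only [h1, hf, if_true]
  split_ifs
  · exact le_rfl
  · exact le_rfl
  · exact zero_le

theorem spec_colorFinalComponent (hp : Params H k α) (h : Growing H k α s B ∅ ∅ ∅) :
    Spec (potential H k α) (colorFinalComponent H k α σ B s) (potential H k α s) fun s' =>
      s'.failed = true ∨ Idle H k α s' := by
  refine Spec.of_support fun y hy => ?_
  unfold colorFinalComponent at hy
  have hW : ∀ f ∈ ((B ∪ (edges H).filter fun f => s.Unsafe f ∧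
      α * k ≤ ((f ∩ s.troubledVerts B).card : ℝ)).image fun f => f ∩ s.troubledVerts B).filter
        fun f => f.Nonempty, f ⊆ s.troubledVerts B := fun f hf => by
    obtain ⟨g, -, rfl⟩ := Finset.mem_image.1 (Finset.mem_filter.1 hf).1
    exact Finset.inter_subset_right
  rcases resampleTrials_support hW _ _ _ y hy with ⟨h1, h2⟩ | ⟨t, rfl, ht, hm⟩
  · exact ⟨Or.inl h1, potential_of_failed h1 h2⟩
  · have := h.color hp ht (fun g hg hne => hm _ ?_) fun f hf hu hc => hm _ ?_
    · exact ⟨Or.inr this.1, this.2⟩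
    · exact Finset.mem_filter.2 ⟨Finset.mem_image_of_mem (fun f => f ∩ s.troubledVerts B)
        (Finset.mem_union_left _ hg), hne⟩
    · refine Finset.mem_filter.2 ⟨Finset.mem_image_of_mem (fun f => f ∩ s.troubledVerts B)
        (Finset.mem_union_right _ (Finset.mem_filter.2 ⟨hf, hu, hc⟩)), ?_⟩
      have h1 : (0 : ℝ) < ((f ∩ s.troubledVerts B).card : ℝ) := by linarith [hp.one_le]
      exact Finset.card_pos.1 (by exact_mod_cast h1)

/-- A query leads to a failure or to a memory that satisfies the invariant again; the expected
potential does not increase. -/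
theorem spec_query (hp : Params H k α) (v : V) (hs : s.failed = true ∨ Idle H k α s) :
    Spec (potential H k α) (query H k α σ v s) (potential H k α s) fun s' =>
      s'.failed = true ∨ Idle H k α s' := by
  unfold query
  split_ifs with hf hu
  · exact Spec.pure hs le_rfl
  all_goals
    have hid : Idle H k α s := hs.resolve_left hf
    have hal : s.failed = false := by simpa using hf
    have hrest : ∀ s₁ : Memory V, Idle H k α s₁ → s₁.failed = false →
        Spec (potential H k α) (if s₁.status v = Status.troubled then
          (buildFinalComponent H k α σ v s₁).bind fun a =>
            colorFinalComponent H k α σ a.B a.mem else PMF.pure s₁) (potential H k α s₁) fun s' =>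
          s'.failed = true ∨ Idle H k α s' := by
      intro s₁ h₁ ha₁
      split_ifs with hv
      · exact (spec_buildFinalComponent hp h₁ ha₁ hv).bind fun a ha =>
          spec_colorFinalComponent hp ha
      · exact Spec.pure (Or.inr h₁) le_rfl
  · refine (spec_processVertex hp hid.inv hu).bind fun s₁ hs₁ => ?_
    exact hrest s₁ (hid.of_ext hs₁.2.1 hs₁.1) (hs₁.2.1.failed.trans hal)
  · rw [PMF.pure_bind]
    exact hrest s hid hal

/-- The potential is a supermartingale during the whole sequence of queries. -/
theorem spec_run (hp : Params H k α) (vs : List V) :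
    ∀ s : Memory V, s.failed = true ∨ Idle H k α s →
      Spec (potential H k α) (run H k α σ vs s) (potential H k α s) fun _ => True := by
  induction vs with
  | nil => exact fun s _ => Spec.pure trivial le_rfl
  | cons v vs ih => exact fun s hs => (spec_query hp v hs).bind ih

theorem idle_initial (hp : Params H k α) : Idle H k α (Memory.initial V) where
  inv := by
    refine ⟨by simp [Memory.initial], fun w hw => by simp [Memory.initial] at hw,
      by simp [Memory.initial], fun g _ _ _ => ?_, fun g hg => ?_⟩
    · have h1 : (Memory.initial V).acceptedPart g = ∅ := by
        simp [Memory.acceptedPart, Memory.initial]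
      rw [h1, Finset.card_empty, Nat.cast_zero]
      have := hp.one_le
      have h3 := hp.le_third
      have hk : (0 : ℝ) < k := by
        rcases Nat.eq_zero_or_pos k with h0 | h0
        · rw [h0] at this
          norm_num at this
        · exact_mod_cast h0
      exact mul_pos (by linarith) hk
    · exact absurd hg.1 (by simp [Memory.initial])
  touched f hf ht := by
    obtain ⟨g, -, hb, -⟩ := ht
    simp [Memory.initial] at hb

end Coloring

/-! ### The initial potential -/

section InitialPotential

variable {V : Type u} [Fintype V] {H : Hypergraph V} {k : ℕ} {α : ℝ}

/-- The initial probability bound of an event: `thr` given vertices get only one color. -/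
def Kind.prob (k : ℕ) (α : ℝ) (κ : Kind) : ℝ≥0∞ := 2⁻¹ ^ (κ.thr k α - 1)

theorem phiReq_initial_le (e : Finset V) (t : ℕ) (T : Set (Finset V)) :
    phiReq e t T (Memory.initial V) ≤ 2⁻¹ ^ (t - 1) := by
  have h : required e T (Memory.initial V) = ∅ := by
    ext w
    simp [mem_required, Memory.initial]
  unfold phiReq
  split_ifs
  · exact zero_le
  · rw [h]
    exact le_rfl

theorem nodePhi_initial_le (M : Multiset (Node V)) (n : Node V) :
    nodePhi k α M (Memory.initial V) n ≤ n.kind.prob k α := by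
  obtain ⟨e, κ, l⟩ := n
  cases κ
  · exact le_of_eq (pow_zero _).symm
  · have h : (Memory.initial V).acceptedPart e = ∅ := by
      simp [Memory.acceptedPart, Memory.initial]
    show phiBad k α e (Memory.initial V) ≤ _
    unfold phiBad
    split_ifs with h1
    · simp [Memory.initial] at h1
    · exact zero_le
    · rw [h]
      exact le_rfl
  all_goals exact phiReq_initial_le _ _ _

/-- The base `2 ^ (k / 3) / 8` of the weights of the nodes: one unit of credit is worth this factor.
The bound on `Δ` says that it is at least `24 Δ`, and the factor `1 / 8` makes the weights of the
nodes with credit small. -/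
def base (k : ℕ) : ℝ := (2 : ℝ) ^ ((k : ℝ) / 3) / 8

theorem base_pos (k : ℕ) : 0 < base k := by unfold base; positivity

/-- The weight of a node in the generating function: its probability times a power of the base;
covering nodes have an additional factor 2. The denominator 24 makes the sum of the weights small. It
is compensated by the numerators of the factors `24 / base k` of the edges. -/
def nodeWeight (k : ℕ) (α : ℝ) (κ : Kind) : ℝ :=
  (if κ.IsCover then 2 else 1) * (1 / 2) ^ (κ.thr k α - 1) * base k ^ κ.credit / 24

/-- The probability of an event with credit `c` compensates for the factor `base k ^ c`. -/
theorem half_pow_mul_base_pow_le {n c : ℕ} {x : ℝ} (hx : x ≤ n) (hc : c * ((k : ℝ) / 3) ≤ x) :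
    (1 / 2 : ℝ) ^ (n - 1) * base k ^ c ≤ 2 / 8 ^ c := by
  have h1 : (1 / 2 : ℝ) ^ (n - 1) = (2 : ℝ) ^ (-((n - 1 : ℕ) : ℝ)) := by
    rw [Real.rpow_neg two_pos.le, Real.rpow_natCast, one_div, inv_pow]
  have h2 : base k ^ c = (2 : ℝ) ^ ((k : ℝ) / 3 * c) / 8 ^ c := by
    rw [base, div_pow, ← Real.rpow_natCast (2 ^ ((k : ℝ) / 3)), ← Real.rpow_mul two_pos.le]
  have h3 : (n : ℝ) - 1 ≤ ((n - 1 : ℕ) : ℝ) := by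
    have : n ≤ (n - 1) + 1 := by omega
    have : (n : ℝ) ≤ ((n - 1 : ℕ) : ℝ) + 1 := by exact_mod_cast this
    linarith
  rw [h1, h2, ← mul_div_assoc, ← Real.rpow_add two_pos]
  gcongr
  calc (2 : ℝ) ^ (-((n - 1 : ℕ) : ℝ) + (k : ℝ) / 3 * c) ≤ (2 : ℝ) ^ (1 : ℝ) :=
        Real.rpow_le_rpow_of_exponent_le one_le_two (by linarith)
    _ = 2 := Real.rpow_one 2

/-- Half of the sum `1 / 12` is the weight `1 / 24` of `blank` nodes; the credits make the weights of
the other kinds smaller. -/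
theorem kindSum_nodeWeight_le (hp : Params H k α) :
    WTree.kindSum (fun κ => ENNReal.ofReal (nodeWeight k α κ)) ≤ ENNReal.ofReal (1 / 12) := by
  have hk : (0 : ℝ) ≤ k := Nat.cast_nonneg k
  have hα := hp.le_third
  have hbad := half_pow_mul_base_pow_le (k := k) (n := badThr k α) (c := 2)
    (Nat.le_ceil ((1 - α) * k)) (by push_cast; nlinarith)
  have hfull := half_pow_mul_base_pow_le (k := k) (n := k) (c := 3) le_rfl (by push_cast; linarith)
  have hacc := half_pow_mul_base_pow_le (k := k) (n := ⌈(1 - 2 * α) * k⌉₊) (c := 1)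
    (Nat.le_ceil ((1 - 2 * α) * k)) (by push_cast; nlinarith)
  have h0 : ∀ κ, 0 ≤ nodeWeight k α κ := fun κ => by
    have := (base_pos k).le
    unfold nodeWeight
    split_ifs <;> positivity
  unfold WTree.kindSum
  rw [← ENNReal.ofReal_add (h0 _) (h0 _), ← ENNReal.ofReal_add (by linarith [h0 .blank, h0 .bad])
    (h0 _), ← ENNReal.ofReal_add (by linarith [h0 .blank, h0 .bad, h0 .inn]) (h0 _),
    ← ENNReal.ofReal_add (by linarith [h0 .blank, h0 .bad, h0 .inn, h0 .out]) (h0 _),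
    ← ENNReal.ofReal_add (by linarith [h0 .blank, h0 .bad, h0 .inn, h0 .out, h0 .full]) (h0 _)]
  refine ENNReal.ofReal_le_ofReal ?_
  simp only [nodeWeight, Kind.IsCover, Kind.thr, Kind.credit, reduceCtorEq, or_self, or_false,
    or_true, if_true, if_false, Nat.zero_sub, pow_zero, mul_one, mul_assoc]
  norm_num at hbad hfull hacc ⊢
  linarith

/-- With one additional factor `d`, the factors `d` of the edges of a tree can be assigned to its
nodes. -/
theorem weight_mul_eq (w : Kind → ℝ≥0∞) (d : ℝ≥0∞) (t : WTree V) (l : ℤ) :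
    t.weight w d * d = ((t.content l).map fun n => w n.kind * d).prod := by
  induction t generalizing l with
  | single e κ => simp [WTree.weight, WTree.content]
  | join t₁ δ t₂ ih₁ ih₂ =>
    rw [WTree.content, Multiset.map_add, Multiset.prod_add, ← ih₁, ← ih₂, WTree.weight]
    ring

theorem nodeWeight_mul (κ : Kind) : ENNReal.ofReal (nodeWeight k α κ) *
    ENNReal.ofReal (24 / base k) * ENNReal.ofReal (base k) =
      (if κ.IsCover then 2 else 1) * κ.prob k α * ENNReal.ofReal (base k) ^ κ.credit := by
  have hb := base_pos k
  have h0 : 0 ≤ nodeWeight k α κ := by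
    unfold nodeWeight
    split_ifs <;> positivity
  have h1 : κ.prob k α = ENNReal.ofReal ((1 / 2) ^ (κ.thr k α - 1)) := by
    rw [Kind.prob, ENNReal.ofReal_pow (by norm_num), one_div, ENNReal.ofReal_inv_of_pos two_pos]
    norm_num
  have h2 : (if κ.IsCover then 2 else 1 : ℝ≥0∞) =
      ENNReal.ofReal (if κ.IsCover then 2 else 1) := by
    split_ifs <;> simp
  rw [h1, h2, ← ENNReal.ofReal_pow hb.le, ← ENNReal.ofReal_mul h0,
    ← ENNReal.ofReal_mul (by positivity), ← ENNReal.ofReal_mul (by split_ifs <;> norm_num),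
    ← ENNReal.ofReal_mul (by split_ifs <;> positivity)]
  congr 1
  unfold nodeWeight
  field_simp

/-- The weights of the nodes of a tree, regrouped: a factor 2 for each covering node, the
probabilities, and the powers of the base that are given by the credits and the nodes. -/
theorem prod_nodeWeight (M : Multiset (Node V)) :
    (M.map fun n => ENNReal.ofReal (nodeWeight k α n.kind) * ENNReal.ofReal (24 / base k)).prod *
      ENNReal.ofReal (base k) ^ M.card =
    2 ^ numCover M * (M.map fun n => n.kind.prob k α).prod *
      ENNReal.ofReal (base k) ^ (M.map fun n => n.kind.credit).sum := by
  induction M using Multiset.induction with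
  | empty => simp [numCover]
  | cons n M ih =>
    have h1 : (2 : ℝ≥0∞) ^ numCover (n ::ₘ M) =
        (if n.kind.IsCover then 2 else 1) * 2 ^ numCover M := by
      unfold numCover
      by_cases h : n.kind.IsCover
      · rw [Multiset.filter_cons_of_pos (p := fun n : Node V => n.kind.IsCover) M h, Multiset.card_cons, pow_succ',
          if_pos h]
      · rw [Multiset.filter_cons_of_neg (p := fun n : Node V => n.kind.IsCover) M h, if_neg h, one_mul]
    rw [h1, Multiset.map_cons, Multiset.prod_cons, Multiset.card_cons, Multiset.map_cons,
      Multiset.prod_cons, Multiset.map_cons, Multiset.sum_cons, pow_succ, pow_add]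
    calc _ = (ENNReal.ofReal (nodeWeight k α n.kind) * ENNReal.ofReal (24 / base k) *
          ENNReal.ofReal (base k)) * ((M.map fun n => ENNReal.ofReal (nodeWeight k α n.kind) *
            ENNReal.ofReal (24 / base k)).prod * ENNReal.ofReal (base k) ^ M.card) := by ring
      _ = _ := by rw [nodeWeight_mul, ih]; ring

/-- The credits of an admissible tree compensate for the factors `24 / base k` of its edges, and the
factors 2 of its covering nodes for the factor `m²`. -/
theorem treePhi_initial_le (hb : 24 ≤ base k) {t : WTree V} (ht : Admissible H t) :
    ((edges H).card : ℝ≥0∞) ^ 2 * treePhi k α (t.content 0) (Memory.initial V) ≤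
      t.weight (fun κ => ENNReal.ofReal (nodeWeight k α κ)) (ENNReal.ofReal (24 / base k)) := by
  set M := t.content 0 with hM
  set E := ENNReal.ofReal (base k) with hE
  have hE1 : 1 ≤ E := by
    rw [hE, ← ENNReal.ofReal_one]
    exact ENNReal.ofReal_le_ofReal (by linarith)
  have hd1 : ENNReal.ofReal (24 / base k) ≤ 1 := by
    rw [← ENNReal.ofReal_one]
    exact ENNReal.ofReal_le_ofReal ((div_le_one (base_pos k)).2 hb)
  -- The power of the base that remains has exponent `∑ credit - M.card ≥ 0`.
  have hcredit : M.card ≤ (M.map fun n => n.kind.credit).sum := by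
    have h1 := ht.surplus
    rw [surplus, ← hM] at h1
    have h2 : (M.map fun n => (n.kind.credit : ℤ)).sum =
        ((M.map fun n => n.kind.credit).sum : ℕ) := by
      rw [Nat.cast_multiset_sum, Multiset.map_map]
      rfl
    omega
  -- There are more than `2 log₂ m` covering nodes.
  have hsize : ((edges H).card : ℝ≥0∞) ^ 2 ≤ 2 ^ numCover M := by
    rcases (edges H).card.eq_zero_or_pos with h0 | h0
    · simp [h0]
    have h1 := ht.size
    rw [← hM] at h1
    have h2 : ((edges H).card : ℝ) ^ 2 ≤ 2 ^ numCover M := by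
      have h3 : (0 : ℝ) < ((edges H).card : ℝ) := by exact_mod_cast h0
      calc ((edges H).card : ℝ) ^ 2 = (2 : ℝ) ^ (2 * Real.logb 2 ((edges H).card : ℝ)) := by
            rw [mul_comm, Real.rpow_mul two_pos.le, Real.rpow_logb two_pos (by norm_num) h3]
            norm_num
        _ ≤ (2 : ℝ) ^ (numCover M : ℝ) := Real.rpow_le_rpow_of_exponent_le one_le_two h1.le
        _ = _ := Real.rpow_natCast 2 _
    have h3 : (edges H).card ^ 2 ≤ 2 ^ numCover M := by exact_mod_cast h2
    exact_mod_cast h3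
  have hprod := prod_nodeWeight (k := k) (α := α) M
  rw [hM, ← weight_mul_eq (fun κ => ENNReal.ofReal (nodeWeight k α κ)), ← hM, ← hE] at hprod
  have hEN : E ^ M.card ≠ 0 := pow_ne_zero _ (by
    intro h0
    rw [h0] at hE1
    simp at hE1)
  have hET : E ^ M.card ≠ ⊤ := ENNReal.pow_ne_top ENNReal.ofReal_ne_top
  have hle : treePhi k α M (Memory.initial V) ≤ (M.map fun n => n.kind.prob k α).prod :=
    prod_map_le_prod_map _ _ _ fun n _ => nodePhi_initial_le M n
  calc ((edges H).card : ℝ≥0∞) ^ 2 * treePhi k α M (Memory.initial V)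
      ≤ 2 ^ numCover M * (M.map fun n => n.kind.prob k α).prod := by gcongr
    _ ≤ t.weight (fun κ => ENNReal.ofReal (nodeWeight k α κ)) (ENNReal.ofReal (24 / base k)) *
        ENNReal.ofReal (24 / base k) := by
        refine (ENNReal.mul_le_mul_iff_left hEN hET).1 ?_
        rw [hprod]
        gcongr
    _ ≤ _ := mul_le_of_le_one_right' hd1

theorem potential_initial : potential H k α (Memory.initial V) =
    ∑' t : WTree V, if Admissible H t then treePhi k α (t.content 0) (Memory.initial V) else 0 := by
  unfold potential
  rw [if_neg, if_neg]
  · simp [Memory.initial]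
  · rintro ⟨C, hC, -⟩
    simp [Memory.initial] at hC

/-- If no two edges intersect, then a valid tree has only one node, which is less than
`2 log₂ m`. -/
theorem not_admissible_of_maxEdgeDegree_eq_zero (h0 : maxEdgeDegree H = 0)
    (hm : 2 ≤ (edges H).card) (t : WTree V) : ¬ Admissible H t := by
  intro ht
  have hlog : 1 ≤ Real.logb 2 ((edges H).card : ℝ) := by
    rw [Real.le_logb_iff_rpow_le one_lt_two (by positivity), Real.rpow_one]
    exact_mod_cast hm
  cases t with
  | single e κ =>
    have h1 := ht.size
    have h2 : numCover ((WTree.single e κ).content 0) ≤ 1 :=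
      (Multiset.card_le_card (Multiset.filter_le _ _)).trans (by simp [WTree.content])
    have h3 : (numCover ((WTree.single e κ).content 0) : ℝ) ≤ 1 := by exact_mod_cast h2
    linarith
  | join t₁ δ t₂ =>
    have hroot := ht.valid.1.edge_mem (t₁.root_mem_content 0)
    have h1 : (nbrs H t₁.rootEdge).card ≤ 0 :=
      h0 ▸ Finset.le_sup (f := fun e => (nbrs H e).card) hroot
    rw [Nat.le_zero, Finset.card_eq_zero] at h1
    exact Finset.notMem_empty _ (h1 ▸ ht.valid.2.2)

/-- The union bound: each of the `m` edges is the root of trees of total weight at most `1 / 6`, and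
the weight of an admissible tree exceeds its initial potential at least by the factor `m²`. -/
theorem sq_mul_potential_initial_le (hp : Params H k α) (hm : 2 ≤ (edges H).card)
    (hdeg : (maxEdgeDegree H : ℝ) ≤ 1 / 192 * (2 : ℝ) ^ ((k : ℝ) / 3)) :
    ((edges H).card : ℝ≥0∞) ^ 2 * potential H k α (Memory.initial V) ≤
      (edges H).card * ENNReal.ofReal (1 / 6) := by
  rw [potential_initial]
  -- If `Δ = 0`, then there is no lower bound for the base.
  rcases Nat.eq_zero_or_pos (maxEdgeDegree H) with h0 | h0
  · simp [not_admissible_of_maxEdgeDegree_eq_zero h0 hm]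
  have hdeg' : 24 * (maxEdgeDegree H : ℝ) ≤ base k := by
    unfold base
    linarith
  have hb : 24 ≤ base k := by
    have : (1 : ℝ) ≤ maxEdgeDegree H := by exact_mod_cast h0
    linarith
  have hd : ∀ x ∈ edges H, ((nbrs H x).card : ℝ≥0∞) * ENNReal.ofReal (24 / base k) ≤ 1 := by
    intro x hx
    rw [← ENNReal.ofReal_natCast, ← ENNReal.ofReal_mul (Nat.cast_nonneg _), ← ENNReal.ofReal_one]
    refine ENNReal.ofReal_le_ofReal ?_
    have h1 : (nbrs H x).card ≤ maxEdgeDegree H :=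
      Finset.le_sup (f := fun e => (nbrs H e).card) hx
    have h2 : ((nbrs H x).card : ℝ) ≤ maxEdgeDegree H := by exact_mod_cast h1
    rw [← mul_div_assoc, div_le_one (base_pos k)]
    linarith
  -- The value `G = 1 / 6` maximizes `G - 3 G²`, and the maximum is `1 / 12`.
  have hG : WTree.kindSum (fun κ => ENNReal.ofReal (nodeWeight k α κ)) +
      3 * (ENNReal.ofReal (1 / 6) * ENNReal.ofReal (1 / 6)) ≤ ENNReal.ofReal (1 / 6) := by
    have h3 : (3 : ℝ≥0∞) = ENNReal.ofReal 3 := by norm_num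
    rw [h3, ← ENNReal.ofReal_mul (by norm_num), ← ENNReal.ofReal_mul (by norm_num)]
    refine (add_le_add_left (kindSum_nodeWeight_le hp) _).trans ?_
    rw [← ENNReal.ofReal_add (by norm_num) (by norm_num)]
    exact ENNReal.ofReal_le_ofReal (by norm_num)
  set w : Kind → ℝ≥0∞ := fun κ => ENNReal.ofReal (nodeWeight k α κ) with hw
  set d := ENNReal.ofReal (24 / base k) with hd'
  calc ((edges H).card : ℝ≥0∞) ^ 2 * ∑' t : WTree V, (if Admissible H t then
        treePhi k α (t.content 0) (Memory.initial V) else 0)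
      ≤ ∑' t : WTree V, ∑ x ∈ edges H,
          (if t.Valid H ∧ t.rootEdge = x then t.weight w d else 0) := by
        rw [← ENNReal.tsum_mul_left]
        refine ENNReal.tsum_le_tsum fun t => ?_
        split_ifs with ht
        · have hroot := ht.valid.edge_mem (t.root_mem_content 0)
          refine (treePhi_initial_le hb ht).trans ?_
          refine le_trans (le_of_eq ?_) (Finset.single_le_sum (f := fun x =>
            if t.Valid H ∧ t.rootEdge = x then t.weight w d else 0) (fun _ _ => zero_le) hroot)
          exact (if_pos ⟨ht.valid, rfl⟩).symm
        · simp
    _ = ∑ x ∈ edges H, ∑' t : WTree V,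
          (if t.Valid H ∧ t.rootEdge = x then t.weight w d else 0) :=
        Summable.tsum_finsetSum fun _ _ => ENNReal.summable
    _ ≤ ∑ x ∈ edges H, ENNReal.ofReal (1 / 6) :=
        Finset.sum_le_sum fun x hx => WTree.tsum_weight_le hd hG hx
    _ = _ := by rw [Finset.sum_const, nsmul_eq_mul]

end InitialPotential

/-- The condition of the local lemma, with `x = α k`, implies that `k` and `α` are positive. -/
theorem one_le_mul_of_lll {D x : ℝ} (hD : 0 ≤ D) (h : 2 * Real.exp 1 * (D + 1) < (2 : ℝ) ^ x) :
    1 ≤ x := by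
  have h1 : (2 : ℝ) ≤ Real.exp 1 := by linarith [Real.add_one_le_exp (1 : ℝ)]
  have h2 : (2 : ℝ) ^ (1 : ℝ) < 2 ^ x := by
    rw [Real.rpow_one]
    nlinarith
  exact ((Real.rpow_lt_rpow_left_iff one_lt_two).1 h2).le

/-- The probability that a large component is found is at most the initial potential. -/
theorem prob_largeFound_le {V : Type u} [Fintype V] {H : Hypergraph V} {k : ℕ} {α : ℝ}
    (hp : Params H k α) (σ : Schedule V) (vs : List V) :
    (run H k α σ vs (Memory.initial V)).toOuterMeasure
        {s | ∃ C ∈ s.found, componentBound H < (C.card : ℝ)} ≤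
      potential H k α (Memory.initial V) := by
  refine le_trans ?_ (spec_run (σ := σ) hp vs _ (Or.inr (idle_initial hp))).2
  rw [PMF.toOuterMeasure_apply]
  refine ENNReal.tsum_le_tsum fun s => ?_
  by_cases h : LargeFound H s
  · refine (Set.indicator_le_self _ _ s).trans ?_
    rw [potential, if_pos h, mul_one]
  · exact (Set.indicator_of_notMem (s := {s : Memory V | LargeFound H s}) h _).le.trans zero_le

end HypergraphLCA

end

theorem mainTheorem4 {V : Type*} [Fintype V] (H : Hypergraph V) (k : ℕ) (α : ℝ)
    (hunif : HypergraphLCA.IsUniform H k)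
    (hm : (HypergraphLCA.edges H).Nonempty)
    (hα : α ≤ 1 / 3)
    (hLLL : 2 * Real.exp 1 * ((HypergraphLCA.maxEdgeDegree H : ℝ) + 1) < (2 : ℝ) ^ (α * (k : ℝ)))
    (hdeg : (HypergraphLCA.maxEdgeDegree H : ℝ) ≤ 1 / 192 * (2 : ℝ) ^ ((k : ℝ) / 3))
    (σ : HypergraphLCA.Schedule V)
    (queries : List V) (hq : ∀ v ∈ queries, v ∈ H.vertexSet) :
    ((HypergraphLCA.run H k α σ queries (HypergraphLCA.Memory.initial V)).toOuterMeasure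
        {s | ∃ C ∈ s.found, HypergraphLCA.componentBound H < (C.card : ℝ)}).toReal
      < 2 / ((HypergraphLCA.edges H).card : ℝ) := by
  have hp : HypergraphLCA.Params H k α :=
    ⟨hunif, HypergraphLCA.one_le_mul_of_lll (Nat.cast_nonneg _) hLLL, hα⟩
  set S : Set (HypergraphLCA.Memory V) :=
    {s | ∃ C ∈ s.found, HypergraphLCA.componentBound H < (C.card : ℝ)} with hS
  set μ := HypergraphLCA.run H k α σ queries (HypergraphLCA.Memory.initial V) with hμ
  have hle := HypergraphLCA.prob_largeFound_le hp σ queries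
  rw [← hμ, ← hS] at hle
  have hone : μ.toOuterMeasure S ≤ 1 := by
    rw [PMF.toOuterMeasure_apply, ← μ.tsum_coe]
    exact ENNReal.tsum_le_tsum fun s => Set.indicator_le_self _ _ s
  have hpos : (0 : ℝ) < ((HypergraphLCA.edges H).card : ℝ) := by
    exact_mod_cast Finset.card_pos.2 hm
  by_cases h2 : 2 ≤ (HypergraphLCA.edges H).card
  · have h3 := (mul_le_mul_right hle _).trans
      (HypergraphLCA.sq_mul_potential_initial_le hp h2 hdeg)
    have h4 := ENNReal.toReal_mono
      (ENNReal.mul_ne_top (ENNReal.natCast_ne_top _) ENNReal.ofReal_ne_top) h3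
    rw [ENNReal.toReal_mul, ENNReal.toReal_mul, ENNReal.toReal_pow, ENNReal.toReal_natCast,
      ENNReal.toReal_ofReal (by norm_num)] at h4
    rw [lt_div_iff₀ hpos]
    nlinarith
  · -- There is only one edge, and the bound on the probability is trivial.
    have h3 : (HypergraphLCA.edges H).card = 1 := by
      have := Finset.card_pos.2 hm
      omega
    have h4 := ENNReal.toReal_mono ENNReal.one_ne_top hone
    rw [h3]
    norm_num at h4 ⊢
    linarith
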